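/- Let $d\ge 2$ be an integer and $\epsilon>0$ a real number. A quantum strategy with question sets $\{0,1,2\}$, $\{0,1,2,3\}$ and answer sets $\{0,\dots,d-1\}$, $\{0,\dots,d-1\}$ consists of Hilbert spaces $\mathcal H_A,\mathcal H_B$, a unit vector $|\psi\rangle\in\mathcal H_A\otimes\mathcal H_B$, and projective measurements $\{\Pi^a_{A_x}\}_a$ on $\mathcal H_A$ and $\{\Pi^b_{B_y}\}_b$ on $\mathcal H_B$; it produces the correlation $p(a,b|x,y)=\langle\psi|\Pi^a_{A_x}\otimes\Pi^b_{B_y}|\psi\rangle$. Let $\mathcal C_q^{3,4,d,d}$ be the set of all correlations so produced. All answers are read modulo $d$. For $0\le m<\lfloor d/2\rfloor$ put $$[\mathrm{CHSH}_m]_p=\sum_{x,y\in\{0,1\}}\ \sum_{a,b\in\{2m,2m+1\}}(-1)^{a+b+xy}\,p(a,b|x,y),$$ $$[\mathrm{CHSH}'_m]_p=\sum_{x\in\{0,2\},\,y\in\{2,3\}}\ \sum_{a,b\in\{2m+1,2m+2\}}(-1)^{a+b+f(x)g(y)}\,p(a,b|x,y),$$ where $f(0)=0,\ f(2)=1,\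 g(2)=0,\ g(3)=1$. Let $[\mathrm{CROSS}]_p$ be the sum of $p(a,b|x,y)$ over $x,y\in\{0,1\}$ and all $(a,b)\notin\bigcup_m\{2m,2m+1\}^2$, where for odd $d$ the pair $(d-1,d-1)$ is left out of the sum. Let $[\mathrm{CROSS}']_p$ be the sum of $p(a,b|x,y)$ over $x\in\{0,2\}$, $y\in\{2,3\}$ and all $(a,b)\notin\bigcup_m\{2m+1,2m+2\}^2$, where for odd $d$ the pair $(0,0)$ is left out of the sum. Define $$[\mathcal B]_p=\sum_m[\mathrm{CHSH}_m]_p+\mathbb 1_{\{d>2\}}\sum_m[\mathrm{CHSH}'_m]_p-\epsilon\,([\mathrm{CROSS}]_p+[\mathrm{CROSS}']_p)+\mathbb 1_{\{d\text{ odd}\}}\frac{\sqrt2}{2}\Big(\sum_{x,y\in\{0,1\}}p(d-1,d-1|x,y)+\sum_{x\in\{0,2\},\,y\in\{2,3\}}p(0,0|x,y)\Big).$$ Then the maximum of $[\mathcal B]_p$ over $p\in\mathcal C_q^{3,4,d,d}$ exists and equals the quantum bound $2\sqrt2\,(1+\mathbb 1_{\{d>2\}})$. If $d>2$, exactly one $p\in\mathcal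 C_q^{3,4,d,d}$ attains it. If $d=2$ (where $\mathcal B$ is the standard CHSH functional and involves only the questions $x,y\in\{0,1\}$), all $p\in\mathcal C_q^{3,4,2,2}$ that attain it have the same restriction to the questions $x,y\in\{0,1\}$. Moreover, for every $d\ge2$, every $p\in\mathcal C_q^{3,4,d,d}$ that attains the maximum self-tests the state $|\Psi\rangle=\frac1{\sqrt d}\sum_{i=0}^{d-1}|ii\rangle$: for every quantum strategy producing $p$, with state $|\psi\rangle\in\mathcal H_A\otimes\mathcal H_B$, there are Hilbert spaces $\mathcal K_A,\mathcal K_B$, isometries $\Phi_A:\mathcal H_A\to\mathbb C^d\otimes\mathcal K_A$ and $\Phi_B:\mathcal H_B\to\mathbb C^d\otimes\mathcal K_B$, and a unit vector $|\mathrm{aux}\rangle\in\mathcal K_A\otimes\mathcal K_B$ such that, up to reordering tensor factors, $(\Phi_A\otimes\Phi_B)|\psi\rangle=|\Psi\rangle\otimes|\mathrm{aux}\rangle$. -/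

import Mathlib

open scoped TensorProduct

universe u

noncomputable section

/-! Hilbert-space tensor products. -/

/-- The Hilbert-space tensor product of two complex inner product spaces: the completion of the
algebraic tensor product for the inner product `⟪u ⊗ v, u' ⊗ v'⟫ = ⟪u, u'⟫ * ⟪v, v'⟫`. -/
abbrev HilbertTensor (E F : Type*) [NormedAddCommGroup E] [InnerProductSpace ℂ E]
    [NormedAddCommGroup F] [InnerProductSpace ℂ F] : Type _ :=
  UniformSpace.Completion (E ⊗[ℂ] F)

/-- The bounded operator `S ⊗ T` between Hilbert-space tensor products. -/
def opTensor {E F G H : Type*} [NormedAddCommGroup E] [InnerProductSpace ℂ E]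
    [NormedAddCommGroup F] [InnerProductSpace ℂ F] [NormedAddCommGroup G] [InnerProductSpace ℂ G]
    [NormedAddCommGroup H] [InnerProductSpace ℂ H] (S : E →L[ℂ] G) (T : F →L[ℂ] H) :
    HilbertTensor E F →L[ℂ] HilbertTensor G H :=
  (TensorProduct.mapL S T).completion

theorem inner_tensorTensorTensorComm {𝕜 E F G H : Type*} [RCLike 𝕜] [NormedAddCommGroup E]
    [InnerProductSpace 𝕜 E] [NormedAddCommGroup F] [InnerProductSpace 𝕜 F]
    [NormedAddCommGroup G] [InnerProductSpace 𝕜 G] [NormedAddCommGroup H] [InnerProductSpace 𝕜 H]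
    (x y : (E ⊗[𝕜] F) ⊗[𝕜] (G ⊗[𝕜] H)) :
    inner 𝕜 (TensorProduct.tensorTensorTensorComm 𝕜 E F G H x)
      (TensorProduct.tensorTensorTensorComm 𝕜 E F G H y) = inner 𝕜 x y := by
  induction x with
  | zero => simp
  | add x₁ x₂ h₁ h₂ => simp only [map_add, inner_add_left, h₁, h₂]
  | tmul s t =>
    induction s with
    | zero => simp
    | add s₁ s₂ h₁ h₂ => simp only [TensorProduct.add_tmul, map_add, inner_add_left, h₁, h₂]
    | tmul a b =>
      induction t with
      | zero => simp
      | add t₁ t₂ h₁ h₂ => simp only [TensorProduct.tmul_add, map_add, inner_add_left, h₁, h₂]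
      | tmul c e =>
        induction y with
        | zero => simp
        | add y₁ y₂ h₁ h₂ => simp only [map_add, inner_add_right, h₁, h₂]
        | tmul s' t' =>
          induction s' with
          | zero => simp
          | add s₁ s₂ h₁ h₂ =>
            simp only [TensorProduct.add_tmul, map_add, inner_add_right, h₁, h₂]
          | tmul a' b' =>
            induction t' with
            | zero => simp
            | add t₁ t₂ h₁ h₂ =>
              simp only [TensorProduct.tmul_add, map_add, inner_add_right, h₁, h₂]
            | tmul c' e' =>
              simp only [TensorProduct.tensorTensorTensorComm_tmul, TensorProduct.inner_tmul]
              ring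

/-- The reordering of tensor factors `(E ⊗ F) ⊗ (G ⊗ H) → (E ⊗ G) ⊗ (F ⊗ H)`. -/
def shuffle (𝕜 E F G H : Type*) [RCLike 𝕜] [NormedAddCommGroup E] [InnerProductSpace 𝕜 E]
    [NormedAddCommGroup F] [InnerProductSpace 𝕜 F] [NormedAddCommGroup G] [InnerProductSpace 𝕜 G]
    [NormedAddCommGroup H] [InnerProductSpace 𝕜 H] :
    (E ⊗[𝕜] F) ⊗[𝕜] (G ⊗[𝕜] H) →ₗᵢ[𝕜] (E ⊗[𝕜] G) ⊗[𝕜] (F ⊗[𝕜] H) :=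
  (TensorProduct.tensorTensorTensorComm 𝕜 E F G H).toLinearMap.isometryOfInner
    inner_tensorTensorTensorComm

/-- The local space `ℂ^d`. -/
abbrev Qudit (d : ℕ) : Type := EuclideanSpace ℂ (Fin d)

/-- The vector `Ψ ⊗ aux`, for a vector `Ψ` of `ℂ^d ⊗ ℂ^d` and a vector `aux` of `K ⊗ L`, with the
tensor factors ordered so that the first party holds `ℂ^d ⊗ K` and the second `ℂ^d ⊗ L`.
(As `ℂ^d` is finite-dimensional, the algebraic tensor products `ℂ^d ⊗ ℂ^d`, `ℂ^d ⊗ K` and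
`ℂ^d ⊗ L` are already complete.) -/
def withAux {d : ℕ} {K L : Type*} [NormedAddCommGroup K] [InnerProductSpace ℂ K]
    [NormedAddCommGroup L] [InnerProductSpace ℂ L] (Ψ : Qudit d ⊗[ℂ] Qudit d)
    (aux : HilbertTensor K L) : HilbertTensor (Qudit d ⊗[ℂ] K) (Qudit d ⊗[ℂ] L) :=
  ((shuffle ℂ (Qudit d) (Qudit d) K L).toContinuousLinearMap ∘L
    TensorProduct.mkL ℂ (Qudit d ⊗[ℂ] Qudit d) (K ⊗[ℂ] L) Ψ).completion aux

/-- The maximally entangled state `(1/√d) ∑ i, |i⟩ ⊗ |i⟩`. -/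
def maxEntangled (d : ℕ) : Qudit d ⊗[ℂ] Qudit d :=
  ((Real.sqrt d : ℂ))⁻¹ •
    ∑ i : Fin d, EuclideanSpace.single i (1 : ℂ) ⊗ₜ[ℂ] EuclideanSpace.single i (1 : ℂ)

/-! Strategies, correlations and self-testing. -/

/-- A projective measurement with outcomes in `A` on the Hilbert space `H`. -/
structure IsProjectiveMeasurement {A H : Type*} [Fintype A] [NormedAddCommGroup H]
    [InnerProductSpace ℂ H] [CompleteSpace H] (P : A → H →L[ℂ] H) : Prop where
  isProj : ∀ a, IsStarProjection (P a)
  orthogonal : ∀ a a', a ≠ a' → P a * P a' = 0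
  sum_eq_one : ∑ a, P a = 1

/-- A quantum strategy with questions in `X`, `Y` and answers in `A`, `B`: two Hilbert spaces, a
pure state in their tensor product, and a projective measurement for every question. -/
structure QuantumStrategy (X Y A B : Type*) [Fintype A] [Fintype B] where
  HA : Type u
  HB : Type u
  [normedA : NormedAddCommGroup HA]
  [innerA : InnerProductSpace ℂ HA]
  [completeA : CompleteSpace HA]
  [normedB : NormedAddCommGroup HB]
  [innerB : InnerProductSpace ℂ HB]
  [completeB : CompleteSpace HB]
  ψ : HilbertTensor HA HB
  norm_ψ : ‖ψ‖ = 1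
  PA : X → A → HA →L[ℂ] HA
  PB : Y → B → HB →L[ℂ] HB
  isMeasA : ∀ x, IsProjectiveMeasurement (PA x)
  isMeasB : ∀ y, IsProjectiveMeasurement (PB y)

attribute [instance] QuantumStrategy.normedA QuantumStrategy.innerA QuantumStrategy.completeA
  QuantumStrategy.normedB QuantumStrategy.innerB QuantumStrategy.completeB

/-- Families of real numbers; `p x y a b` stands for `p(a, b | x, y)`. -/
abbrev Correlation (X Y A B : Type*) : Type _ := X → Y → A → B → ℝ

/-- The strategy `S` produces `p`: `p(a, b | x, y) = ⟨ψ| Π_{A_x}^a ⊗ Π_{B_y}^b |ψ⟩`. -/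
def QuantumStrategy.Produces {X Y A B : Type*} [Fintype A] [Fintype B]
    (S : QuantumStrategy.{u} X Y A B) (p : Correlation X Y A B) : Prop :=
  ∀ x y a b, inner ℂ S.ψ (opTensor (S.PA x a) (S.PB y b) S.ψ) = (p x y a b : ℂ)

/-- The set of quantum correlations with `m`, `n` questions and `r`, `s` answers. -/
def Cq (m n r s : ℕ) : Set (Correlation (Fin m) (Fin n) (Fin r) (Fin s)) :=
  {p | ∃ S : QuantumStrategy.{u} (Fin m) (Fin n) (Fin r) (Fin s), S.Produces p}

/-- The correlation `p` self-tests the state `Ψ` of `ℂ^d ⊗ ℂ^d`: for every quantum strategy that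
produces `p` there are a local isometry `ΦA ⊗ ΦB` and an auxiliary state `aux` such that
`(ΦA ⊗ ΦB) ψ = Ψ ⊗ aux`. -/
def SelfTestsState {X Y A B : Type*} [Fintype A] [Fintype B] {d : ℕ}
    (p : Correlation X Y A B) (Ψ : Qudit d ⊗[ℂ] Qudit d) : Prop :=
  ∀ S : QuantumStrategy.{u} X Y A B, S.Produces p →
    ∃ (KA : Type u) (_ : NormedAddCommGroup KA) (_ : InnerProductSpace ℂ KA)
      (_ : CompleteSpace KA)
      (KB : Type u) (_ : NormedAddCommGroup KB) (_ : InnerProductSpace ℂ KB)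
      (_ : CompleteSpace KB)
      (ΦA : S.HA →ₗᵢ[ℂ] Qudit d ⊗[ℂ] KA) (ΦB : S.HB →ₗᵢ[ℂ] Qudit d ⊗[ℂ] KB)
      (aux : HilbertTensor KA KB),
      ‖aux‖ = 1 ∧
        opTensor ΦA.toContinuousLinearMap ΦB.toContinuousLinearMap S.ψ = withAux Ψ aux

/-! The Bell operator. Answers are `0, …, d - 1`; natural numbers are read modulo `d`. -/

/-- The CHSH functional with answers in `{k, k + 1}` (modulo `d`), where the questions `qA 0`,
`qA 1` and `qB 0`, `qB 1` play the role of the questions `0`, `1`. -/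
def chshBlock {d : ℕ} [NeZero d] (qA : Fin 2 → Fin 3) (qB : Fin 2 → Fin 4) (k : ℕ)
    (p : Correlation (Fin 3) (Fin 4) (Fin d) (Fin d)) : ℝ :=
  ∑ s : Fin 2, ∑ t : Fin 2, ∑ a ∈ ({k, k + 1} : Finset ℕ), ∑ b ∈ ({k, k + 1} : Finset ℕ),
    (-1 : ℝ) ^ (a + b + (s : ℕ) * (t : ℕ)) *
      p (qA s) (qB t) (Fin.ofNat d a) (Fin.ofNat d b)

/-- `[CHSH_m]_p`: questions `x, y ∈ {0, 1}`, answers in `{2m, 2m + 1}`. -/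
def chsh {d : ℕ} [NeZero d] (m : ℕ) (p : Correlation (Fin 3) (Fin 4) (Fin d) (Fin d)) : ℝ :=
  chshBlock ![0, 1] ![0, 1] (2 * m) p

/-- `[CHSH'_m]_p`: questions `x ∈ {0, 2}`, `y ∈ {2, 3}`, answers in `{2m + 1, 2m + 2}`. -/
def chsh' {d : ℕ} [NeZero d] (m : ℕ) (p : Correlation (Fin 3) (Fin 4) (Fin d) (Fin d)) : ℝ :=
  chshBlock ![0, 2] ![2, 3] (2 * m + 1) p

/-- The pair `(a, b)` lies in one of the squares `{2m + k, 2m + k + 1}²` (modulo `d`), with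
`0 ≤ m < ⌊d / 2⌋`. -/
def InBlock {d : ℕ} [NeZero d] (k : ℕ) (a b : Fin d) : Prop :=
  ∃ m < d / 2, (a = Fin.ofNat d (2 * m + k) ∨ a = Fin.ofNat d (2 * m + k + 1)) ∧
    (b = Fin.ofNat d (2 * m + k) ∨ b = Fin.ofNat d (2 * m + k + 1))

open Classical in
/-- `[CROSS]_p`: the total weight, over `x, y ∈ {0, 1}`, of the pairs of answers outside the
squares `{2m, 2m + 1}²` and, for odd `d`, different from `(d - 1, d - 1)`. -/
def cross {d : ℕ} [NeZero d] (p : Correlation (Fin 3) (Fin 4) (Fin d) (Fin d)) : ℝ :=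
  ∑ x ∈ ({0, 1} : Finset (Fin 3)), ∑ y ∈ ({0, 1} : Finset (Fin 4)), ∑ a : Fin d, ∑ b : Fin d,
    if InBlock 0 a b ∨ (Odd d ∧ a = Fin.ofNat d (d - 1) ∧ b = Fin.ofNat d (d - 1)) then 0
    else p x y a b

open Classical in
/-- `[CROSS']_p`: the total weight, over `x ∈ {0, 2}` and `y ∈ {2, 3}`, of the pairs of answers
outside the squares `{2m + 1, 2m + 2}²` and, for odd `d`, different from `(0, 0)`. -/
def cross' {d : ℕ} [NeZero d] (p : Correlation (Fin 3) (Fin 4) (Fin d) (Fin d)) : ℝ :=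
  ∑ x ∈ ({0, 2} : Finset (Fin 3)), ∑ y ∈ ({2, 3} : Finset (Fin 4)), ∑ a : Fin d, ∑ b : Fin d,
    if InBlock 1 a b ∨ (Odd d ∧ a = 0 ∧ b = 0) then 0 else p x y a b

open Classical in
/-- The Bell operator with penalty `ε`. -/
def bell {d : ℕ} [NeZero d] (ε : ℝ) (p : Correlation (Fin 3) (Fin 4) (Fin d) (Fin d)) : ℝ :=
  ∑ m ∈ Finset.range (d / 2), chsh m p
    + (if 2 < d then 1 else 0) * ∑ m ∈ Finset.range (d / 2), chsh' m p
    - ε * (cross p + cross' p)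
    + (if Odd d then 1 else 0) * (Real.sqrt 2 / 2) *
      (∑ x ∈ ({0, 1} : Finset (Fin 3)), ∑ y ∈ ({0, 1} : Finset (Fin 4)),
          p x y (Fin.ofNat d (d - 1)) (Fin.ofNat d (d - 1))
        + ∑ x ∈ ({0, 2} : Finset (Fin 3)), ∑ y ∈ ({2, 3} : Finset (Fin 4)), p x y 0 0)

/-- The quantum bound `2√2 (1 + 1_{d > 2})`. -/
def quantumBound (d : ℕ) : ℝ := 2 * Real.sqrt 2 * (1 + if 2 < d then 1 else 0)

/-- The restriction of a correlation to the questions `x, y ∈ {0, 1}`. -/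
def restrict01 {d : ℕ} (p : Correlation (Fin 3) (Fin 4) (Fin d) (Fin d)) :
    Correlation (Fin 2) (Fin 2) (Fin d) (Fin d) :=
  fun s t => p (![0, 1] s) (![0, 1] t)

end

/-! The functional splits into two halves: questions {0,1} × {0,1}, and questions {0,2} × {2,3} with
all answers shifted by one. For one half put `u s a = Π^a ψ` and `v t b = Π^b ψ`. Tsirelson's sum of
squares, applied on each block of two answers, writes `2√2` minus the functional as a sum of squared
norms plus `ε` times the cross weight (`blockFunctional_add_defect`). This gives the bound. Equality
holds exactly when the relations `BlockOptimal` do: on each block the observables of the first party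
act on `ψ` as `(B₀ ± B₁)/√2`, the left-over answers agree, and different blocks are uncorrelated.

These relations let every relevant operator of the first party be moved across `ψ` to the second. On
the support of `ψ` the two observables of a block then anticommute, so the second one exchanges the
two projections that make up the first (`BlockOptimal.isLink`). The first half links the answers
`2m` and `2m + 1` of question 0, the second links `2m + 1` and `2m + 2`, and together they connect
all answers. Products of links along this chain are partial isometries onto the projection of answer
0. Taken as the columns of a local isometry on each side, they carry `ψ` to `∑ eᵢ ⊗ eᵢ ⊗ Π⁰ψ`, which
is the maximally entangled state with an auxiliary one (`MirrorSystem.exists_isometries`).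

For uniqueness, all vectors `Π^a ψ`, `Π^b ψ` are fixed real combinations of the projection vectors
of question 0 and the link vectors. The Gram matrix of these is forced, because the expectation in
`ψ` is tracial against operators that have a partner on the other side (`expect_mul_comm`,
`OptimalPair.inner_eval`).

The bound is attained on the maximally entangled state by measuring in bases rotated by 0, π/4 and
±π/8 inside the plane of each block (`blockOptimal_rotated`). -/

noncomputable section

/-! ### Operators on Hilbert-space tensor products and the two commuting representations. -/

section OpTensor

variable {E F G H G' H' : Type*} [NormedAddCommGroup E] [InnerProductSpace ℂ E]
  [NormedAddCommGroup F] [InnerProductSpace ℂ F] [NormedAddCommGroup G] [InnerProductSpace ℂ G]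
  [NormedAddCommGroup H] [InnerProductSpace ℂ H] [NormedAddCommGroup G'] [InnerProductSpace ℂ G']
  [NormedAddCommGroup H'] [InnerProductSpace ℂ H']

/-- The product vector `x ⊗ y` of the Hilbert-space tensor product. -/
def pureTensor (x : E) (y : F) : HilbertTensor E F := ((x ⊗ₜ[ℂ] y : E ⊗[ℂ] F) : HilbertTensor E F)

theorem opTensor_pureTensor (S : E →L[ℂ] G) (T : F →L[ℂ] H) (x : E) (y : F) :
    opTensor S T (pureTensor x y) = pureTensor (S x) (T y) := by
  simp [opTensor, pureTensor]

theorem inner_pureTensor (x x' : E) (y y' : F) :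
    inner ℂ (pureTensor x y) (pureTensor x' y') = inner ℂ x x' * inner ℂ y y' := by
  simp [pureTensor]

theorem pureTensor_add_left (x x' : E) (y : F) :
    pureTensor (x + x') y = pureTensor x y + pureTensor x' y := by
  rw [pureTensor, TensorProduct.add_tmul, UniformSpace.Completion.coe_add]
  rfl

theorem pureTensor_add_right (x : E) (y y' : F) :
    pureTensor x (y + y') = pureTensor x y + pureTensor x y' := by
  rw [pureTensor, TensorProduct.tmul_add, UniformSpace.Completion.coe_add]
  rfl

theorem pureTensor_smul_left (c : ℂ) (x : E) (y : F) :
    pureTensor (c • x) y = c • pureTensor x y := by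
  simp [pureTensor, ← TensorProduct.smul_tmul']

theorem pureTensor_smul_right (c : ℂ) (x : E) (y : F) :
    pureTensor x (c • y) = c • pureTensor x y := by
  simp [pureTensor]

theorem HilbertTensor.clm_ext {f g : HilbertTensor E F →L[ℂ] G}
    (h : ∀ x y, f (pureTensor x y) = g (pureTensor x y)) : f = g := by
  ext v
  induction v using UniformSpace.Completion.induction_on with
  | hp => exact isClosed_eq f.continuous g.continuous
  | ih a =>
    induction a with
    | zero => rw [UniformSpace.Completion.coe_zero, map_zero, map_zero]
    | add a b ha hb => simp only [UniformSpace.Completion.coe_add, map_add, ha, hb]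
    | tmul x y => exact h x y

theorem HilbertTensor.eq_zero_of_inner {v : HilbertTensor E F}
    (h : ∀ x y, inner ℂ v (pureTensor x y) = 0) : v = 0 := by
  have : innerSL ℂ v = 0 := HilbertTensor.clm_ext fun x y => by simpa using h x y
  simpa using congrArg (fun f => f v) this

theorem opTensor_comp (S' : G →L[ℂ] G') (T' : H →L[ℂ] H') (S : E →L[ℂ] G) (T : F →L[ℂ] H) :
    opTensor S' T' ∘L opTensor S T = opTensor (S' ∘L S) (T' ∘L T) :=
  HilbertTensor.clm_ext fun x y => by simp [opTensor_pureTensor]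

theorem opTensor_add_left (S S' : E →L[ℂ] G) (T : F →L[ℂ] H) :
    opTensor (S + S') T = opTensor S T + opTensor S' T :=
  HilbertTensor.clm_ext fun x y => by simp [opTensor_pureTensor, pureTensor_add_left]

theorem opTensor_add_right (S : E →L[ℂ] G) (T T' : F →L[ℂ] H) :
    opTensor S (T + T') = opTensor S T + opTensor S T' :=
  HilbertTensor.clm_ext fun x y => by simp [opTensor_pureTensor, pureTensor_add_right]

theorem opTensor_smul_left (c : ℂ) (S : E →L[ℂ] G) (T : F →L[ℂ] H) :
    opTensor (c • S) T = c • opTensor S T :=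
  HilbertTensor.clm_ext fun x y => by simp [opTensor_pureTensor, pureTensor_smul_left]

theorem opTensor_smul_right (c : ℂ) (S : E →L[ℂ] G) (T : F →L[ℂ] H) :
    opTensor S (c • T) = c • opTensor S T :=
  HilbertTensor.clm_ext fun x y => by simp [opTensor_pureTensor, pureTensor_smul_right]

theorem opTensor_zero_left (T : F →L[ℂ] H) : opTensor (0 : E →L[ℂ] G) T = 0 := by
  simpa using opTensor_smul_left 0 (0 : E →L[ℂ] G) T

theorem opTensor_zero_right (S : E →L[ℂ] G) : opTensor S (0 : F →L[ℂ] H) = 0 := by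
  simpa using opTensor_smul_right 0 S (0 : F →L[ℂ] H)

theorem opTensor_one_one : opTensor (1 : E →L[ℂ] E) (1 : F →L[ℂ] F) = 1 :=
  HilbertTensor.clm_ext fun x y => by simp [opTensor_pureTensor]

theorem opTensor_sum_left {ι : Type*} (s : Finset ι) (S : ι → E →L[ℂ] G) (T : F →L[ℂ] H) :
    opTensor (∑ i ∈ s, S i) T = ∑ i ∈ s, opTensor (S i) T := by
  classical
  induction s using Finset.induction_on with
  | empty => simp [opTensor_zero_left]
  | insert i s hi ih => rw [Finset.sum_insert hi, Finset.sum_insert hi, opTensor_add_left, ih]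

theorem opTensor_sum_right {ι : Type*} (s : Finset ι) (S : E →L[ℂ] G) (T : ι → F →L[ℂ] H) :
    opTensor S (∑ i ∈ s, T i) = ∑ i ∈ s, opTensor S (T i) := by
  classical
  induction s using Finset.induction_on with
  | empty => simp [opTensor_zero_right]
  | insert i s hi ih => rw [Finset.sum_insert hi, Finset.sum_insert hi, opTensor_add_right, ih]

theorem opTensor_adjoint [CompleteSpace E] [CompleteSpace F] [CompleteSpace G] [CompleteSpace H]
    (S : E →L[ℂ] G) (T : F →L[ℂ] H) : (opTensor S T).adjoint = opTensor S.adjoint T.adjoint := by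
  refine HilbertTensor.clm_ext fun x y => ?_
  rw [← sub_eq_zero]
  refine HilbertTensor.eq_zero_of_inner fun x' y' => ?_
  simp [inner_sub_left, ContinuousLinearMap.adjoint_inner_left, opTensor_pureTensor,
    inner_pureTensor]

/-- The representation `M ↦ M ⊗ 1` of the operators of the first party. -/
def leftRep (E F : Type*) [NormedAddCommGroup E] [InnerProductSpace ℂ E] [CompleteSpace E]
    [NormedAddCommGroup F] [InnerProductSpace ℂ F] [CompleteSpace F] :
    (E →L[ℂ] E) →⋆ₐ[ℂ] (HilbertTensor E F →L[ℂ] HilbertTensor E F) where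
  toFun M := opTensor M 1
  map_one' := opTensor_one_one
  map_mul' M N := HilbertTensor.clm_ext fun x y => by simp [opTensor_pureTensor]
  map_zero' := opTensor_zero_left _
  map_add' M N := opTensor_add_left _ _ _
  commutes' c := by
    simp only [Algebra.algebraMap_eq_smul_one, opTensor_smul_left, opTensor_one_one]
  map_star' M := by
    rw [ContinuousLinearMap.star_eq_adjoint, ContinuousLinearMap.star_eq_adjoint,
      opTensor_adjoint, ← ContinuousLinearMap.star_eq_adjoint 1, star_one]

/-- The representation `N ↦ 1 ⊗ N` of the operators of the second party. -/
def rightRep (E F : Type*) [NormedAddCommGroup E] [InnerProductSpace ℂ E] [CompleteSpace E]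
    [NormedAddCommGroup F] [InnerProductSpace ℂ F] [CompleteSpace F] :
    (F →L[ℂ] F) →⋆ₐ[ℂ] (HilbertTensor E F →L[ℂ] HilbertTensor E F) where
  toFun N := opTensor 1 N
  map_one' := opTensor_one_one
  map_mul' M N := HilbertTensor.clm_ext fun x y => by simp [opTensor_pureTensor]
  map_zero' := opTensor_zero_right _
  map_add' M N := opTensor_add_right _ _ _
  commutes' c := by
    simp only [Algebra.algebraMap_eq_smul_one, opTensor_smul_right, opTensor_one_one]
  map_star' M := by
    rw [ContinuousLinearMap.star_eq_adjoint, ContinuousLinearMap.star_eq_adjoint,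
      opTensor_adjoint, ← ContinuousLinearMap.star_eq_adjoint 1, star_one]

variable [CompleteSpace E] [CompleteSpace F]

theorem leftRep_apply (M : E →L[ℂ] E) : leftRep E F M = opTensor M 1 := rfl

theorem rightRep_apply (N : F →L[ℂ] F) : rightRep E F N = opTensor 1 N := rfl

theorem leftRep_mul_rightRep (M : E →L[ℂ] E) (N : F →L[ℂ] F) :
    leftRep E F M * rightRep E F N = opTensor M N :=
  HilbertTensor.clm_ext fun x y => by simp [leftRep_apply, rightRep_apply, opTensor_pureTensor]

theorem leftRep_commute_rightRep (M : E →L[ℂ] E) (N : F →L[ℂ] F) :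
    Commute (leftRep E F M) (rightRep E F N) :=
  HilbertTensor.clm_ext fun x y => by simp [leftRep_apply, rightRep_apply, opTensor_pureTensor]

end OpTensor

/-! ### The support projection of a vector for one party. -/

section Support

variable {A B : Type*} [Ring A] [StarRing A] [Algebra ℂ A] [Ring B] [StarRing B] [Algebra ℂ B]
  {H : Type*} [NormedAddCommGroup H] [InnerProductSpace ℂ H] [CompleteSpace H]

/-- The projection `π` is the support of the vector `ψ` for the representation `L`; the operators
that have a partner in the commuting representation `R` commute with it. -/
structure IsSupport (L : A →⋆ₐ[ℂ] (H →L[ℂ] H)) (R : B →⋆ₐ[ℂ] (H →L[ℂ] H)) (ψ : H) (π : A) :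
    Prop where
  isProj : IsStarProjection π
  map_apply : L π ψ = ψ
  mul_eq_zero : ∀ M, L M ψ = 0 → M * π = 0
  commute : ∀ M N, star M = M → L M ψ = R N ψ → Commute M π

end Support

section SupportExists

/-- The projection onto the orthogonal complement of the common kernel of a family of functionals. -/
theorem exists_proj_of_functionals {E ι : Type*} [NormedAddCommGroup E] [InnerProductSpace ℂ E]
    [CompleteSpace E] (g : ι → E →L[ℂ] ℂ) :
    ∃ π : E →L[ℂ] E, IsStarProjection π ∧ (∀ v y, g y (π v) = g y v) ∧
      (∀ v, (∀ y, g y v = 0) → π v = 0) ∧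
      ∀ M, star M = M → (∀ v, (∀ y, g y v = 0) → ∀ y, g y (M v) = 0) → Commute M π := by
  let K : Submodule ℂ E := ⨅ y, (g y).ker
  have hmem : ∀ v, v ∈ K ↔ ∀ y, g y v = 0 := fun v => by simp [K]
  have hclosed : IsClosed (K : Set E) := by
    have : (K : Set E) = ⋂ y, {v | g y v = 0} := by ext v; simp [hmem]
    rw [this]
    exact isClosed_iInter fun y => isClosed_eq (g y).continuous continuous_const
  have : CompleteSpace K := hclosed.completeSpace_coe
  have hp : IsStarProjection K.starProjection := isStarProjection_starProjection
  have hq : IsStarProjection (1 - K.starProjection) := hp.one_sub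
  have hker : ∀ v, (∀ y, g y v = 0) → (1 - K.starProjection) v = 0 := fun v hv => by
    simp [Submodule.starProjection_eq_self_iff.mpr ((hmem v).mpr hv)]
  have hg : ∀ v y, g y (K.starProjection v) = 0 := fun v y =>
    (hmem _).mp (Submodule.starProjection_apply_mem K v) y
  refine ⟨1 - K.starProjection, hq, fun v y => by simp [hg], hker, fun M hM h => ?_⟩
  set π := 1 - K.starProjection with hπ
  -- `M` preserves the common kernel, so `π M (1 - π) = 0`. As `M` is self-adjoint, taking adjoints
  -- gives the other half of the commutation.
  have h1 : π * M = π * M * π := by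
    have : π * M * K.starProjection = 0 := by
      ext v
      simpa using hker _ (h _ (hg v))
    rw [hπ, mul_sub, mul_one, ← hπ, this, sub_zero]
  have h2 : M * π = π * M * π := by
    simpa [hM, hq.isSelfAdjoint.star_eq, mul_assoc] using congrArg star h1
  rw [Commute, SemiconjBy, h2, ← h1]

variable {E F : Type*} [NormedAddCommGroup E] [InnerProductSpace ℂ E] [CompleteSpace E]
  [NormedAddCommGroup F] [InnerProductSpace ℂ F] [CompleteSpace F]

/-- This does the work of the Schmidt decomposition in any dimension. The vectors `x` orthogonal to
`ψ` in the sense `⟪ψ, x ⊗ y⟫ = 0` for all `y` form a closed subspace, and `π` projects onto its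
complement. If `M ψ = 0`, then `star M` maps into that subspace, hence `M π = 0`. A partner `N`
moves `M` from `x` to `star N` on `y`, so the subspace is stable under `M`. -/
theorem exists_isSupport_left (ψ : HilbertTensor E F) :
    ∃ π, IsSupport (leftRep E F) (rightRep E F) ψ π := by
  let g : F → E →L[ℂ] ℂ := fun y => innerSL ℂ ψ ∘L
    (UniformSpace.Completion.toComplL ∘L (TensorProduct.mkL ℂ E F).flip y)
  have hg : ∀ y x, g y x = inner ℂ ψ (pureTensor x y) := fun y x => rfl
  obtain ⟨π, hπ, h1, h2, h3⟩ := exists_proj_of_functionals g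
  have hadj : ∀ (M : E →L[ℂ] E) x y, inner ℂ (leftRep E F M ψ) (pureTensor x y) =
      g y (star M x) := fun M x y => by
    rw [hg, ← ContinuousLinearMap.adjoint_inner_right, ← ContinuousLinearMap.star_eq_adjoint,
      ← map_star, leftRep_apply, opTensor_pureTensor, one_apply_eq_self]
  have hadj' : ∀ (N : F →L[ℂ] F) x y, inner ℂ (rightRep E F N ψ) (pureTensor x y) =
      g (star N y) x := fun N x y => by
    rw [hg, ← ContinuousLinearMap.adjoint_inner_right, ← ContinuousLinearMap.star_eq_adjoint,
      ← map_star, rightRep_apply, opTensor_pureTensor, one_apply_eq_self]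
  refine ⟨π, hπ, ?_, fun M hM => ?_, fun M N hM hMN => h3 M hM fun v hv y => ?_⟩
  · rw [← sub_eq_zero]
    refine HilbertTensor.eq_zero_of_inner fun x y => ?_
    rw [inner_sub_left, hadj, hπ.isSelfAdjoint.star_eq, h1, hg, sub_self]
  · have : π * star M = 0 := by
      ext v
      refine h2 _ fun y => ?_
      exact (hadj M v y).symm.trans (by rw [hM, inner_zero_left])
    simpa [hπ.isSelfAdjoint.star_eq] using congrArg star this
  · have := hadj M v y
    rw [hM] at this
    rw [← this, hMN, hadj']
    exact hv _

theorem exists_isSupport_right (ψ : HilbertTensor E F) :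
    ∃ π, IsSupport (rightRep E F) (leftRep E F) ψ π := by
  let g : E → F →L[ℂ] ℂ := fun x => innerSL ℂ ψ ∘L
    (UniformSpace.Completion.toComplL ∘L TensorProduct.mkL ℂ E F x)
  have hg : ∀ x y, g x y = inner ℂ ψ (pureTensor x y) := fun y x => rfl
  obtain ⟨π, hπ, h1, h2, h3⟩ := exists_proj_of_functionals g
  have hadj : ∀ (M : E →L[ℂ] E) x y, inner ℂ (leftRep E F M ψ) (pureTensor x y) =
      g (star M x) y := fun M x y => by
    rw [hg, ← ContinuousLinearMap.adjoint_inner_right, ← ContinuousLinearMap.star_eq_adjoint,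
      ← map_star, leftRep_apply, opTensor_pureTensor, one_apply_eq_self]
  have hadj' : ∀ (N : F →L[ℂ] F) x y, inner ℂ (rightRep E F N ψ) (pureTensor x y) =
      g x (star N y) := fun N x y => by
    rw [hg, ← ContinuousLinearMap.adjoint_inner_right, ← ContinuousLinearMap.star_eq_adjoint,
      ← map_star, rightRep_apply, opTensor_pureTensor, one_apply_eq_self]
  refine ⟨π, hπ, ?_, fun M hM => ?_, fun M N hM hMN => h3 M hM fun v hv y => ?_⟩
  · rw [← sub_eq_zero]
    refine HilbertTensor.eq_zero_of_inner fun x y => ?_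
    rw [inner_sub_left, hadj', hπ.isSelfAdjoint.star_eq, h1, hg, sub_self]
  · have : π * star M = 0 := by
      ext v
      refine h2 _ fun y => ?_
      exact (hadj' M y v).symm.trans (by rw [hM, inner_zero_left])
    simpa [hπ.isSelfAdjoint.star_eq] using congrArg star this
  · have := hadj' M y v
    rw [hM] at this
    rw [← this, hMN, hadj]
    exact hv _

end SupportExists
end

noncomputable section

/-! ### One half of the functional: sum of squares, bound and equality case. -/

section Half

/-- The CHSH functional with answers in `{k, k + 1}`, the answer `k` counting as `+1`. -/
def chshAt (p : Fin 2 → Fin 2 → ℕ → ℕ → ℝ) (k : ℕ) : ℝ :=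
  ∑ s : Fin 2, ∑ t : Fin 2, (-1 : ℝ) ^ ((s : ℕ) * (t : ℕ)) *
    (p s t k k - p s t k (k + 1) - p s t (k + 1) k + p s t (k + 1) (k + 1))

/-- The total weight of the pairs of answers in different blocks `{2m, 2m + 1}`. -/
def crossWeight (d : ℕ) (p : Fin 2 → Fin 2 → ℕ → ℕ → ℝ) : ℝ :=
  ∑ s : Fin 2, ∑ t : Fin 2, ∑ a ∈ Finset.range d, ∑ b ∈ Finset.range d,
    if a / 2 = b / 2 then 0 else p s t a b

/-- One half of the Bell functional: a family of CHSH functionals on the blocks `{2m, 2m + 1}`. -/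
def blockFunctional (d : ℕ) (ε : ℝ) (p : Fin 2 → Fin 2 → ℕ → ℕ → ℝ) : ℝ :=
  ∑ m ∈ Finset.range (d / 2), chshAt p (2 * m) - ε * crossWeight d p +
    (if Odd d then 1 else 0) * (Real.sqrt 2 / 2) *
      ∑ s : Fin 2, ∑ t : Fin 2, p s t (d - 1) (d - 1)

theorem sum_range_eq_sum_blocks {M : Type*} [AddCommMonoid M] (d : ℕ) (f : ℕ → M) :
    ∑ i ∈ Finset.range d, f i = ∑ m ∈ Finset.range (d / 2), (f (2 * m) + f (2 * m + 1)) +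
      if Odd d then f (d - 1) else 0 := by
  have key : ∀ n, ∑ i ∈ Finset.range (2 * n), f i =
      ∑ m ∈ Finset.range n, (f (2 * m) + f (2 * m + 1)) := by
    intro n
    induction n with
    | zero => simp
    | succ n ih =>
      rw [Finset.sum_range_succ _ n, ← ih, show 2 * (n + 1) = 2 * n + 1 + 1 by ring,
        Finset.sum_range_succ, Finset.sum_range_succ, add_assoc]
  rcases Nat.even_or_odd' d with ⟨n, rfl | rfl⟩
  · simp [key, Nat.not_odd_iff_even.mpr (even_two_mul n)]
  · have h : (2 * n + 1) / 2 = n := by omega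
    simp [Finset.sum_range_succ, key, h]

variable {V : Type*} [NormedAddCommGroup V] [InnerProductSpace ℝ V]

/-- The vectors `Π_i ψ` of a projective measurement: orthogonal, with squared norms summing to
one. -/
structure IsOutcomeFamily (d : ℕ) (u : ℕ → V) : Prop where
  orthogonal : ∀ i < d, ∀ j < d, i ≠ j → inner ℝ (u i) (u j) = 0
  sum_sq : ∑ i ∈ Finset.range d, ‖u i‖ ^ 2 = 1

/-- The relations between the vectors of the two parties that characterize the maximum of
`blockFunctional`. -/
structure BlockOptimal (d : ℕ) (u v : Fin 2 → ℕ → V) : Prop where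
  diff_zero : ∀ m < d / 2, u 0 (2 * m) - u 0 (2 * m + 1) =
    (Real.sqrt 2 / 2) • ((v 0 (2 * m) - v 0 (2 * m + 1)) + (v 1 (2 * m) - v 1 (2 * m + 1)))
  diff_one : ∀ m < d / 2, u 1 (2 * m) - u 1 (2 * m + 1) =
    (Real.sqrt 2 / 2) • ((v 0 (2 * m) - v 0 (2 * m + 1)) - (v 1 (2 * m) - v 1 (2 * m + 1)))
  last : Odd d → ∀ s t, u s (d - 1) = v t (d - 1)
  cross : ∀ s t, ∀ a < d, ∀ b < d, a / 2 ≠ b / 2 → inner ℝ (u s a) (v t b) = 0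

/-- The nonnegative defect of the CHSH functional on one block. -/
def blockDefect (u v : Fin 2 → ℕ → V) (k : ℕ) : ℝ :=
  ‖(u 0 k - u 0 (k + 1)) -
      (Real.sqrt 2 / 2) • ((v 0 k - v 0 (k + 1)) + (v 1 k - v 1 (k + 1)))‖ ^ 2 +
    ‖(u 1 k - u 1 (k + 1)) -
      (Real.sqrt 2 / 2) • ((v 0 k - v 0 (k + 1)) - (v 1 k - v 1 (k + 1)))‖ ^ 2

/-- Tsirelson's bound as a sum of squares for arbitrary vectors. The cross terms of the two squares
cancel the CHSH expression, and the parallelogram law evaluates `‖y₀ + y₁‖² + ‖y₀ - y₁‖²`. -/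
theorem inner_add_sum_sq_eq (x₀ x₁ y₀ y₁ : V) :
    inner ℝ x₀ (y₀ + y₁) + inner ℝ x₁ (y₀ - y₁) + Real.sqrt 2 / 2 *
      (‖x₀ - (Real.sqrt 2 / 2) • (y₀ + y₁)‖ ^ 2 + ‖x₁ - (Real.sqrt 2 / 2) • (y₀ - y₁)‖ ^ 2) =
      Real.sqrt 2 / 2 * (‖x₀‖ ^ 2 + ‖x₁‖ ^ 2 + (‖y₀‖ ^ 2 + ‖y₁‖ ^ 2)) := by
  have h2 : Real.sqrt 2 ^ 2 = 2 := Real.sq_sqrt (by norm_num)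
  have hq : 0 ≤ Real.sqrt 2 / 2 := by positivity
  rw [norm_sub_sq_real, norm_sub_sq_real, norm_smul, norm_smul, mul_pow, mul_pow,
    inner_smul_right, inner_smul_right, norm_add_sq_real, norm_sub_sq_real,
    Real.norm_of_nonneg hq]
  linear_combination (-(inner ℝ x₀ (y₀ + y₁) + inner ℝ x₁ (y₀ - y₁)) / 2 +
    Real.sqrt 2 / 4 * (‖y₀‖ ^ 2 + ‖y₁‖ ^ 2)) * h2

theorem chshAt_add_blockDefect {u v : Fin 2 → ℕ → V} {k : ℕ}
    (hu : ∀ s, inner ℝ (u s k) (u s (k + 1)) = 0) (hv : ∀ t, inner ℝ (v t k) (v t (k + 1)) = 0) :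
    chshAt (fun s t a b => inner ℝ (u s a) (v t b)) k + Real.sqrt 2 / 2 * blockDefect u v k =
      Real.sqrt 2 / 2 * (∑ s, (‖u s k‖ ^ 2 + ‖u s (k + 1)‖ ^ 2) +
        ∑ t, (‖v t k‖ ^ 2 + ‖v t (k + 1)‖ ^ 2)) := by
  have h := inner_add_sum_sq_eq (u 0 k - u 0 (k + 1)) (u 1 k - u 1 (k + 1))
    (v 0 k - v 0 (k + 1)) (v 1 k - v 1 (k + 1))
  rw [norm_sub_sq_real (u 0 k), norm_sub_sq_real (u 1 k), norm_sub_sq_real (v 0 k),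
    norm_sub_sq_real (v 1 k), hu, hu, hv, hv] at h
  simp only [inner_sub_left, inner_sub_right, inner_add_right] at h
  rw [blockDefect, chshAt]
  simp only [Fin.sum_univ_two, Fin.val_zero, Fin.val_one]
  linear_combination h

/-- Each of the four measurements has total weight 1, which produces `4 · √2/2`. For odd `d` the
blocks miss the weight of the last answer. The bonus restores it: `⟪u, v⟫ = (‖u‖² + ‖v‖² - ‖u -
v‖²)/2`, summed over the four pairs of questions, yields each missing weight exactly once, so `√2/2`
is the right coefficient. -/
theorem blockFunctional_add_defect {d : ℕ} (ε : ℝ) {u v : Fin 2 → ℕ → V}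
    (hu : ∀ s, IsOutcomeFamily d (u s)) (hv : ∀ t, IsOutcomeFamily d (v t)) :
    blockFunctional d ε (fun s t a b => inner ℝ (u s a) (v t b)) +
      (Real.sqrt 2 / 2 * ∑ m ∈ Finset.range (d / 2), blockDefect u v (2 * m) +
        Real.sqrt 2 / 2 * (if Odd d then
          (∑ s : Fin 2, ∑ t : Fin 2, ‖u s (d - 1) - v t (d - 1)‖ ^ 2) / 2 else 0) +
        ε * crossWeight d (fun s t a b => inner ℝ (u s a) (v t b))) = 2 * Real.sqrt 2 := by
  have h1 : ∑ m ∈ Finset.range (d / 2), chshAt (fun s t a b => inner ℝ (u s a) (v t b)) (2 * m) +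
      Real.sqrt 2 / 2 * ∑ m ∈ Finset.range (d / 2), blockDefect u v (2 * m) =
      Real.sqrt 2 / 2 * ∑ m ∈ Finset.range (d / 2),
        (∑ s, (‖u s (2 * m)‖ ^ 2 + ‖u s (2 * m + 1)‖ ^ 2) +
        ∑ t, (‖v t (2 * m)‖ ^ 2 + ‖v t (2 * m + 1)‖ ^ 2)) := by
    rw [Finset.mul_sum, Finset.mul_sum, ← Finset.sum_add_distrib]
    refine Finset.sum_congr rfl fun m hm => ?_
    have hm : m < d / 2 := Finset.mem_range.mp hm
    exact chshAt_add_blockDefect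
      (fun s => (hu s).orthogonal _ (by omega) _ (by omega) (by omega))
      (fun s => (hv s).orthogonal _ (by omega) _ (by omega) (by omega))
  have h2 : ∀ s, _ := fun s => (sum_range_eq_sum_blocks d _).symm.trans (hu s).sum_sq
  have h3 : ∀ s, _ := fun s => (sum_range_eq_sum_blocks d _).symm.trans (hv s).sum_sq
  have a0 := h2 0
  have a1 := h2 1
  have b0 := h3 0
  have b1 := h3 1
  simp only [Finset.sum_add_distrib, Fin.sum_univ_two] at a0 a1 b0 b1 h1
  rw [blockFunctional]
  by_cases ho : Odd d
  · simp only [ho, if_true] at a0 a1 b0 b1 ⊢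
    simp only [Fin.sum_univ_two, @norm_sub_sq_real V]
    linear_combination h1 + Real.sqrt 2 / 2 * (a0 + a1 + b0 + b1)
  · simp only [ho, if_false] at a0 a1 b0 b1 ⊢
    linear_combination h1 + Real.sqrt 2 / 2 * (a0 + a1 + b0 + b1)

theorem blockDefect_nonneg (u v : Fin 2 → ℕ → V) (k : ℕ) : 0 ≤ blockDefect u v k := by
  unfold blockDefect; positivity

theorem crossWeight_nonneg {d : ℕ} {p : Fin 2 → Fin 2 → ℕ → ℕ → ℝ} (hp : ∀ s t a b, 0 ≤ p s t a b) :
    0 ≤ crossWeight d p :=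
  Finset.sum_nonneg fun s _ => Finset.sum_nonneg fun t _ => Finset.sum_nonneg fun a _ =>
    Finset.sum_nonneg fun b _ => by split_ifs <;> simp [hp]

theorem crossWeight_eq_zero_iff {d : ℕ} {p : Fin 2 → Fin 2 → ℕ → ℕ → ℝ}
    (hp : ∀ s t a b, 0 ≤ p s t a b) :
    crossWeight d p = 0 ↔ ∀ s t, ∀ a < d, ∀ b < d, a / 2 ≠ b / 2 → p s t a b = 0 := by
  have h0 : ∀ s t a b, 0 ≤ if a / 2 = b / 2 then 0 else p s t a b := fun s t a b => by
    split_ifs <;> simp [hp]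
  rw [crossWeight, Finset.sum_eq_zero_iff_of_nonneg fun s _ => Finset.sum_nonneg fun t _ =>
    Finset.sum_nonneg fun a _ => Finset.sum_nonneg fun b _ => h0 s t a b]
  refine ⟨fun h s t a ha b hb hab => ?_, fun h s _ => ?_⟩
  · have h1 := h s (Finset.mem_univ _)
    rw [Finset.sum_eq_zero_iff_of_nonneg fun t _ =>
      Finset.sum_nonneg fun a _ => Finset.sum_nonneg fun b _ => h0 s t a b] at h1
    have h2 := h1 t (Finset.mem_univ _)
    rw [Finset.sum_eq_zero_iff_of_nonneg fun a _ => Finset.sum_nonneg fun b _ => h0 s t a b] at h2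
    have h3 := h2 a (Finset.mem_range.mpr ha)
    rw [Finset.sum_eq_zero_iff_of_nonneg fun b _ => h0 s t a b] at h3
    simpa [hab] using h3 b (Finset.mem_range.mpr hb)
  · refine Finset.sum_eq_zero fun t _ => Finset.sum_eq_zero fun a ha =>
      Finset.sum_eq_zero fun b hb => ?_
    split_ifs with hab
    · rfl
    · exact h s t a (Finset.mem_range.mp ha) b (Finset.mem_range.mp hb) hab

theorem blockFunctional_le {d : ℕ} {ε : ℝ} (hε : 0 < ε) {u v : Fin 2 → ℕ → V}
    (hu : ∀ s, IsOutcomeFamily d (u s)) (hv : ∀ t, IsOutcomeFamily d (v t))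
    (hp : ∀ s t a b, 0 ≤ inner ℝ (u s a) (v t b)) :
    blockFunctional d ε (fun s t a b => inner ℝ (u s a) (v t b)) ≤ 2 * Real.sqrt 2 := by
  have h := blockFunctional_add_defect ε hu hv
  have h1 : 0 ≤ ∑ m ∈ Finset.range (d / 2), blockDefect u v (2 * m) :=
    Finset.sum_nonneg fun m _ => blockDefect_nonneg _ _ _
  have h2 : 0 ≤ (if Odd d then
      (∑ s : Fin 2, ∑ t : Fin 2, ‖u s (d - 1) - v t (d - 1)‖ ^ 2) / 2 else 0) := by
    split_ifs <;> positivity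
  have h3 := crossWeight_nonneg (d := d) hp
  have : 0 ≤ Real.sqrt 2 := Real.sqrt_nonneg 2
  have := mul_nonneg (by positivity : 0 ≤ Real.sqrt 2 / 2) h1
  have := mul_nonneg (by positivity : 0 ≤ Real.sqrt 2 / 2) h2
  have := mul_nonneg hε.le h3
  linarith

/-- All three terms of the defect are nonnegative, so at the maximum each vanishes. The strict
positivity of `ε` is what kills the cross weight. -/
theorem blockFunctional_eq_iff {d : ℕ} {ε : ℝ} (hε : 0 < ε) {u v : Fin 2 → ℕ → V}
    (hu : ∀ s, IsOutcomeFamily d (u s)) (hv : ∀ t, IsOutcomeFamily d (v t))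
    (hp : ∀ s t a b, 0 ≤ inner ℝ (u s a) (v t b)) :
    blockFunctional d ε (fun s t a b => inner ℝ (u s a) (v t b)) = 2 * Real.sqrt 2 ↔
      BlockOptimal d u v := by
  have h := blockFunctional_add_defect ε hu hv
  have h1 : 0 ≤ ∑ m ∈ Finset.range (d / 2), blockDefect u v (2 * m) :=
    Finset.sum_nonneg fun m _ => blockDefect_nonneg _ _ _
  have h2 : 0 ≤ (if Odd d then
      (∑ s : Fin 2, ∑ t : Fin 2, ‖u s (d - 1) - v t (d - 1)‖ ^ 2) / 2 else 0) := by
    split_ifs <;> positivity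
  have h3 := crossWeight_nonneg (d := d) hp
  have hq : 0 < Real.sqrt 2 / 2 := by positivity
  have e1 := mul_nonneg hq.le h1
  have e2 := mul_nonneg hq.le h2
  have e3 := mul_nonneg hε.le h3
  constructor
  · intro heq
    have z1 : ∑ m ∈ Finset.range (d / 2), blockDefect u v (2 * m) = 0 :=
      (mul_eq_zero.mp (by linarith)).resolve_left hq.ne'
    have z2 : (if Odd d then
      (∑ s : Fin 2, ∑ t : Fin 2, ‖u s (d - 1) - v t (d - 1)‖ ^ 2) / 2 else 0) = 0 :=
      (mul_eq_zero.mp (by linarith)).resolve_left hq.ne'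
    have z3 := (mul_eq_zero.mp (by linarith :
      ε * crossWeight d (fun s t a b => inner ℝ (u s a) (v t b)) = 0)).resolve_left hε.ne'
    rw [Finset.sum_eq_zero_iff_of_nonneg fun m _ => blockDefect_nonneg _ _ _] at z1
    have z1' : ∀ m < d / 2, _ ∧ _ := fun m hm => by
      have := z1 m (Finset.mem_range.mpr hm)
      rw [blockDefect, add_eq_zero_iff_of_nonneg (sq_nonneg _) (sq_nonneg _)] at this
      simp only [sq_eq_zero_iff, norm_eq_zero, sub_eq_zero] at this
      exact this
    refine ⟨fun m hm => (z1' m hm).1, fun m hm => (z1' m hm).2, fun ho s t => ?_,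
      (crossWeight_eq_zero_iff hp).mp z3⟩
    rw [if_pos ho, div_eq_zero_iff, or_iff_left (by norm_num),
      Finset.sum_eq_zero_iff_of_nonneg fun s _ => Finset.sum_nonneg fun t _ => sq_nonneg _] at z2
    have z4 := z2 s (Finset.mem_univ _)
    rw [Finset.sum_eq_zero_iff_of_nonneg fun t _ => sq_nonneg _] at z4
    simpa [sub_eq_zero] using z4 t (Finset.mem_univ _)
  · intro ho
    have z1 : ∑ m ∈ Finset.range (d / 2), blockDefect u v (2 * m) = 0 :=
      Finset.sum_eq_zero fun m hm => by
        have hm := Finset.mem_range.mp hm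
        simp [blockDefect, ho.diff_zero m hm, ho.diff_one m hm]
    have z2 : (if Odd d then
      (∑ s : Fin 2, ∑ t : Fin 2, ‖u s (d - 1) - v t (d - 1)‖ ^ 2) / 2 else 0) = 0 := by
      split_ifs with hodd
      · simp [fun s t => sub_eq_zero.mpr (ho.last hodd s t)]
      · rfl
    rw [z1, z2, (crossWeight_eq_zero_iff hp).mpr ho.cross] at h
    linarith

end Half
end

noncomputable section

/-! ### The Bell functional as the sum of its two halves. -/

section Bell

variable {d : ℕ} [NeZero d]

theorem Fin.ofNat_add_inj_of_lt {k i j : ℕ} (hi : i < d) (hj : j < d) :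
    Fin.ofNat d (i + k) = Fin.ofNat d (j + k) ↔ i = j := by
  refine ⟨fun h => ?_, fun h => by rw [h]⟩
  have h1 : (i + k) % d = (j + k) % d := congrArg Fin.val h
  have h2 : i ≡ j [MOD d] := Nat.ModEq.add_right_cancel' k h1
  exact h2.eq_of_lt_of_lt hi hj

theorem Fin.sum_univ_eq_sum_range_shift {M : Type*} [AddCommMonoid M] (k : ℕ) (g : Fin d → M) :
    ∑ a, g a = ∑ i ∈ Finset.range d, g (Fin.ofNat d (i + k)) := by
  rw [Finset.sum_range, ← Equiv.sum_comp (Equiv.addRight (Fin.ofNat d k))]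
  refine Finset.sum_congr rfl fun a _ => congrArg g (Fin.ext ?_)
  simp [Fin.val_add]

/-- The correlation restricted to two questions per party, with the answers shifted by `k`. -/
def Correlation.pull (qA : Fin 2 → Fin 3) (qB : Fin 2 → Fin 4) (k : ℕ)
    (p : Correlation (Fin 3) (Fin 4) (Fin d) (Fin d)) : Fin 2 → Fin 2 → ℕ → ℕ → ℝ :=
  fun s t a b => p (qA s) (qB t) (Fin.ofNat d (a + k)) (Fin.ofNat d (b + k))

/-- A common shift `k` of both answers does not change the parity of `a + b`, so the signs of the
primed functional are those of the unprimed one. -/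
theorem chshBlock_eq_chshAt (qA : Fin 2 → Fin 3) (qB : Fin 2 → Fin 4) (k m : ℕ)
    (p : Correlation (Fin 3) (Fin 4) (Fin d) (Fin d)) :
    chshBlock qA qB (2 * m + k) p = chshAt (p.pull qA qB k) (2 * m) := by
  have h : 2 * m + k + 1 = 2 * m + 1 + k := by ring
  have hk : ((-1 : ℝ) ^ k) ^ 2 = 1 := by rw [← pow_mul, mul_comm, pow_mul]; simp
  have hm : ((-1 : ℝ) ^ m) ^ 4 = 1 := by rw [← pow_mul, mul_comm, pow_mul]; norm_num
  unfold chshBlock chshAt Correlation.pull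
  refine Finset.sum_congr rfl fun s _ => Finset.sum_congr rfl fun t _ => ?_
  rw [Finset.sum_pair (by omega), Finset.sum_pair (by omega), Finset.sum_pair (by omega), h]
  have e1 : (-1 : ℝ) ^ (2 * m + k + (2 * m + k) + (s : ℕ) * (t : ℕ)) =
    (-1) ^ ((s : ℕ) * (t : ℕ)) := by
    rw [pow_add, Even.neg_one_pow ⟨2 * m + k, rfl⟩, one_mul]
  have e2 : (-1 : ℝ) ^ (2 * m + k + (2 * m + 1 + k) + (s : ℕ) * (t : ℕ)) =
    -(-1) ^ ((s : ℕ) * (t : ℕ)) := by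
    rw [pow_add, Odd.neg_one_pow ⟨2 * m + k, by ring⟩, neg_one_mul]
  have e3 : (-1 : ℝ) ^ (2 * m + 1 + k + (2 * m + k) + (s : ℕ) * (t : ℕ)) =
    -(-1) ^ ((s : ℕ) * (t : ℕ)) := by
    rw [pow_add, Odd.neg_one_pow ⟨2 * m + k, by ring⟩, neg_one_mul]
  have e4 : (-1 : ℝ) ^ (2 * m + 1 + k + (2 * m + 1 + k) + (s : ℕ) * (t : ℕ)) =
    (-1) ^ ((s : ℕ) * (t : ℕ)) := by
    rw [pow_add, Even.neg_one_pow ⟨2 * m + 1 + k, rfl⟩, one_mul]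
  rw [e1, e2, e3, e4]
  ring

/-- Division by 2 names the block. For odd `d` the left-over answer `d - 1` is alone in its class `d
/ 2`, so the exceptional pair needs no separate treatment. -/
theorem inBlock_or_iff {k a b : ℕ} (ha : a < d) (hb : b < d) :
    (InBlock k (Fin.ofNat d (a + k)) (Fin.ofNat d (b + k)) ∨ (Odd d ∧
      Fin.ofNat d (a + k) = Fin.ofNat d (d - 1 + k) ∧
      Fin.ofNat d (b + k) = Fin.ofNat d (d - 1 + k))) ↔ a / 2 = b / 2 := by
  have hd : 0 < d := Nat.pos_of_ne_zero (NeZero.ne d)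
  rw [Fin.ofNat_add_inj_of_lt ha (by omega), Fin.ofNat_add_inj_of_lt hb (by omega), Nat.odd_iff]
  have h : InBlock k (Fin.ofNat d (a + k)) (Fin.ofNat d (b + k)) ↔
      ∃ m < d / 2, (a = 2 * m ∨ a = 2 * m + 1) ∧ (b = 2 * m ∨ b = 2 * m + 1) := by
    refine exists_congr fun m => and_congr_right fun hm => ?_
    rw [show 2 * m + k + 1 = 2 * m + 1 + k by ring, Fin.ofNat_add_inj_of_lt ha (by omega),
      Fin.ofNat_add_inj_of_lt ha (by omega), Fin.ofNat_add_inj_of_lt hb (by omega),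
      Fin.ofNat_add_inj_of_lt hb (by omega)]
  rw [h]
  constructor
  · rintro (⟨m, hm, h1, h2⟩ | h) <;> omega
  · intro hab
    by_cases hlt : a / 2 < d / 2
    · exact Or.inl ⟨a / 2, hlt, by omega, by omega⟩
    · exact Or.inr (by omega)

open Classical in
theorem sum_cross_eq (k : ℕ) (f : Fin d → Fin d → ℝ) (c : Fin d)
    (hc : c = Fin.ofNat d (d - 1 + k)) :
    (∑ a : Fin d, ∑ b : Fin d, if InBlock k a b ∨ (Odd d ∧ a = c ∧ b = c) then 0 else f a b) =
      ∑ a ∈ Finset.range d, ∑ b ∈ Finset.range d, if a / 2 = b / 2 then 0 else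
        f (Fin.ofNat d (a + k)) (Fin.ofNat d (b + k)) := by
  rw [Fin.sum_univ_eq_sum_range_shift k]
  refine Finset.sum_congr rfl fun a ha => ?_
  rw [Fin.sum_univ_eq_sum_range_shift k]
  refine Finset.sum_congr rfl fun b hb => ?_
  subst hc
  simp only [inBlock_or_iff (Finset.mem_range.mp ha) (Finset.mem_range.mp hb)]

/-- The left-over answer of the shifted half is 0, which is why `(0, 0)` replaces `(d - 1, d - 1)`
there. -/
theorem Fin.ofNat_pred_add_one : (0 : Fin d) = Fin.ofNat d (d - 1 + 1) := by
  have hd : 0 < d := Nat.pos_of_ne_zero (NeZero.ne d)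
  refine Fin.ext ?_
  rw [Nat.sub_add_cancel hd]
  simp

theorem cross_eq_crossWeight (p : Correlation (Fin 3) (Fin 4) (Fin d) (Fin d)) :
    cross p = crossWeight d (p.pull ![0, 1] ![0, 1] 0) := by
  simp only [cross, sum_cross_eq 0 _ (Fin.ofNat d (d - 1)) rfl]
  simp [crossWeight, Correlation.pull, Fin.sum_univ_two]

theorem cross'_eq_crossWeight (p : Correlation (Fin 3) (Fin 4) (Fin d) (Fin d)) :
    cross' p = crossWeight d (p.pull ![0, 2] ![2, 3] 1) := by
  simp only [cross', sum_cross_eq 1 _ 0 Fin.ofNat_pred_add_one]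
  have h1 : (0 : Fin 3) ≠ 2 := by decide
  have h2 : (2 : Fin 4) ≠ 3 := by decide
  simp [crossWeight, Correlation.pull, Fin.sum_univ_two, Finset.sum_pair h1, Finset.sum_pair h2]

theorem bell_eq_add {ε : ℝ} (hd : 2 < d) (p : Correlation (Fin 3) (Fin 4) (Fin d) (Fin d)) :
    bell ε p = blockFunctional d ε (p.pull ![0, 1] ![0, 1] 0) +
      blockFunctional d ε (p.pull ![0, 2] ![2, 3] 1) := by
  have h1 : (0 : Fin 3) ≠ 2 := by decide
  have h2 : (2 : Fin 4) ≠ 3 := by decide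
  have c0 : ∀ m, chsh m p = chshAt (p.pull ![0, 1] ![0, 1] 0) (2 * m) := fun m =>
    chshBlock_eq_chshAt _ _ 0 m p
  have c1 : ∀ m, chsh' m p = chshAt (p.pull ![0, 2] ![2, 3] 1) (2 * m) := fun m =>
    chshBlock_eq_chshAt _ _ 1 m p
  simp only [bell, blockFunctional, cross_eq_crossWeight, cross'_eq_crossWeight, c0, c1, if_pos hd,
    Finset.sum_pair h1, Finset.sum_pair h2, Finset.sum_pair (zero_ne_one (α := Fin 3)),
    Finset.sum_pair (zero_ne_one (α := Fin 4)), Fin.sum_univ_two]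
  simp only [Correlation.pull, ← Fin.ofNat_pred_add_one]
  by_cases ho : Odd d <;> simp [ho] <;> ring

theorem bell_eq_of_two {ε : ℝ} (hd : d = 2) (p : Correlation (Fin 3) (Fin 4) (Fin d) (Fin d)) :
    bell ε p = blockFunctional d ε (p.pull ![0, 1] ![0, 1] 0) := by
  have c0 : ∀ m, chsh m p = chshAt (p.pull ![0, 1] ![0, 1] 0) (2 * m) := fun m =>
    chshBlock_eq_chshAt _ _ 0 m p
  have hodd : ¬ Odd d := by subst hd; decide
  -- For `d = 2` there is a single block, so no pair of answers crosses and the penalty on the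
  -- primed questions is empty.
  have hc : cross' p = 0 := by
    rw [cross'_eq_crossWeight, crossWeight]
    refine Finset.sum_eq_zero fun s _ => Finset.sum_eq_zero fun t _ =>
      Finset.sum_eq_zero fun a ha => Finset.sum_eq_zero fun b hb => if_pos ?_
    have ha := Finset.mem_range.mp ha
    have hb := Finset.mem_range.mp hb
    omega
  simp only [bell, blockFunctional, cross_eq_crossWeight, hc, c0, if_neg hodd,
    if_neg (show ¬ 2 < d by omega)]
  ring

end Bell
end

noncomputable section

/-! ### Chains of projections exchanged by links, and the partial isometries along them. -/

section Chain

/-- `X` exchanges the projections `p` and `q`, and is a self-adjoint unitary on their sum. -/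
structure IsLink {A : Type*} [Ring A] [StarRing A] (p q X : A) : Prop where
  star_eq : star X = X
  mul_left : X * p = q * X
  sq : X * X = p + q
  mul_add : X * (p + q) = X

/-- The edges `e — e + 1` of the cycle of answers that are used by one of the CHSH blocks. -/
def IsEdge (d e : ℕ) : Prop := e < d ∧ (Even e → e + 1 < d) ∧ (Odd e → 2 < d)

/-- The transports use only these edges. The remaining one, from `d - 1` around to 0, exists for
even `d > 2` and matters only for the correlation. -/
theorem isEdge_of_succ_lt {d e : ℕ} (h : e + 1 < d) : IsEdge d e :=
  ⟨by omega, fun _ => h, fun ho => by rcases ho with ⟨k, rfl⟩; omega⟩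

/-- Projections `a i` with sum `π`, neighbours being exchanged by the operators `X`. -/
structure ChainSystem {A : Type*} [Ring A] [StarRing A] {d : ℕ} [NeZero d] (π : A) (a : Fin d → A)
    (X : ℕ → A) : Prop where
  isProj_support : IsStarProjection π
  isProj : ∀ i, IsStarProjection (a i)
  orthogonal : ∀ i j, i ≠ j → a i * a j = 0
  sum_eq : ∑ i, a i = π
  link : ∀ e, IsEdge d e → IsLink (a (Fin.ofNat d e)) (a (Fin.ofNat d (e + 1))) (X e)

section Link

variable {A : Type*} [Ring A] [StarRing A] {p q X : A}

theorem IsLink.mul_right (h : IsLink p q X) (hp : star p = p) (hq : star q = q) :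
    p * X = X * q := by
  simpa [h.star_eq, hp, hq] using congrArg star h.mul_left

theorem IsLink.symm (h : IsLink p q X) (hp : star p = p) (hq : star q = q) : IsLink q p X :=
  ⟨h.star_eq, (h.mul_right hp hq).symm, by rw [h.sq, add_comm], by rw [add_comm, h.mul_add]⟩

theorem IsLink.add_mul (h : IsLink p q X) (hp : star p = p) (hq : star q = q) :
    (p + q) * X = X := by
  simpa [h.star_eq, hp, hq] using congrArg star h.mul_add

theorem IsLink.mul_eq_zero (h : IsLink p q X) {r : A} (h1 : p * r = 0) (h2 : q * r = 0) :
    X * r = 0 := by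
  rw [← h.mul_add, mul_assoc, _root_.add_mul, h1, h2, add_zero, mul_zero]

theorem IsLink.eq_zero_mul (h : IsLink p q X) (hp : star p = p) (hq : star q = q) {r : A}
    (h1 : r * p = 0) (h2 : r * q = 0) : r * X = 0 := by
  rw [← h.add_mul hp hq, ← mul_assoc, _root_.mul_add, h1, h2, add_zero, zero_mul]

end Link

namespace ChainSystem

variable {A : Type*} [Ring A] [StarRing A] {d : ℕ} [NeZero d] {π : A} {a : Fin d → A} {X : ℕ → A}

/-- The partial isometries `a 0 * X 0 * ⋯ * X (i - 1)` from `a i` to `a 0`. -/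
def transport (a : Fin d → A) (X : ℕ → A) : ℕ → A
  | 0 => a 0
  | i + 1 => transport a X i * X i

theorem transport_mul (h : ChainSystem π a X) : ∀ i < d, transport a X i * a (Fin.ofNat d i) =
    transport a X i
  | 0, _ => by simpa [transport] using (h.isProj 0).isIdempotentElem.eq
  | i + 1, hi => by
    have hl := h.link i (isEdge_of_succ_lt hi)
    rw [transport, mul_assoc, ← hl.mul_right (h.isProj _).isSelfAdjoint.star_eq
      (h.isProj _).isSelfAdjoint.star_eq, ← mul_assoc, h.transport_mul i (by omega)]

/-- A link carries the initial projection one step along the chain: `Xᵢ aᵢ Xᵢ = aᵢ₊₁ Xᵢ² = aᵢ₊₁`. -/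
theorem star_transport_mul_self (h : ChainSystem π a X) : ∀ i < d,
    star (transport a X i) * transport a X i = a (Fin.ofNat d i)
  | 0, _ => by
    simpa [transport, (h.isProj 0).isSelfAdjoint.star_eq] using (h.isProj 0).isIdempotentElem.eq
  | i + 1, hi => by
    have hl := h.link i (isEdge_of_succ_lt hi)
    have ih := h.star_transport_mul_self i (by omega)
    have h0 := h.isProj (Fin.ofNat d (i + 1))
    have hne : Fin.ofNat d (i + 1) ≠ Fin.ofNat d i := fun hh => by
      have := (Fin.ofNat_add_inj_of_lt (k := 0) hi (by omega)).mp hh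
      omega
    calc star (transport a X (i + 1)) * transport a X (i + 1)
        = X i * (star (transport a X i) * transport a X i) * X i := by
          rw [transport, star_mul, hl.star_eq]; simp only [mul_assoc]
      _ = a (Fin.ofNat d (i + 1)) * (X i * X i) := by rw [ih, hl.mul_left, mul_assoc]
      _ = a (Fin.ofNat d (i + 1)) := by
          rw [hl.sq, mul_add, h.orthogonal _ _ hne, zero_add, h0.isIdempotentElem.eq]

/-- The transport up to `i` absorbs `aᵢ` on its right, so `Xᵢ² = aᵢ + aᵢ₊₁` disappears between it
and its adjoint. -/
theorem transport_mul_star_self (h : ChainSystem π a X) : ∀ i < d,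
    transport a X i * star (transport a X i) = a 0
  | 0, _ => by
    simpa [transport, (h.isProj 0).isSelfAdjoint.star_eq] using (h.isProj 0).isIdempotentElem.eq
  | i + 1, hi => by
    have hl := h.link i (isEdge_of_succ_lt hi)
    have ih := h.transport_mul_star_self i (by omega)
    have ht := h.transport_mul i (by omega)
    have h0 := h.isProj (Fin.ofNat d i)
    have hne : Fin.ofNat d i ≠ Fin.ofNat d (i + 1) := fun hh => by
      have := (Fin.ofNat_add_inj_of_lt (k := 0) (by omega) hi).mp hh
      omega
    calc transport a X (i + 1) * star (transport a X (i + 1))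
        = transport a X i * a (Fin.ofNat d i) * (X i * X i) * star (transport a X i) := by
          rw [ht, transport, star_mul, hl.star_eq]; simp only [mul_assoc]
      _ = transport a X i * a (Fin.ofNat d i) * star (transport a X i) := by
          rw [hl.sq, mul_add, mul_assoc _ (a (Fin.ofNat d i)) (a (Fin.ofNat d (i + 1))),
            h.orthogonal _ _ hne, mul_assoc _ (a (Fin.ofNat d i)) (a (Fin.ofNat d i)),
            h0.isIdempotentElem.eq, mul_zero, add_zero]
      _ = a 0 := by rw [ht, ih]

theorem transport_mul_star_of_ne (h : ChainSystem π a X) {i j : ℕ} (hi : i < d) (hj : j < d)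
    (hij : i ≠ j) : transport a X i * star (transport a X j) = 0 := by
  have hne : Fin.ofNat d i ≠ Fin.ofNat d j := fun hh =>
    hij ((Fin.ofNat_add_inj_of_lt (k := 0) hi hj).mp hh)
  rw [← h.transport_mul i hi, ← h.transport_mul j hj, star_mul,
    (h.isProj _).isSelfAdjoint.star_eq, mul_assoc, ← mul_assoc (a _) (a _), h.orthogonal _ _ hne,
    zero_mul, mul_zero]

theorem support_mul (h : ChainSystem π a X) (i : Fin d) : π * a i = a i := by
  rw [← h.sum_eq, Finset.sum_mul, Finset.sum_eq_single i, (h.isProj i).isIdempotentElem.eq]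
  · exact fun j _ hj => h.orthogonal j i hj
  · simp

theorem support_mul_transport (h : ChainSystem π a X) : ∀ i, π * transport a X i = transport a X i
  | 0 => h.support_mul 0
  | i + 1 => by rw [transport, ← mul_assoc, h.support_mul_transport i]

end ChainSystem

end Chain

/-! ### Moving operators across the state. -/

section Mirror

variable {A B : Type*} [Ring A] [StarRing A] [Algebra ℂ A] [Ring B] [StarRing B] [Algebra ℂ B]
  {H : Type*} [NormedAddCommGroup H] [InnerProductSpace ℂ H] [CompleteSpace H]
  {L : A →⋆ₐ[ℂ] (H →L[ℂ] H)} {R : B →⋆ₐ[ℂ] (H →L[ℂ] H)} {ψ : H}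

/-- Once `M'` has become `N'`, the operator `L M` must pass `R N'` before it meets `ψ`, so products
change order. -/
theorem mirror_mul (hc : ∀ M N, Commute (L M) (R N)) {M M' : A} {N N' : B}
    (h : L M ψ = R N ψ) (h' : L M' ψ = R N' ψ) : L (M * M') ψ = R (N' * N) ψ := by
  rw [map_mul, mul_apply_eq_comp, h', ← mul_apply_eq_comp, (hc M N').eq, mul_apply_eq_comp, h,
    ← mul_apply_eq_comp, ← map_mul]

theorem mirror_add {M M' : A} {N N' : B}
    (h : L M ψ = R N ψ) (h' : L M' ψ = R N' ψ) : L (M + M') ψ = R (N + N') ψ := by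
  rw [map_add, map_add, add_apply, add_apply, h, h']

theorem mirror_sub {M M' : A} {N N' : B}
    (h : L M ψ = R N ψ) (h' : L M' ψ = R N' ψ) : L (M - M') ψ = R (N - N') ψ := by
  rw [map_sub, map_sub, sub_apply, sub_apply, h, h']

theorem mirror_smul (c : ℂ) {M : A} {N : B} (h : L M ψ = R N ψ) :
    L (c • M) ψ = R (c • N) ψ := by
  rw [map_smul, map_smul, smul_apply, smul_apply, h]

end Mirror
end

/-! ### From the equality relations to links on the support. -/

noncomputable section

set_option linter.unusedSectionVars false

/-- A projective measurement with outcomes `0, …, d - 1` in a star ring, indexed by `ℕ`. -/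
structure IsPVM {A : Type*} [Ring A] [StarRing A] (d : ℕ) (α : ℕ → A) : Prop where
  isProj : ∀ i, IsStarProjection (α i)
  orthogonal : ∀ i < d, ∀ j < d, i ≠ j → α i * α j = 0
  sum_eq_one : ∑ i ∈ Finset.range d, α i = 1

theorem IsProjectiveMeasurement.isPVM {d : ℕ} [NeZero d] {H : Type*} [NormedAddCommGroup H]
    [InnerProductSpace ℂ H] [CompleteSpace H] {P : Fin d → H →L[ℂ] H}
    (h : IsProjectiveMeasurement P) (k : ℕ) : IsPVM d (fun i => P (Fin.ofNat d (i + k))) where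
  isProj i := h.isProj _
  orthogonal i hi j hj hij := h.orthogonal _ _ (by rwa [Ne, Fin.ofNat_add_inj_of_lt hi hj])
  sum_eq_one := by rw [← Fin.sum_univ_eq_sum_range_shift k P, h.sum_eq_one]

theorem isStarProjection_mul_of_commute {A : Type*} [Ring A] [StarRing A] {p π : A}
    (hp : IsStarProjection p) (hπ : IsStarProjection π) (h : Commute p π) :
    IsStarProjection (p * π) := by
  refine ⟨?_, ?_⟩
  · rw [IsIdempotentElem, mul_assoc, ← mul_assoc π, ← h.eq, mul_assoc p π π,
      hπ.isIdempotentElem.eq, ← mul_assoc, hp.isIdempotentElem.eq]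
  · rw [isSelfAdjoint_iff, star_mul, hp.isSelfAdjoint.star_eq, hπ.isSelfAdjoint.star_eq, h.eq]

section

attribute [local instance] InnerProductSpace.complexToReal

variable {A B : Type*} [Ring A] [StarRing A] [Algebra ℂ A] [StarModule ℂ A]
  [Ring B] [StarRing B] [Algebra ℂ B] [StarModule ℂ B]
  {H : Type*} [NormedAddCommGroup H] [InnerProductSpace ℂ H] [CompleteSpace H]
  {L : A →⋆ₐ[ℂ] (H →L[ℂ] H)} {R : B →⋆ₐ[ℂ] (H →L[ℂ] H)} {ψ : H}

theorem inner_rep_left (M : A) (x y : H) : inner ℂ (L M x) y = inner ℂ x (L (star M) y) := by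
  rw [map_star, ContinuousLinearMap.star_eq_adjoint, ContinuousLinearMap.adjoint_inner_right]

theorem norm_sq_rep_proj {p : A} (hp : IsStarProjection p) (x : H) :
    ‖L p x‖ ^ 2 = (inner ℂ x (L p x)).re := by
  rw [← inner_self_eq_norm_sq (𝕜 := ℂ), inner_rep_left, hp.isSelfAdjoint.star_eq,
    ← mul_apply_eq_comp, ← map_mul, hp.isIdempotentElem.eq]
  rfl

theorem IsPVM.isOutcomeFamily {d : ℕ} {α : ℕ → A} (h : IsPVM d α) (hψ : ‖ψ‖ = 1) :
    IsOutcomeFamily d (fun i => L (α i) ψ) where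
  orthogonal i hi j hj hij := by
    rw [real_inner_eq_re_inner ℂ, inner_rep_left, (h.isProj i).isSelfAdjoint.star_eq,
      ← mul_apply_eq_comp, ← map_mul, h.orthogonal i hi j hj hij]
    simp
  sum_sq := by
    simp only [norm_sq_rep_proj (h.isProj _), ← Complex.re_sum, ← inner_sum]
    rw [← sum_apply, ← map_sum, h.sum_eq_one, map_one, one_apply_eq_self,
      inner_self_eq_norm_sq_to_K, hψ]
    simp

/-- This makes the probabilities nonnegative and turns a zero probability into the vanishing of the
vector `p q ψ`. -/
theorem inner_proj_proj (hc : ∀ M N, Commute (L M) (R N)) {p : A} {q : B}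
    (hp : IsStarProjection p) (hq : IsStarProjection q) :
    inner ℝ (L p ψ) (R q ψ) = ‖L p (R q ψ)‖ ^ 2 := by
  rw [norm_sq_rep_proj hp, inner_rep_left, hq.isSelfAdjoint.star_eq, real_inner_eq_re_inner ℂ,
    inner_rep_left, hp.isSelfAdjoint.star_eq, ← mul_apply_eq_comp (R q), ← (hc p q).eq,
    mul_apply_eq_comp, ← mul_apply_eq_comp (R q), ← map_mul R, hq.isIdempotentElem.eq]
  rfl

variable {d : ℕ} {α : Fin 2 → ℕ → A} {β : Fin 2 → ℕ → B}

theorem IsPVM.sum_block_apply {β : ℕ → B} (hβ : IsPVM d β) {m : ℕ} (hm : m < d / 2) (T : H →L[ℂ] H)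
    (h : ∀ b < d, b / 2 ≠ m → T (R (β b) ψ) = 0) :
    T ψ = T (R (β (2 * m) + β (2 * m + 1)) ψ) := by
  have h1 : T ψ = ∑ b ∈ Finset.range d, T (R (β b) ψ) := by
    rw [← map_sum, ← sum_apply, ← map_sum, hβ.sum_eq_one, map_one, one_apply_eq_self]
  have h2 : ({2 * m, 2 * m + 1} : Finset ℕ) ⊆ Finset.range d := by
    intro i hi
    simp only [Finset.mem_insert, Finset.mem_singleton] at hi
    simp only [Finset.mem_range]
    omega
  rw [h1, ← Finset.sum_subset h2, Finset.sum_pair (by omega), map_add, add_apply, map_add]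
  intro b hb hb'
  simp only [Finset.mem_insert, Finset.mem_singleton, not_or] at hb'
  exact h b (Finset.mem_range.mp hb) (by omega)

/-- Zero cross weight kills the product of projections from different blocks on `ψ`. Inserting the
identity as the sum of the other party's projections therefore gives `P ψ = P Q ψ` and `Q ψ = Q P ψ`
for the block projections `P` and `Q`, and these commute. -/
theorem BlockOptimal.mirror_block (hc : ∀ M N, Commute (L M) (R N)) (hα : ∀ s, IsPVM d (α s))
    (hβ : ∀ t, IsPVM d (β t))
    (h : BlockOptimal d (fun s i => L (α s i) ψ) (fun t i => R (β t i) ψ)) {m : ℕ}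
    (hm : m < d / 2) (s t : Fin 2) :
    L (α s (2 * m) + α s (2 * m + 1)) ψ = R (β t (2 * m) + β t (2 * m + 1)) ψ := by
  have key : ∀ a < d, ∀ b < d, a / 2 ≠ b / 2 → L (α s a) (R (β t b) ψ) = 0 := by
    intro a ha b hb hab
    have := h.cross s t a ha b hb hab
    rw [inner_proj_proj hc ((hα s).isProj a) ((hβ t).isProj b)] at this
    simpa using this
  have key' : ∀ a < d, ∀ b < d, a / 2 ≠ b / 2 → R (β t b) (L (α s a) ψ) = 0 := by
    intro a ha b hb hab
    rw [← key a ha b hb hab, ← mul_apply_eq_comp, ← mul_apply_eq_comp, (hc _ _).eq]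
  have e1 : L (α s (2 * m) + α s (2 * m + 1)) ψ =
      L (α s (2 * m) + α s (2 * m + 1)) (R (β t (2 * m) + β t (2 * m + 1)) ψ) :=
    (hβ t).sum_block_apply (R := R) hm _ fun b hb hbm => by
      rw [map_add, add_apply, key _ (by omega) b hb (by omega), key _ (by omega) b hb (by omega),
        add_zero]
  have e2 : R (β t (2 * m) + β t (2 * m + 1)) ψ =
      R (β t (2 * m) + β t (2 * m + 1)) (L (α s (2 * m) + α s (2 * m + 1)) ψ) :=
    (hα s).sum_block_apply (R := L) hm _ fun a ha ham => by
      rw [map_add, add_apply, key' a ha _ (by omega) (by omega), key' a ha _ (by omega) (by omega),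
        add_zero]
  refine e1.trans (Eq.trans ?_ e2.symm)
  rw [← mul_apply_eq_comp, (hc _ _).eq, mul_apply_eq_comp]

/-- The operator `(√2 / 2) (B₀ ± B₁)` on one block. -/
def tilted (c : ℂ) (β : Fin 2 → ℕ → B) (k : ℕ) : B :=
  ((Real.sqrt 2 / 2 : ℝ) : ℂ) •
    ((β 0 k - β 0 (k + 1)) + c • (β 1 k - β 1 (k + 1)))

theorem BlockOptimal.mirror_diff_zero
    (h : BlockOptimal d (fun s i => L (α s i) ψ) (fun t i => R (β t i) ψ)) {m : ℕ}
    (hm : m < d / 2) :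
    L (α 0 (2 * m) - α 0 (2 * m + 1)) ψ = R (tilted 1 β (2 * m)) ψ := by
  rw [tilted, map_smul, smul_apply, Complex.coe_smul, one_smul]
  simpa only [map_add, map_sub, add_apply, sub_apply] using h.diff_zero m hm

theorem BlockOptimal.mirror_diff_one
    (h : BlockOptimal d (fun s i => L (α s i) ψ) (fun t i => R (β t i) ψ)) {m : ℕ}
    (hm : m < d / 2) :
    L (α 1 (2 * m) - α 1 (2 * m + 1)) ψ = R (tilted (-1) β (2 * m)) ψ := by
  rw [tilted, map_smul, smul_apply, Complex.coe_smul, neg_one_smul, ← sub_eq_add_neg]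
  simpa only [map_sub, sub_apply] using h.diff_one m hm

theorem star_tilted (hβ : ∀ t i, IsStarProjection (β t i)) {c : ℂ} (hc : star c = c) (k : ℕ) :
    star (tilted c β k) = tilted c β k := by
  have hs : ∀ t i, star (β t i) = β t i := fun t i => (hβ t i).isSelfAdjoint.star_eq
  simp only [tilted, star_smul, star_add, star_sub, hs, hc]
  rw [Complex.star_def, Complex.conj_ofReal]

theorem IsPVM.diff_sq {β : ℕ → B} (hβ : IsPVM d β) {k : ℕ} (hk : k + 1 < d) :
    (β k - β (k + 1)) * (β k - β (k + 1)) = β k + β (k + 1) := by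
  have h1 := hβ.orthogonal k (by omega) (k + 1) hk (by omega)
  have h2 := hβ.orthogonal (k + 1) hk k (by omega) (by omega)
  rw [sub_mul, mul_sub, mul_sub, h1, h2, (hβ.isProj _).isIdempotentElem.eq,
    (hβ.isProj _).isIdempotentElem.eq]
  abel

theorem IsPVM.diff_mul_sum {β : ℕ → B} (hβ : IsPVM d β) {k : ℕ} (hk : k + 1 < d) :
    (β k - β (k + 1)) * (β k + β (k + 1)) = β k - β (k + 1) := by
  have h1 := hβ.orthogonal k (by omega) (k + 1) hk (by omega)
  have h2 := hβ.orthogonal (k + 1) hk k (by omega) (by omega)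
  rw [sub_mul, mul_add, mul_add, h1, h2, (hβ.isProj _).isIdempotentElem.eq,
    (hβ.isProj _).isIdempotentElem.eq]
  abel

theorem IsPVM.sum_mul_diff {β : ℕ → B} (hβ : IsPVM d β) {k : ℕ} (hk : k + 1 < d) :
    (β k + β (k + 1)) * (β k - β (k + 1)) = β k - β (k + 1) := by
  have h1 := hβ.orthogonal k (by omega) (k + 1) hk (by omega)
  have h2 := hβ.orthogonal (k + 1) hk k (by omega) (by omega)
  rw [add_mul, mul_sub, mul_sub, h1, h2, (hβ.isProj _).isIdempotentElem.eq,
    (hβ.isProj _).isIdempotentElem.eq]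
  abel

/-- The cross terms of `(x + y)(x - y) + (x - y)(x + y)` cancel and leave `2(x² - y²)`. The squares
are the block projections of the two questions, which agree on `ψ` in an optimal strategy. -/
theorem tilted_anticomm (hβ : ∀ t, IsPVM d (β t)) {k : ℕ} (hk : k + 1 < d) :
    tilted 1 β k * tilted (-1) β k + tilted (-1) β k * tilted 1 β k =
      (β 0 k + β 0 (k + 1)) - (β 1 k + β 1 (k + 1)) := by
  rw [← (hβ 0).diff_sq hk, ← (hβ 1).diff_sq hk, tilted, tilted]
  set x := β 0 k - β 0 (k + 1)
  set y := β 1 k - β 1 (k + 1)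
  have hq : ((Real.sqrt 2 / 2 : ℝ) : ℂ) * ((Real.sqrt 2 / 2 : ℝ) : ℂ) = 1 / 2 := by
    rw [← Complex.ofReal_mul, div_mul_div_comm, Real.mul_self_sqrt (by norm_num)]
    norm_num
  simp only [smul_mul_smul_comm, hq, ← smul_add]
  have : (x + (1 : ℂ) • y) * (x + (-1 : ℂ) • y) + (x + (-1 : ℂ) • y) * (x + (1 : ℂ) • y) =
      (2 : ℂ) • (x * x - y * y) := by
    simp only [one_smul, neg_smul, two_smul, add_mul, mul_add, neg_mul, mul_neg]
    abel
  rw [this, smul_smul]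
  norm_num

/-- Write `p`, `q` for the two projections of question 0 and `X` for the observable of question 1.
On the support, `p - q` anticommutes with `X`, because their partners are the two tilted operators.
Also `X (p + q) = X = (p + q) X` there. Adding these relations gives `2 X p = 2 q X`. -/
theorem BlockOptimal.isLink (hc : ∀ M N, Commute (L M) (R N)) (hα : ∀ s, IsPVM d (α s))
    (hβ : ∀ t, IsPVM d (β t))
    (h : BlockOptimal d (fun s i => L (α s i) ψ) (fun t i => R (β t i) ψ))
    {π : A} (hπ : IsSupport L R ψ π) (hcomm : ∀ s, ∀ i < d, Commute (α s i) π) {m : ℕ}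
    (hm : m < d / 2) :
    IsLink (α 0 (2 * m) * π) (α 0 (2 * m + 1) * π) ((α 1 (2 * m) - α 1 (2 * m + 1)) * π) := by
  have hs : ∀ s i, star (α s i) = α s i := fun s i => ((hα s).isProj i).isSelfAdjoint.star_eq
  have hk : 2 * m + 1 < d := by omega
  have hz := h.mirror_diff_zero hm
  have hx := h.mirror_diff_one hm
  have hb := h.mirror_block hc hα hβ hm
  have cP0 : Commute (α 0 (2 * m) + α 0 (2 * m + 1)) π :=
    (hcomm 0 _ (by omega)).add_left (hcomm 0 _ hk)
  have cX : Commute (α 1 (2 * m) - α 1 (2 * m + 1)) π :=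
    (hcomm 1 _ (by omega)).sub_left (hcomm 1 _ hk)
  have hXX := (hα 1).diff_sq hk
  have hXP := (hα 1).diff_mul_sum hk
  have hPX := (hα 1).sum_mul_diff hk
  -- Both block projections have the same partner, hence the same action on `ψ`, hence they agree on
  -- the support.
  have hPP : (α 0 (2 * m) + α 0 (2 * m + 1)) * π = (α 1 (2 * m) + α 1 (2 * m + 1)) * π := by
    rw [← sub_eq_zero, ← sub_mul]
    refine hπ.mul_eq_zero _ ?_
    rw [map_sub, sub_apply, hb 0 0, hb 1 0, sub_self]
  have hanti : ((α 0 (2 * m) - α 0 (2 * m + 1)) * (α 1 (2 * m) - α 1 (2 * m + 1)) +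
      (α 1 (2 * m) - α 1 (2 * m + 1)) * (α 0 (2 * m) - α 0 (2 * m + 1))) * π = 0 := by
    refine hπ.mul_eq_zero _ ?_
    rw [mirror_add (mirror_mul hc hz hx) (mirror_mul hc hx hz), add_comm, tilted_anticomm hβ hk,
      map_sub, sub_apply, ← hb 0 0, ← hb 0 1, sub_self]
  have hsX : star (α 1 (2 * m) - α 1 (2 * m + 1)) = α 1 (2 * m) - α 1 (2 * m + 1) := by
    rw [star_sub, hs, hs]
  generalize α 1 (2 * m) - α 1 (2 * m + 1) = X at *
  generalize α 1 (2 * m) + α 1 (2 * m + 1) = P at *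
  have hpi := hπ.isProj.isIdempotentElem.eq
  have c0 := hcomm 0 (2 * m) (by omega)
  have c1 := hcomm 0 (2 * m + 1) (by omega)
  have e1 : X * (α 0 (2 * m) + α 0 (2 * m + 1)) * π = X * π := by
    rw [mul_assoc, hPP, ← mul_assoc, hXP]
  have e2 : (α 0 (2 * m) + α 0 (2 * m + 1)) * X * π = X * π := by
    rw [mul_assoc, cX.eq, ← mul_assoc, hPP, mul_assoc, ← cX.eq, ← mul_assoc, hPX]
  refine ⟨?_, ?_, ?_, ?_⟩
  · rw [star_mul, hsX, hπ.isProj.isSelfAdjoint.star_eq, cX.eq]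
  · have : (2 : ℂ) • (X * α 0 (2 * m) * π) = (2 : ℂ) • (α 0 (2 * m + 1) * X * π) := by
      rw [← sub_eq_zero, two_smul, two_smul]
      calc _ = X * (α 0 (2 * m) + α 0 (2 * m + 1)) * π -
            (α 0 (2 * m) + α 0 (2 * m + 1)) * X * π +
            ((α 0 (2 * m) - α 0 (2 * m + 1)) * X + X * (α 0 (2 * m) - α 0 (2 * m + 1))) * π := by
            noncomm_ring
        _ = 0 := by rw [e1, e2, hanti, sub_self, add_zero]
    have h2 : X * α 0 (2 * m) * π = α 0 (2 * m + 1) * X * π := by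
      simpa using congrArg (fun z => (1 / 2 : ℂ) • z) this
    rw [mul_assoc, ← mul_assoc π, ← c0.eq, mul_assoc (α 0 (2 * m)), hpi, ← mul_assoc, h2,
      mul_assoc _ π, ← mul_assoc π, ← cX.eq, mul_assoc X π π, hpi, ← mul_assoc]
  · rw [mul_assoc, ← mul_assoc π, ← cX.eq, mul_assoc X π π, hpi, ← mul_assoc, hXX, ← hPP, add_mul]
  · rw [← add_mul, mul_assoc, ← mul_assoc π, ← cP0.eq, mul_assoc _ π π, hpi, ← mul_assoc, e1]

end

end

/-! ### Partners of the measurements and the mirrored chain. -/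

noncomputable section

section

set_option linter.unusedSectionVars false

attribute [local instance] InnerProductSpace.complexToReal

variable {A B : Type*} [Ring A] [StarRing A] [Algebra ℂ A] [StarModule ℂ A]
  [Ring B] [StarRing B] [Algebra ℂ B] [StarModule ℂ B]
  {H : Type*} [NormedAddCommGroup H] [InnerProductSpace ℂ H] [CompleteSpace H]
  {L : A →⋆ₐ[ℂ] (H →L[ℂ] H)} {R : B →⋆ₐ[ℂ] (H →L[ℂ] H)} {ψ : H}
  {d : ℕ}

theorem exists_block_index {d i : ℕ} (hi : i < d) :
    (∃ m < d / 2, i = 2 * m ∨ i = 2 * m + 1) ∨ (Odd d ∧ i = d - 1) := by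
  rw [Nat.odd_iff]
  by_cases h : i / 2 < d / 2
  · exact Or.inl ⟨i / 2, h, by omega⟩
  · exact Or.inr (by omega)

theorem BlockOptimal.exists_mirror_diff {α : Fin 2 → ℕ → A} {β : Fin 2 → ℕ → B}
    (hβ : ∀ t, IsPVM d (β t))
    (h : BlockOptimal d (fun s i => L (α s i) ψ) (fun t i => R (β t i) ψ)) {m : ℕ}
    (hm : m < d / 2) (s : Fin 2) :
    ∃ T, star T = T ∧ L (α s (2 * m) - α s (2 * m + 1)) ψ = R T ψ := by
  have hp := fun t i => (hβ t).isProj i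
  fin_cases s
  · exact ⟨_, star_tilted hp (by simp) _, h.mirror_diff_zero hm⟩
  · exact ⟨_, star_tilted hp (by simp) _, h.mirror_diff_one hm⟩

/-- Sum and difference of a block both have self-adjoint partners, and a single projection is half
their sum or difference. Self-adjoint partners are what makes the projections commute with the
support. -/
theorem BlockOptimal.exists_mirror {α : Fin 2 → ℕ → A} {β : Fin 2 → ℕ → B}
    (hc : ∀ M N, Commute (L M) (R N)) (hα : ∀ s, IsPVM d (α s))
    (hβ : ∀ t, IsPVM d (β t))
    (h : BlockOptimal d (fun s i => L (α s i) ψ) (fun t i => R (β t i) ψ)) (s : Fin 2) {i : ℕ}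
    (hi : i < d) : ∃ N, star N = N ∧ L (α s i) ψ = R N ψ := by
  have hs : ∀ t i, star (β t i) = β t i := fun t i => ((hβ t).isProj i).isSelfAdjoint.star_eq
  have hhalf : star (1 / 2 : ℂ) = 1 / 2 := by simp
  rcases exists_block_index hi with ⟨m, hm, hi⟩ | ⟨ho, rfl⟩
  · obtain ⟨T, hT, hD⟩ := h.exists_mirror_diff hβ hm s
    have hP := h.mirror_block hc hα hβ hm s 0
    rcases hi with rfl | rfl
    · refine ⟨(1 / 2 : ℂ) • ((β 0 (2 * m) + β 0 (2 * m + 1)) + T), ?_, ?_⟩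
      · rw [star_smul, star_add, star_add, hs, hs, hT, hhalf]
      · rw [← mirror_smul _ (mirror_add hP hD)]
        congr 2
        rw [show α s (2 * m) + α s (2 * m + 1) + (α s (2 * m) - α s (2 * m + 1)) =
          (2 : ℂ) • α s (2 * m) by rw [two_smul]; abel, smul_smul]
        norm_num
    · refine ⟨(1 / 2 : ℂ) • ((β 0 (2 * m) + β 0 (2 * m + 1)) - T), ?_, ?_⟩
      · rw [star_smul, star_sub, star_add, hs, hs, hT, hhalf]
      · rw [← mirror_smul _ (mirror_sub hP hD)]
        congr 2
        rw [show α s (2 * m) + α s (2 * m + 1) - (α s (2 * m) - α s (2 * m + 1)) =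
          (2 : ℂ) • α s (2 * m + 1) by rw [two_smul]; abel, smul_smul]
        norm_num
  · exact ⟨β 0 (d - 1), hs _ _, h.last ho s 0⟩

/-- A chain system of the first party together with its mirror image for the second party. -/
structure MirrorSystem [NeZero d] (L : A →⋆ₐ[ℂ] (H →L[ℂ] H)) (R : B →⋆ₐ[ℂ] (H →L[ℂ] H)) (ψ : H)
    (πA : A) (a : Fin d → A) (X : ℕ → A) (πB : B) (b : Fin d → B) (Y : ℕ → B) : Prop where
  supportA : IsSupport L R ψ πA
  supportB : IsSupport R L ψ πB
  chainA : ChainSystem πA a X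
  chainB : ChainSystem πB b Y
  mirror_proj : ∀ i, L (a i) ψ = R (b i) ψ
  mirror_link : ∀ e, IsEdge d e → L (X e) ψ = R (Y e) ψ

theorem IsSupport.eq_zero {π : A} (hπ : IsSupport L R ψ π) {M : A} (h : L M ψ = 0)
    (hM : M * π = M) : M = 0 := by
  rw [← hM, hπ.mul_eq_zero M h]

theorem IsSupport.map_mul_apply {π : A} (hπ : IsSupport L R ψ π) (M : A) :
    L (M * π) ψ = L M ψ := by
  rw [map_mul, mul_apply_eq_comp, hπ.map_apply]

/-- If the operators of a chain system have self-adjoint partners on the other side, then these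
partners, cut down to the support, form a chain system. -/
theorem ChainSystem.exists_mirrorSystem [NeZero d] (hc : ∀ M N, Commute (L M) (R N)) {πA : A}
    {a : Fin d → A} {X : ℕ → A} {πB : B} (hA : IsSupport L R ψ πA) (hB : IsSupport R L ψ πB)
    (h : ChainSystem πA a X) (ha : ∀ i, ∃ N, star N = N ∧ L (a i) ψ = R N ψ)
    (hX : ∀ e, IsEdge d e → ∃ N, star N = N ∧ L (X e) ψ = R N ψ) :
    ∃ b Y, MirrorSystem L R ψ πA a X πB b Y := by
  -- Off the edges the value 0 serves as a default, so that the choice of partners is a total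
  -- function.
  have hX' : ∀ e, ∃ N, IsEdge d e → star N = N ∧ L (X e) ψ = R N ψ := fun e => by
    by_cases he : IsEdge d e
    · obtain ⟨N, hN⟩ := hX e he
      exact ⟨N, fun _ => hN⟩
    · exact ⟨0, fun h => absurd h he⟩
  choose b hb using ha
  choose Y hY using hX'
  have hpi := hB.isProj.isIdempotentElem.eq
  have hpis := hB.isProj.isSelfAdjoint.star_eq
  have cb : ∀ i, Commute (b i) πB := fun i => hB.commute _ _ (hb i).1 (hb i).2.symm
  have cY : ∀ e, IsEdge d e → Commute (Y e) πB := fun e he =>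
    hB.commute _ _ (hY e he).1 (hY e he).2.symm
  have mb : ∀ i, R (b i * πB) ψ = L (a i) ψ := fun i => by
    rw [hB.map_mul_apply, (hb i).2]
  have mY : ∀ e, IsEdge d e → R (Y e * πB) ψ = L (X e) ψ := fun e he => by
    rw [hB.map_mul_apply, (hY e he).2]
  have hc' : ∀ N M, Commute (R N) (L M) := fun N M => (hc M N).symm
  have kb : ∀ i, b i * πB * πB = b i * πB := fun i => by rw [mul_assoc, hpi]
  have kY : ∀ e, Y e * πB * πB = Y e * πB := fun e => by rw [mul_assoc, hpi]
  have sb : ∀ i, star (b i * πB) = b i * πB := fun i => by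
    rw [star_mul, (hb i).1, hpis, (cb i).eq]
  have sa : ∀ i, star (a i) = a i := fun i => (h.isProj i).isSelfAdjoint.star_eq
  -- Operators cut down to the support are determined by their action on `ψ`. Each chain relation is
  -- thus carried across `ψ`, in reversed order, from its adjoint relation on the first side.
  have eq_of : ∀ {N N' : B} {M : A}, R N ψ = L M ψ → R N' ψ = L M ψ → N * πB = N → N' * πB = N' →
      N = N' := fun {N N' M} h1 h2 h3 h4 => by
    rw [← sub_eq_zero]
    refine hB.eq_zero ?_ (by rw [sub_mul, h3, h4])
    rw [map_sub, sub_apply, h1, h2, sub_self]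
  refine ⟨fun i => b i * πB, fun e => Y e * πB, hA, hB, h,
    ⟨hB.isProj, fun i => ⟨?_, sb i⟩, fun i j hij => ?_, ?_, fun e he => ?_⟩,
    fun i => (mb i).symm, fun e he => (mY e he).symm⟩
  · refine eq_of (mirror_mul hc' (mb i) (mb i)) ?_ (by rw [mul_assoc, kb]) (kb i)
    rw [mb, (h.isProj i).isIdempotentElem.eq]
  · refine eq_of (mirror_mul hc' (mb i) (mb j)) ?_ (by rw [mul_assoc, kb]) (zero_mul _)
    rw [h.orthogonal j i hij.symm, map_zero, map_zero]
  · refine eq_of (M := πA) ?_ ?_ (by simp only [Finset.sum_mul, kb]) hpi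
    · rw [← h.sum_eq, map_sum, map_sum, sum_apply, sum_apply]
      exact Finset.sum_congr rfl fun i _ => mb i
    · rw [hB.map_apply, hA.map_apply]
  · have hl := h.link e he
    refine ⟨?_, ?_, ?_, ?_⟩
    · rw [star_mul, (hY e he).1, hpis, (cY e he).eq]
    · refine eq_of (mirror_mul hc' (mY e he) (mb _)) ?_ (by rw [mul_assoc, kb])
        (by rw [mul_assoc, kY])
      rw [mirror_mul hc' (mb _) (mY e he), hl.mul_right (sa _) (sa _)]
    · refine eq_of (mirror_mul hc' (mY e he) (mY e he)) ?_ (by rw [mul_assoc, kY])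
        (by rw [add_mul, kb, kb])
      rw [hl.sq]
      exact mirror_add (mb _) (mb _)
    · refine eq_of (mirror_mul hc' (mY e he) (mirror_add (mb _) (mb _))) ?_
        (by rw [mul_assoc, add_mul, kb, kb]) (kY e)
      rw [hl.add_mul (sa _) (sa _), mY e he]

end

end

/-! ### The full chain of an optimal strategy and the tracial expectation on it. -/

noncomputable section

section

set_option linter.unusedSectionVars false

attribute [local instance] InnerProductSpace.complexToReal

variable {A B : Type*} [Ring A] [StarRing A] [Algebra ℂ A] [StarModule ℂ A]
  [Ring B] [StarRing B] [Algebra ℂ B] [StarModule ℂ B]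
  {H : Type*} [NormedAddCommGroup H] [InnerProductSpace ℂ H] [CompleteSpace H]
  {L : A →⋆ₐ[ℂ] (H →L[ℂ] H)} {R : B →⋆ₐ[ℂ] (H →L[ℂ] H)} {ψ : H}
  {d : ℕ} [NeZero d]

/-- The measurements of the questions `q 0`, `q 1`, with answers shifted by `k`. -/
def shiftedFamily {X A : Type*} (q : Fin 2 → X) (k : ℕ) (P : X → Fin d → A) : Fin 2 → ℕ → A :=
  fun s i => P (q s) (Fin.ofNat d (i + k))

/-- Measurements satisfying the relations that characterize the maximum of the Bell functional. -/
structure OptimalPair (L : A →⋆ₐ[ℂ] (H →L[ℂ] H)) (R : B →⋆ₐ[ℂ] (H →L[ℂ] H)) (ψ : H)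
    (P : Fin 3 → Fin d → A) (Q : Fin 4 → Fin d → B) : Prop where
  pvmA : ∀ x k, IsPVM d (fun i => P x (Fin.ofNat d (i + k)))
  pvmB : ∀ y k, IsPVM d (fun i => Q y (Fin.ofNat d (i + k)))
  opt : BlockOptimal d (fun s i => L (shiftedFamily ![0, 1] 0 P s i) ψ)
    (fun t i => R (shiftedFamily ![0, 1] 0 Q t i) ψ)
  opt' : 2 < d → BlockOptimal d (fun s i => L (shiftedFamily ![0, 2] 1 P s i) ψ)
    (fun t i => R (shiftedFamily ![2, 3] 1 Q t i) ψ)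

/-- The operator exchanging the answers `e` and `e + 1` of the question `0`. -/
def linkOp (P : Fin 3 → Fin d → A) (e : ℕ) : A :=
  if Even e then P 1 (Fin.ofNat d e) - P 1 (Fin.ofNat d (e + 1))
  else P 2 (Fin.ofNat d e) - P 2 (Fin.ofNat d (e + 1))

variable {P : Fin 3 → Fin d → A} {Q : Fin 4 → Fin d → B}

theorem Fin.ofNat_val_add_zero (i : Fin d) : Fin.ofNat d ((i : ℕ) + 0) = i := by
  simp

theorem Fin.exists_ofNat_add_eq (k : ℕ) (i : Fin d) : ∃ n < d, Fin.ofNat d (n + k) = i := by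
  have hd : 0 < d := Nat.pos_of_ne_zero (NeZero.ne d)
  -- Adding `(d - 1) * k` subtracts `k` modulo `d`.
  refine ⟨((i : ℕ) + (d - 1) * k) % d, Nat.mod_lt _ hd, Fin.ext ?_⟩
  have h1 : ((i : ℕ) + (d - 1) * k) % d + k ≡ (i : ℕ) + (d - 1) * k + k [MOD d] :=
    (Nat.mod_modEq _ _).add_right k
  have h2 : (i : ℕ) + (d - 1) * k + k = i + d * k := by
    obtain ⟨n, rfl⟩ := Nat.exists_eq_succ_of_ne_zero hd.ne'
    simp
    ring
  rw [h2] at h1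
  exact Eq.trans (show _ % d = (i : ℕ) % d from h1.trans
    (Nat.add_modulus_mul_modEq_iff.mpr rfl)) (Nat.mod_eq_of_lt i.isLt)

theorem OptimalPair.exists_mirror (hc : ∀ M N, Commute (L M) (R N)) (h : OptimalPair L R ψ P Q)
    (i : Fin d) : (∀ x, x = 0 ∨ x = 1 ∨ 2 < d → ∃ N, star N = N ∧ L (P x i) ψ = R N ψ) := by
  intro x hx
  have key : ∀ s, ∃ N, star N = N ∧ L (P ((![0, 1] : Fin 2 → Fin 3) s) i) ψ = R N ψ := fun s => by
    have := h.opt.exists_mirror hc (fun s => h.pvmA _ _) (fun t => h.pvmB _ _) s i.isLt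
    simpa only [shiftedFamily, Fin.ofNat_val_add_zero] using this
  have key' : 2 < d → ∀ s, ∃ N, star N = N ∧ L (P ((![0, 2] : Fin 2 → Fin 3) s) i) ψ = R N ψ := by
    intro hd2 s
    obtain ⟨n, hn, rfl⟩ := Fin.exists_ofNat_add_eq 1 i
    exact (h.opt' hd2).exists_mirror hc (fun s => h.pvmA _ _) (fun t => h.pvmB _ _) s hn
  have h3 : x = 0 ∨ x = 1 ∨ x = 2 := by
    fin_cases x <;> simp
  rcases h3 with rfl | rfl | rfl
  · exact key 0
  · exact key 1
  · exact key' (by simpa using hx) 1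

theorem OptimalPair.exists_mirror_linkOp (hc : ∀ M N, Commute (L M) (R N))
    (h : OptimalPair L R ψ P Q) {e : ℕ} (he : IsEdge d e) :
    ∃ N, star N = N ∧ L (linkOp P e) ψ = R N ψ := by
  rw [linkOp]
  split_ifs with hev
  · obtain ⟨N, h1, h2⟩ := h.exists_mirror hc (Fin.ofNat d e) 1 (by simp)
    obtain ⟨N', h1', h2'⟩ := h.exists_mirror hc (Fin.ofNat d (e + 1)) 1 (by simp)
    exact ⟨N - N', by rw [star_sub, h1, h1'], mirror_sub h2 h2'⟩
  · have hd := he.2.2 (Nat.not_even_iff_odd.mp hev)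
    obtain ⟨N, h1, h2⟩ := h.exists_mirror hc (Fin.ofNat d e) 2 (by simp [hd])
    obtain ⟨N', h1', h2'⟩ := h.exists_mirror hc (Fin.ofNat d (e + 1)) 2 (by simp [hd])
    exact ⟨N - N', by rw [star_sub, h1, h1'], mirror_sub h2 h2'⟩

/-- Question 0 belongs to both halves. The first half supplies the even links, through question 1,
and the shifted half the odd ones, through question 2. -/
theorem OptimalPair.chainSystem (hc : ∀ M N, Commute (L M) (R N))
    (h : OptimalPair L R ψ P Q) {π : A} (hπ : IsSupport L R ψ π) :
    ChainSystem π (fun i => P 0 i * π) (fun e => linkOp P e * π) := by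
  have hproj : ∀ x i, IsStarProjection (P x i) := fun x i => by
    have := (h.pvmA x 0).isProj i
    rwa [Fin.ofNat_val_add_zero] at this
  have hcomm : ∀ x i, x = 0 ∨ x = 1 ∨ 2 < d → Commute (P x i) π := fun x i hx => by
    obtain ⟨N, -, h2⟩ := h.exists_mirror hc i x hx
    exact hπ.commute _ _ (hproj x i).isSelfAdjoint.star_eq h2
  refine ⟨hπ.isProj, fun i => isStarProjection_mul_of_commute (hproj 0 i) hπ.isProj
    (hcomm 0 i (by simp)), fun i j hij => ?_, ?_, fun e he => ?_⟩
  · have h1 := (h.pvmA 0 0).orthogonal i i.isLt j j.isLt (fun hh => hij (Fin.ext hh))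
    simp only [Fin.ofNat_val_add_zero] at h1
    rw [mul_assoc, ← mul_assoc π, ← (hcomm 0 j (by simp)).eq, ← mul_assoc, ← mul_assoc, h1,
      zero_mul, zero_mul]
  · rw [← Finset.sum_mul, Fin.sum_univ_eq_sum_range_shift 0, (h.pvmA 0 0).sum_eq_one, one_mul]
  · simp only [linkOp]
    obtain ⟨hlt, hev, hodd⟩ := he
    split_ifs with h2
    · obtain ⟨m, rfl⟩ := even_iff_exists_two_mul.mp h2
      have hm : m < d / 2 := by have := hev h2; omega
      exact h.opt.isLink hc (fun s => h.pvmA _ _) (fun t => h.pvmB _ _) hπ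
        (fun s i hi => by
          refine hcomm _ _ ?_
          fin_cases s <;> simp) hm
    · obtain ⟨m, rfl⟩ := Nat.not_even_iff_odd.mp h2
      have hd := hodd (Nat.not_even_iff_odd.mp h2)
      have hm : m < d / 2 := by omega
      exact (h.opt' hd).isLink hc (fun s => h.pvmA _ _) (fun t => h.pvmB _ _) hπ
        (fun s i hi => hcomm _ _ (by simp [hd])) hm

theorem OptimalPair.exists_mirrorSystem (hc : ∀ M N, Commute (L M) (R N))
    (h : OptimalPair L R ψ P Q) {πA : A} (hA : IsSupport L R ψ πA) {πB : B}
    (hB : IsSupport R L ψ πB) :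
    ∃ b Y, MirrorSystem L R ψ πA (fun i => P 0 i * πA) (fun e => linkOp P e * πA) πB b Y := by
  refine (h.chainSystem hc hA).exists_mirrorSystem hc hA hB (fun i => ?_) (fun e he => ?_)
  · rw [hA.map_mul_apply]
    exact h.exists_mirror hc i 0 (by simp)
  · rw [hA.map_mul_apply]
    exact h.exists_mirror_linkOp hc he

/-! The functional `M ↦ ⟪ψ, M ψ⟫` on a mirrored chain system. -/

/-- The expectation of an operator of the first party. -/
def expect (L : A →⋆ₐ[ℂ] (H →L[ℂ] H)) (ψ : H) (M : A) : ℂ := inner ℂ ψ (L M ψ)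

theorem expect_add (M N : A) : expect L ψ (M + N) = expect L ψ M + expect L ψ N := by
  simp [expect]

theorem expect_zero : expect L ψ (0 : A) = 0 := by simp [expect]

/-- Trace property: `⟪ψ, M K ψ⟫ = ⟪ψ, M N ψ⟫ = ⟪N ψ, M ψ⟫ = ⟪K ψ, M ψ⟫`, where `N` commutes with
`M`. -/
theorem expect_mul_comm (hc : ∀ M N, Commute (L M) (R N)) (M : A) {K : A} {N : B}
    (hK : star K = K) (hN : star N = N) (h : L K ψ = R N ψ) :
    expect L ψ (M * K) = expect L ψ (K * M) := by
  have e1 : inner ℂ ψ (R N (L M ψ)) = inner ℂ (R N ψ) (L M ψ) := by rw [inner_rep_left, hN]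
  have e2 : inner ℂ ψ (L K (L M ψ)) = inner ℂ (L K ψ) (L M ψ) := by rw [inner_rep_left, hK]
  rw [expect, expect, map_mul, map_mul, mul_apply_eq_comp, mul_apply_eq_comp, h,
    ← mul_apply_eq_comp, (hc _ _).eq, mul_apply_eq_comp, e1, e2, h]

variable {πA : A} {a : Fin d → A} {X : ℕ → A} {πB : B} {b : Fin d → B} {Y : ℕ → B}

namespace MirrorSystem

theorem star_proj (h : MirrorSystem L R ψ πA a X πB b Y) (i : Fin d) : star (a i) = a i :=
  (h.chainA.isProj i).isSelfAdjoint.star_eq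

theorem expect_mul_proj (hc : ∀ M N, Commute (L M) (R N)) (h : MirrorSystem L R ψ πA a X πB b Y)
    (M : A) (i : Fin d) : expect L ψ (M * a i) = expect L ψ (a i * M) :=
  expect_mul_comm hc M (h.star_proj i) (h.chainB.isProj i).isSelfAdjoint.star_eq (h.mirror_proj i)

theorem expect_mul_link (hc : ∀ M N, Commute (L M) (R N)) (h : MirrorSystem L R ψ πA a X πB b Y)
    (M : A) {e : ℕ} (he : IsEdge d e) : expect L ψ (M * X e) = expect L ψ (X e * M) :=
  expect_mul_comm hc M (h.chainA.link e he).star_eq (h.chainB.link e he).star_eq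
    (h.mirror_link e he)

end MirrorSystem

theorem IsEdge.two_le {e : ℕ} (he : IsEdge d e) : 2 ≤ d := by
  rcases Nat.even_or_odd e with h | h
  · have := he.2.1 h; omega
  · have := he.2.2 h; omega

theorem IsEdge.ne_succ {e : ℕ} (he : IsEdge d e) : Fin.ofNat d e ≠ Fin.ofNat d (e + 1) := by
  have := he.two_le
  intro hh
  rw [add_comm e 1] at hh
  nth_rewrite 1 [← zero_add e] at hh
  exact zero_ne_one ((Fin.ofNat_add_inj_of_lt (by omega) (by omega)).mp hh)

/-- Two different edges of the cycle share at most one vertex. -/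
theorem IsEdge.exists_not_mem {e f : ℕ} (he : IsEdge d e) (hf : IsEdge d f) (hef : e ≠ f) :
    (Fin.ofNat d e ≠ Fin.ofNat d f ∧ Fin.ofNat d e ≠ Fin.ofNat d (f + 1)) ∨
    (Fin.ofNat d (e + 1) ≠ Fin.ofNat d f ∧ Fin.ofNat d (e + 1) ≠ Fin.ofNat d (f + 1)) := by
  have hd := he.two_le
  have h1 : Fin.ofNat d e ≠ Fin.ofNat d f := fun hh =>
    hef ((Fin.ofNat_add_inj_of_lt (k := 0) he.1 hf.1).mp hh)
  by_cases h2 : Fin.ofNat d e = Fin.ofNat d (f + 1)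
  · right
    -- For `d = 2` the wrapping edge would have the same two endpoints as edge 0, but it is not
    -- used, so two different edges cannot exist.
    have hd' : 2 < d := by
      by_contra hlt
      have hd2 : d = 2 := by omega
      have : ∀ g, IsEdge d g → g = 0 := fun g hg => by
        rcases Nat.even_or_odd g with hg' | hg'
        · have := hg.2.1 hg'; omega
        · have := hg.2.2 hg'; omega
      exact hef ((this e he).trans (this f hf).symm)
    have h3 : Fin.ofNat d (e + 1) = Fin.ofNat d (2 + f) := by
      have : e % d = (f + 1) % d := congrArg Fin.val h2
      refine Fin.ext (?_ : (e + 1) % d = (2 + f) % d)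
      rw [show 2 + f = f + 1 + 1 by ring]
      exact Nat.ModEq.add_right 1 this
    rw [h3]
    constructor
    · intro hh
      nth_rewrite 2 [← zero_add f] at hh
      exact two_ne_zero ((Fin.ofNat_add_inj_of_lt (by omega) (by omega)).mp hh)
    · intro hh
      rw [add_comm f 1] at hh
      have := (Fin.ofNat_add_inj_of_lt (by omega) (by omega)).mp hh
      omega
  · exact Or.inl ⟨h1, h2⟩

namespace MirrorSystem

variable (hc : ∀ M N, Commute (L M) (R N)) (h : MirrorSystem L R ψ πA a X πB b Y)

include hc h

theorem expect_proj_succ {e : ℕ} (he : IsEdge d e) :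
    expect L ψ (a (Fin.ofNat d e)) = expect L ψ (a (Fin.ofNat d (e + 1))) := by
  have hl := h.chainA.link e he
  have e1 : a (Fin.ofNat d e) * X e * X e = a (Fin.ofNat d e) := by
    rw [mul_assoc, hl.sq, mul_add, h.chainA.orthogonal _ _ he.ne_succ,
      (h.chainA.isProj _).isIdempotentElem.eq, add_zero]
  have e2 : X e * (a (Fin.ofNat d e) * X e) = a (Fin.ofNat d (e + 1)) := by
    rw [← mul_assoc, hl.mul_left, mul_assoc, hl.sq, mul_add,
      h.chainA.orthogonal _ _ he.ne_succ.symm, (h.chainA.isProj _).isIdempotentElem.eq, zero_add]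
  rw [← e1, h.expect_mul_link hc _ he, e2]

/-- The links make all `d` weights equal, and they sum to `⟪ψ, πA ψ⟫ = 1`. This is where the
uniformity of the entangled state comes from. -/
theorem expect_proj (hψ : ‖ψ‖ = 1) (i : Fin d) : expect L ψ (a i) = (d : ℂ)⁻¹ := by
  have hconst : ∀ j < d, expect L ψ (a (Fin.ofNat d j)) = expect L ψ (a 0) := by
    intro j
    induction j with
    | zero => intro _; rfl
    | succ j ih =>
      intro hj
      rw [← ih (by omega), ← h.expect_proj_succ hc (isEdge_of_succ_lt hj)]
  have hall : ∀ j, expect L ψ (a j) = expect L ψ (a 0) := fun j => by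
    simpa using hconst j j.isLt
  have hsum : ∑ j, expect L ψ (a j) = 1 := by
    simp only [expect, ← inner_sum]
    rw [← sum_apply, ← map_sum, h.chainA.sum_eq, h.supportA.map_apply,
      inner_self_eq_norm_sq_to_K, hψ]
    simp
  simp only [hall, Finset.sum_const, Finset.card_univ, Fintype.card_fin, nsmul_eq_mul] at hsum
  rw [hall]
  exact eq_inv_of_mul_eq_one_right hsum

theorem expect_proj_mul_proj (hψ : ‖ψ‖ = 1) (i j : Fin d) :
    expect L ψ (a i * a j) = if i = j then (d : ℂ)⁻¹ else 0 := by
  split_ifs with hij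
  · rw [hij, (h.chainA.isProj j).isIdempotentElem.eq, h.expect_proj hc hψ]
  · rw [h.chainA.orthogonal i j hij, expect_zero]

/-- By traciality `aᵢ X = aᵢ X aⱼ` has the expectation of `aⱼ aᵢ X = 0`. -/
theorem expect_proj_mul_link_of_isLink {i j : Fin d} (hij : i ≠ j) {e : ℕ}
    (hl : IsLink (a i) (a j) (X e)) : expect L ψ (a i * X e) = 0 := by
  have hi := (h.chainA.isProj i).isIdempotentElem.eq
  rw [← hi, mul_assoc, hl.mul_right (h.star_proj _) (h.star_proj _), ← mul_assoc,
    h.expect_mul_proj hc, ← mul_assoc, h.chainA.orthogonal j i hij.symm, zero_mul, expect_zero]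

theorem expect_proj_mul_link {e : ℕ} (he : IsEdge d e) (i : Fin d) :
    expect L ψ (a i * X e) = 0 := by
  have hl := h.chainA.link e he
  by_cases h1 : i = Fin.ofNat d e
  · subst h1
    exact h.expect_proj_mul_link_of_isLink hc he.ne_succ hl
  by_cases h2 : i = Fin.ofNat d (e + 1)
  · subst h2
    exact h.expect_proj_mul_link_of_isLink hc he.ne_succ.symm
      (hl.symm (h.star_proj _) (h.star_proj _))
  rw [hl.eq_zero_mul (h.star_proj _) (h.star_proj _) (h.chainA.orthogonal _ _ h1)
    (h.chainA.orthogonal _ _ h2), expect_zero]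

/-- The vertex `i` of `e` lies off `f`, so `aᵢ` annihilates `X f` from both sides. Split `X e` as
`aᵢ X e + X e aᵢ`: the second part dies against `X f` at once, the first after a cyclic move of
`aᵢ`. -/
theorem expect_link_mul_link_of_isLink {i j : Fin d} {e f : ℕ}
    (hl : IsLink (a i) (a j) (X e)) (hf : IsEdge d f) (h1 : i ≠ Fin.ofNat d f)
    (h2 : i ≠ Fin.ofNat d (f + 1)) : expect L ψ (X e * X f) = 0 := by
  have hlf := h.chainA.link f hf
  have z1 : a i * X f = 0 := hlf.eq_zero_mul (h.star_proj _) (h.star_proj _)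
    (h.chainA.orthogonal _ _ h1) (h.chainA.orthogonal _ _ h2)
  have z2 : X f * a i = 0 := hlf.mul_eq_zero
    (h.chainA.orthogonal _ _ h1.symm) (h.chainA.orthogonal _ _ h2.symm)
  rw [← hl.add_mul (h.star_proj _) (h.star_proj _), add_mul, add_mul, ← hl.mul_left,
    mul_assoc (X e), z1, mul_zero, add_zero, mul_assoc, ← h.expect_mul_proj hc, mul_assoc, z2,
    mul_zero, expect_zero]

theorem expect_link_mul_link (hψ : ‖ψ‖ = 1) {e f : ℕ} (he : IsEdge d e) (hf : IsEdge d f) :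
    expect L ψ (X e * X f) = if e = f then 2 * (d : ℂ)⁻¹ else 0 := by
  have hl := h.chainA.link e he
  split_ifs with hef
  · subst hef
    rw [hl.sq, expect_add, h.expect_proj hc hψ, h.expect_proj hc hψ, two_mul]
  · rcases he.exists_not_mem hf hef with ⟨h1, h2⟩ | ⟨h1, h2⟩
    · exact h.expect_link_mul_link_of_isLink hc hl hf h1 h2
    · exact h.expect_link_mul_link_of_isLink hc (hl.symm (h.star_proj _) (h.star_proj _)) hf h1 h2

end MirrorSystem

end

end

/-! ### The local isometries and the extracted entangled state. -/

noncomputable section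

section Isometry

set_option linter.unusedSectionVars false

variable {E F : Type*} [NormedAddCommGroup E] [InnerProductSpace ℂ E] [CompleteSpace E]
  [NormedAddCommGroup F] [InnerProductSpace ℂ F] [CompleteSpace F] {d : ℕ}

/-- The map `v ↦ ∑ i, e i ⊗ V i v`. -/
def columnMap (V : Fin d → E →L[ℂ] E) : E →L[ℂ] Qudit d ⊗[ℂ] E :=
  ∑ i, TensorProduct.mkL ℂ (Qudit d) E (EuclideanSpace.single i 1) ∘L V i

theorem columnMap_apply (V : Fin d → E →L[ℂ] E) (v : E) :
    columnMap V v = ∑ i, EuclideanSpace.single i (1 : ℂ) ⊗ₜ[ℂ] V i v := by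
  simp [columnMap]

theorem norm_columnMap {V : Fin d → E →L[ℂ] E} (hV : ∑ i, star (V i) * V i = 1) (v : E) :
    ‖columnMap V v‖ = ‖v‖ := by
  have key : inner ℂ (columnMap V v) (columnMap V v) = inner ℂ v v := by
    have : ∀ i, inner ℂ (V i v) (V i v) = inner ℂ v ((star (V i) * V i) v) := fun i => by
      rw [ContinuousLinearMap.star_eq_adjoint, mul_apply_eq_comp,
        ContinuousLinearMap.adjoint_inner_right]
    rw [columnMap_apply, sum_inner]
    simp only [inner_sum, TensorProduct.inner_tmul, EuclideanSpace.inner_single_left,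
      PiLp.single_apply, map_one, one_mul, ite_mul, zero_mul]
    simp only [Finset.sum_ite_eq, Finset.mem_univ, if_true, this]
    rw [← inner_sum, ← sum_apply, hV, one_apply_eq_self]
  rw [@norm_eq_sqrt_re_inner ℂ, @norm_eq_sqrt_re_inner ℂ, key]

/-- `columnMap` as an isometry. -/
def columnIsometry (V : Fin d → E →L[ℂ] E) (hV : ∑ i, star (V i) * V i = 1) :
    E →ₗᵢ[ℂ] Qudit d ⊗[ℂ] E :=
  ⟨(columnMap V).toLinearMap, norm_columnMap hV⟩

theorem columnIsometry_toContinuousLinearMap (V : Fin d → E →L[ℂ] E)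
    (hV : ∑ i, star (V i) * V i = 1) :
    (columnIsometry V hV).toContinuousLinearMap = columnMap V := rfl

theorem withAux_tmul (x y : Qudit d) (v : HilbertTensor E F) :
    withAux (x ⊗ₜ[ℂ] y) v =
      opTensor (TensorProduct.mkL ℂ (Qudit d) E x) (TensorProduct.mkL ℂ (Qudit d) F y) v := by
  have : ((shuffle ℂ (Qudit d) (Qudit d) E F).toContinuousLinearMap ∘L
      TensorProduct.mkL ℂ (Qudit d ⊗[ℂ] Qudit d) (E ⊗[ℂ] F) (x ⊗ₜ[ℂ] y)).completion =
      opTensor (TensorProduct.mkL ℂ (Qudit d) E x) (TensorProduct.mkL ℂ (Qudit d) F y) := by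
    refine HilbertTensor.clm_ext fun v w => ?_
    rw [opTensor_pureTensor]
    simp [pureTensor, shuffle]
  exact congrArg (fun f => f v) this

theorem withAux_add (x y : Qudit d ⊗[ℂ] Qudit d) (v : HilbertTensor E F) :
    withAux (x + y) v = withAux x v + withAux y v := by
  have : ((shuffle ℂ (Qudit d) (Qudit d) E F).toContinuousLinearMap ∘L
      TensorProduct.mkL ℂ (Qudit d ⊗[ℂ] Qudit d) (E ⊗[ℂ] F) (x + y)).completion =
      ((shuffle ℂ (Qudit d) (Qudit d) E F).toContinuousLinearMap ∘L
        TensorProduct.mkL ℂ (Qudit d ⊗[ℂ] Qudit d) (E ⊗[ℂ] F) x).completion +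
      ((shuffle ℂ (Qudit d) (Qudit d) E F).toContinuousLinearMap ∘L
        TensorProduct.mkL ℂ (Qudit d ⊗[ℂ] Qudit d) (E ⊗[ℂ] F) y).completion := by
    refine HilbertTensor.clm_ext fun v w => ?_
    simp [pureTensor, UniformSpace.Completion.coe_add]
  exact congrArg (fun f => f v) this

theorem withAux_smul (c : ℂ) (x : Qudit d ⊗[ℂ] Qudit d) (v : HilbertTensor E F) :
    withAux (c • x) v = c • withAux x v := by
  have : ((shuffle ℂ (Qudit d) (Qudit d) E F).toContinuousLinearMap ∘L
      TensorProduct.mkL ℂ (Qudit d ⊗[ℂ] Qudit d) (E ⊗[ℂ] F) (c • x)).completion =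
      c • ((shuffle ℂ (Qudit d) (Qudit d) E F).toContinuousLinearMap ∘L
        TensorProduct.mkL ℂ (Qudit d ⊗[ℂ] Qudit d) (E ⊗[ℂ] F) x).completion := by
    refine HilbertTensor.clm_ext fun v w => ?_
    simp [pureTensor, UniformSpace.Completion.coe_smul]
  exact congrArg (fun f => f v) this

theorem withAux_sum {ι : Type*} (s : Finset ι) (x : ι → Qudit d ⊗[ℂ] Qudit d)
    (v : HilbertTensor E F) : withAux (∑ i ∈ s, x i) v = ∑ i ∈ s, withAux (x i) v := by
  classical
  induction s using Finset.induction_on with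
  | empty => simpa using withAux_smul (0 : ℂ) (0 : Qudit d ⊗[ℂ] Qudit d) v
  | insert i s hi ih => rw [Finset.sum_insert hi, Finset.sum_insert hi, withAux_add, ih]

theorem withAux_maxEntangled (v : HilbertTensor E F) :
    withAux (maxEntangled d) v = ((Real.sqrt d : ℂ))⁻¹ • ∑ i : Fin d,
      opTensor (TensorProduct.mkL ℂ (Qudit d) E (EuclideanSpace.single i 1))
        (TensorProduct.mkL ℂ (Qudit d) F (EuclideanSpace.single i 1)) v := by
  rw [maxEntangled, withAux_smul, withAux_sum]
  simp only [withAux_tmul]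

theorem opTensor_columnMap (V : Fin d → E →L[ℂ] E) (W : Fin d → F →L[ℂ] F) :
    opTensor (columnMap V) (columnMap W) = ∑ i, ∑ j,
      opTensor (TensorProduct.mkL ℂ (Qudit d) E (EuclideanSpace.single i 1))
        (TensorProduct.mkL ℂ (Qudit d) F (EuclideanSpace.single j 1)) ∘L opTensor (V i) (W j) := by
  rw [columnMap, columnMap, opTensor_sum_left]
  refine Finset.sum_congr rfl fun i _ => ?_
  rw [opTensor_sum_right]
  exact Finset.sum_congr rfl fun j _ => (opTensor_comp _ _ _ _).symm

variable [NeZero d]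

/-- The transport operators, completed to an isometry off the support. -/
def extendedTransport (π : E →L[ℂ] E) (a : Fin d → E →L[ℂ] E) (X : ℕ → E →L[ℂ] E) (i : Fin d) :
    E →L[ℂ] E :=
  ChainSystem.transport a X i + if i = 0 then 1 - π else 0

/-- The transports contribute `∑ aᵢ = π` and column 0 adds `1 - π`. There are no cross terms, since
the transports have range inside the support. -/
theorem ChainSystem.sum_extendedTransport {π : E →L[ℂ] E} {a : Fin d → E →L[ℂ] E}
    {X : ℕ → E →L[ℂ] E} (h : ChainSystem π a X) :
    ∑ i, star (extendedTransport π a X i) * extendedTransport π a X i = 1 := by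
  have h1 : ∀ i : Fin d, star (extendedTransport π a X i) * extendedTransport π a X i =
      a i + if i = 0 then 1 - π else 0 := fun i => by
    have ht := h.star_transport_mul_self i i.isLt
    have hs : (1 - π) * ChainSystem.transport a X i = 0 := by
      rw [sub_mul, one_mul, h.support_mul_transport, sub_self]
    have hp := h.isProj_support.one_sub
    have hs' : star (ChainSystem.transport a X i) * (1 - π) = 0 := by
      simpa only [star_mul, hp.isSelfAdjoint.star_eq, star_zero] using congrArg star hs
    rw [extendedTransport]
    split_ifs
    · rw [star_add, add_mul, mul_add, mul_add, hs', hp.isSelfAdjoint.star_eq, hs,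
        hp.isIdempotentElem.eq, ht]
      simp
    · simpa using ht
  simp only [h1, Finset.sum_add_distrib, h.sum_eq]
  simp

theorem IsSupport.extendedTransport_apply {B H : Type*} [Ring B] [StarRing B] [Algebra ℂ B]
    [NormedAddCommGroup H] [InnerProductSpace ℂ H] [CompleteSpace H]
    {L : (E →L[ℂ] E) →⋆ₐ[ℂ] (H →L[ℂ] H)} {R : B →⋆ₐ[ℂ] (H →L[ℂ] H)} {ψ : H} {π : E →L[ℂ] E}
    (hπ : IsSupport L R ψ π) (a : Fin d → E →L[ℂ] E) (X : ℕ → E →L[ℂ] E) (i : Fin d) :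
    L (extendedTransport π a X i) ψ = L (ChainSystem.transport a X i) ψ := by
  rw [extendedTransport, map_add, add_apply]
  split_ifs
  · rw [map_sub, map_one, sub_apply, hπ.map_apply, one_apply_eq_self, sub_self, add_zero]
  · rw [map_zero, zero_apply, add_zero]

/-- The adjoint appears because crossing `ψ` reverses the product of links. -/
theorem MirrorSystem.mirror_transport {A B H : Type*} [Ring A] [StarRing A] [Algebra ℂ A]
    [StarModule ℂ A] [Ring B] [StarRing B] [Algebra ℂ B] [StarModule ℂ B]
    [NormedAddCommGroup H] [InnerProductSpace ℂ H] [CompleteSpace H]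
    {L : A →⋆ₐ[ℂ] (H →L[ℂ] H)} {R : B →⋆ₐ[ℂ] (H →L[ℂ] H)} {ψ : H} {πA : A} {a : Fin d → A}
    {X : ℕ → A} {πB : B} {b : Fin d → B} {Y : ℕ → B} (hc : ∀ M N, Commute (L M) (R N))
    (h : MirrorSystem L R ψ πA a X πB b Y) : ∀ i < d,
    L (star (ChainSystem.transport a X i)) ψ = R (ChainSystem.transport b Y i) ψ
  | 0, _ => by
    rw [ChainSystem.transport, ChainSystem.transport, h.star_proj, h.mirror_proj]
  | i + 1, hi => by
    have he := isEdge_of_succ_lt hi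
    rw [ChainSystem.transport, ChainSystem.transport, star_mul, (h.chainA.link i he).star_eq]
    exact mirror_mul hc (h.mirror_link i he) (h.mirror_transport hc i (by omega))

/-- With transports `Tᵢ` and `T'ⱼ` of the two sides, `Tᵢ ⊗ T'ⱼ` acts on `ψ` as `Tᵢ star(Tⱼ)`, which
is `a 0` for `i = j` and 0 otherwise. Only the diagonal terms `eᵢ ⊗ eᵢ` remain. The factor `√d`
normalizes `a 0 ψ`, of squared norm `1/d`. -/
theorem MirrorSystem.exists_isometries {ψ : HilbertTensor E F} (hψ : ‖ψ‖ = 1) {πA : E →L[ℂ] E}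
    {a : Fin d → E →L[ℂ] E} {X : ℕ → E →L[ℂ] E} {πB : F →L[ℂ] F} {b : Fin d → F →L[ℂ] F}
    {Y : ℕ → F →L[ℂ] F} (h : MirrorSystem (leftRep E F) (rightRep E F) ψ πA a X πB b Y) :
    ∃ (ΦA : E →ₗᵢ[ℂ] Qudit d ⊗[ℂ] E) (ΦB : F →ₗᵢ[ℂ] Qudit d ⊗[ℂ] F) (aux : HilbertTensor E F),
      ‖aux‖ = 1 ∧ opTensor ΦA.toContinuousLinearMap ΦB.toContinuousLinearMap ψ =
        withAux (maxEntangled d) aux := by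
  have hc := leftRep_commute_rightRep (E := E) (F := F)
  have hd : (0 : ℝ) < d := by exact_mod_cast Nat.pos_of_ne_zero (NeZero.ne d)
  have hsq : ((Real.sqrt d : ℝ) : ℂ) ≠ 0 := by
    exact_mod_cast (Real.sqrt_pos.mpr hd).ne'
  refine ⟨columnIsometry _ h.chainA.sum_extendedTransport,
    columnIsometry _ h.chainB.sum_extendedTransport,
    ((Real.sqrt d : ℝ) : ℂ) • leftRep E F (a 0) ψ, ?_, ?_⟩
  · have h1 : ‖leftRep E F (a 0) ψ‖ ^ 2 = (d : ℝ)⁻¹ := by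
      rw [norm_sq_rep_proj (h.chainA.isProj 0)]
      have := h.expect_proj hc hψ 0
      rw [expect] at this
      rw [this, ← Complex.ofReal_natCast, ← Complex.ofReal_inv, Complex.ofReal_re]
    rw [norm_smul, Complex.norm_real, Real.norm_of_nonneg (Real.sqrt_nonneg _)]
    refine (pow_eq_one_iff_of_nonneg (by positivity) two_ne_zero).mp ?_
    rw [mul_pow, h1, Real.sq_sqrt hd.le, mul_inv_cancel₀ hd.ne']
  · have key : ∀ i j, opTensor (extendedTransport πA a X i) (extendedTransport πB b Y j) ψ =
        if i = j then leftRep E F (a 0) ψ else 0 := fun i j => by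
      rw [← leftRep_mul_rightRep, mul_apply_eq_comp, h.supportB.extendedTransport_apply,
        ← mul_apply_eq_comp, (hc _ _).eq, mul_apply_eq_comp, h.supportA.extendedTransport_apply,
        ← mul_apply_eq_comp, ← (hc _ _).eq, mul_apply_eq_comp,
        ← h.mirror_transport hc j j.isLt, ← mul_apply_eq_comp, ← map_mul]
      split_ifs with hij
      · rw [hij, h.chainA.transport_mul_star_self j j.isLt]
      · rw [h.chainA.transport_mul_star_of_ne i.isLt j.isLt (fun hh => hij (Fin.ext hh)),
          map_zero, zero_apply]
    rw [columnIsometry_toContinuousLinearMap, columnIsometry_toContinuousLinearMap,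
      opTensor_columnMap, withAux_maxEntangled]
    simp only [sum_apply, ContinuousLinearMap.comp_apply, key, map_smul]
    rw [← Finset.smul_sum, smul_smul, inv_mul_cancel₀ hsq, one_smul]
    refine Finset.sum_congr rfl fun i _ => ?_
    rw [Finset.sum_eq_single i]
    · rw [if_pos rfl]
    · intro j _ hj
      rw [if_neg hj.symm, map_zero]
    · simp

end Isometry

end

/-! ### Bound and equality for strategies; uniqueness of the optimal correlation. -/

noncomputable section

section Strategy

set_option linter.unusedSectionVars false

attribute [local instance] InnerProductSpace.complexToReal

variable {A B : Type*} [Ring A] [StarRing A] [Algebra ℂ A] [StarModule ℂ A]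
  [Ring B] [StarRing B] [Algebra ℂ B] [StarModule ℂ B]
  {H : Type*} [NormedAddCommGroup H] [InnerProductSpace ℂ H] [CompleteSpace H]
  {L : A →⋆ₐ[ℂ] (H →L[ℂ] H)} {R : B →⋆ₐ[ℂ] (H →L[ℂ] H)} {ψ : H}
  {d : ℕ} [NeZero d] {ε : ℝ} {P : Fin 3 → Fin d → A} {Q : Fin 4 → Fin d → B}

/-- Projective measurements of two parties in commuting representations, and a unit vector. -/
structure IsCommutingStrategy (L : A →⋆ₐ[ℂ] (H →L[ℂ] H)) (R : B →⋆ₐ[ℂ] (H →L[ℂ] H)) (ψ : H)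
    (P : Fin 3 → Fin d → A) (Q : Fin 4 → Fin d → B) : Prop where
  commute : ∀ M N, Commute (L M) (R N)
  norm_eq : ‖ψ‖ = 1
  pvmA : ∀ x k, IsPVM d (fun i => P x (Fin.ofNat d (i + k)))
  pvmB : ∀ y k, IsPVM d (fun i => Q y (Fin.ofNat d (i + k)))

/-- The correlation of two families of measurements in commuting representations. -/
def commutingCorrelation (L : A →⋆ₐ[ℂ] (H →L[ℂ] H)) (R : B →⋆ₐ[ℂ] (H →L[ℂ] H)) (ψ : H)
    (P : Fin 3 → Fin d → A) (Q : Fin 4 → Fin d → B) : Correlation (Fin 3) (Fin 4) (Fin d) (Fin d) :=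
  fun x y a b => inner ℝ (L (P x a) ψ) (R (Q y b) ψ)

namespace IsCommutingStrategy

variable (h : IsCommutingStrategy L R ψ P Q)

include h

theorem isProj_left (x : Fin 3) (a : Fin d) : IsStarProjection (P x a) := by
  simpa only [Fin.ofNat_val_add_zero] using (h.pvmA x 0).isProj a

theorem isProj_right (y : Fin 4) (b : Fin d) : IsStarProjection (Q y b) := by
  simpa only [Fin.ofNat_val_add_zero] using (h.pvmB y 0).isProj b

theorem inner_eq (x : Fin 3) (y : Fin 4) (a b : Fin d) :
    inner ℂ ψ ((L (P x a) * R (Q y b)) ψ) = (commutingCorrelation L R ψ P Q x y a b : ℂ) := by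
  have hp := h.isProj_left x a
  have hq := h.isProj_right y b
  rw [commutingCorrelation, inner_proj_proj h.commute hp hq, Complex.ofReal_pow]
  refine Eq.trans ?_ (inner_self_eq_norm_sq_to_K (𝕜 := ℂ) (L (P x a) (R (Q y b) ψ)))
  rw [inner_rep_left, hp.isSelfAdjoint.star_eq, ← mul_apply_eq_comp (L _),
    ← map_mul, hp.isIdempotentElem.eq, inner_rep_left, hq.isSelfAdjoint.star_eq,
    ← mul_apply_eq_comp (L _), (h.commute _ _).eq, ← mul_apply_eq_comp (R _),
    ← mul_assoc, ← map_mul, hq.isIdempotentElem.eq, ← (h.commute _ _).eq]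

theorem nonneg (x : Fin 3) (y : Fin 4) (a b : Fin d) :
    0 ≤ commutingCorrelation L R ψ P Q x y a b := by
  rw [commutingCorrelation, inner_proj_proj h.commute (h.isProj_left x a) (h.isProj_right y b)]
  positivity

theorem blockFunctional_le (hε : 0 < ε) (qA : Fin 2 → Fin 3) (qB : Fin 2 → Fin 4) (k : ℕ) :
    blockFunctional d ε ((commutingCorrelation L R ψ P Q).pull qA qB k) ≤ 2 * Real.sqrt 2 :=
  _root_.blockFunctional_le (u := fun s i => L (shiftedFamily qA k P s i) ψ)
    (v := fun t i => R (shiftedFamily qB k Q t i) ψ) hε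
    (fun s => (h.pvmA (qA s) k).isOutcomeFamily h.norm_eq)
    (fun t => (h.pvmB (qB t) k).isOutcomeFamily h.norm_eq)
    (fun _ _ _ _ => h.nonneg _ _ _ _)

theorem blockFunctional_eq_iff (hε : 0 < ε) (qA : Fin 2 → Fin 3) (qB : Fin 2 → Fin 4) (k : ℕ) :
    blockFunctional d ε ((commutingCorrelation L R ψ P Q).pull qA qB k) = 2 * Real.sqrt 2 ↔
      BlockOptimal d (fun s i => L (shiftedFamily qA k P s i) ψ)
        (fun t i => R (shiftedFamily qB k Q t i) ψ) :=
  _root_.blockFunctional_eq_iff (u := fun s i => L (shiftedFamily qA k P s i) ψ)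
    (v := fun t i => R (shiftedFamily qB k Q t i) ψ) hε
    (fun s => (h.pvmA (qA s) k).isOutcomeFamily h.norm_eq)
    (fun t => (h.pvmB (qB t) k).isOutcomeFamily h.norm_eq)
    (fun _ _ _ _ => h.nonneg _ _ _ _)

theorem bell_le (hε : 0 < ε) (hd : 2 ≤ d) :
    bell ε (commutingCorrelation L R ψ P Q) ≤ quantumBound d := by
  have h1 := h.blockFunctional_le hε ![0, 1] ![0, 1] 0
  have h2 := h.blockFunctional_le hε ![0, 2] ![2, 3] 1
  rcases hd.lt_or_eq with hd | hd
  · rw [bell_eq_add hd, quantumBound, if_pos hd]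
    linarith
  · rw [bell_eq_of_two hd.symm, quantumBound, if_neg (by omega)]
    linarith

theorem bell_eq_iff (hε : 0 < ε) (hd : 2 ≤ d) :
    bell ε (commutingCorrelation L R ψ P Q) = quantumBound d ↔ OptimalPair L R ψ P Q := by
  have h1 := h.blockFunctional_le hε ![0, 1] ![0, 1] 0
  have h2 := h.blockFunctional_le hε ![0, 2] ![2, 3] 1
  have e1 := h.blockFunctional_eq_iff hε ![0, 1] ![0, 1] 0
  have e2 := h.blockFunctional_eq_iff hε ![0, 2] ![2, 3] 1
  rcases hd.lt_or_eq with hd | hd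
  · rw [bell_eq_add hd, quantumBound, if_pos hd]
    constructor
    · intro heq
      exact ⟨h.pvmA, h.pvmB, e1.mp (by linarith), fun _ => e2.mp (by linarith)⟩
    · intro ho
      rw [e1.mpr ho.opt, e2.mpr (ho.opt' hd)]
      ring
  · rw [bell_eq_of_two hd.symm, quantumBound, if_neg (by omega), add_zero, mul_one, e1]
    exact ⟨fun ho => ⟨h.pvmA, h.pvmB, ho, fun hlt => by omega⟩, fun ho => ho.opt⟩

end IsCommutingStrategy

/-- The coefficients of a combination of two projections and one link operator. -/
structure LinkCombo (d : ℕ) where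
  α : ℝ
  β : ℝ
  γ : ℝ
  i : Fin d
  j : Fin d
  e : ℕ

/-- The vector with given coefficients. -/
def LinkCombo.eval {V : Type*} [AddCommGroup V] [Module ℝ V] (c : LinkCombo d) (D : Fin d → V)
    (O : ℕ → V) : V :=
  c.α • D c.i + c.β • D c.j + c.γ • O c.e

/-- The inner product of two combinations in an optimal strategy. -/
def LinkCombo.pairing (c c' : LinkCombo d) : ℝ :=
  let δ : Fin d → Fin d → ℝ := fun i j => if i = j then (d : ℝ)⁻¹ else 0
  c.α * (c'.α * δ c.i c'.i) + c.α * (c'.β * δ c.i c'.j) + c.β * (c'.α * δ c.j c'.i) +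
    c.β * (c'.β * δ c.j c'.j) + c.γ * (c'.γ * if c.e = c'.e then 2 * (d : ℝ)⁻¹ else 0)

/-- The projection vectors of question 0 and the link vectors are mutually orthogonal, with squared
norms `1/d` and `2/d`, whatever the strategy. -/
theorem OptimalPair.inner_eval (h : OptimalPair L R ψ P Q) (hcm : ∀ M N, Commute (L M) (R N))
    (hψ : ‖ψ‖ = 1) {πA : A} (hA : IsSupport L R ψ πA) {πB : B} (hB : IsSupport R L ψ πB)
    {c c' : LinkCombo d} (hc : IsEdge d c.e) (hc' : IsEdge d c'.e) :
    inner ℝ (c.eval (fun i => L (P 0 i) ψ) (fun e => L (linkOp P e) ψ))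
      (c'.eval (fun i => L (P 0 i) ψ) (fun e => L (linkOp P e) ψ)) = c.pairing c' := by
  obtain ⟨b, Y, hsys⟩ := h.exists_mirrorSystem hcm hA hB
  have key : ∀ M N : A, star (M * πA) = M * πA →
      inner ℝ (L M ψ) (L N ψ) = (expect L ψ (M * πA * (N * πA))).re := by
    intro M N hM
    rw [← hA.map_mul_apply M, ← hA.map_mul_apply N, real_inner_eq_re_inner ℂ, inner_rep_left, hM,
      expect, map_mul _ (M * πA), mul_apply_eq_comp]
    rfl
  have hDD : ∀ i j, inner ℝ (L (P 0 i) ψ) (L (P 0 j) ψ) = if i = j then (d : ℝ)⁻¹ else 0 := by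
    intro i j
    rw [key _ _ (hsys.star_proj i), hsys.expect_proj_mul_proj hcm hψ]
    split_ifs
    · rw [← Complex.ofReal_natCast, ← Complex.ofReal_inv, Complex.ofReal_re]
    · rfl
  have hDO : ∀ i e, IsEdge d e → inner ℝ (L (P 0 i) ψ) (L (linkOp P e) ψ) = 0 := by
    intro i e he
    rw [key _ _ (hsys.star_proj i), hsys.expect_proj_mul_link hcm he, Complex.zero_re]
  have hOD : ∀ i e, IsEdge d e → inner ℝ (L (linkOp P e) ψ) (L (P 0 i) ψ) = 0 := fun i e he => by
    rw [real_inner_comm, hDO i e he]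
  have hOO : ∀ e f, IsEdge d e → IsEdge d f → inner ℝ (L (linkOp P e) ψ) (L (linkOp P f) ψ) =
      if e = f then 2 * (d : ℝ)⁻¹ else 0 := by
    intro e f he hf
    rw [key _ _ (hsys.chainA.link e he).star_eq, hsys.expect_link_mul_link hcm hψ he hf]
    split_ifs
    · rw [← Complex.ofReal_natCast, ← Complex.ofReal_inv]
      simp
    · rfl
  simp only [LinkCombo.eval, LinkCombo.pairing, inner_add_left, inner_add_right,
    real_inner_smul_left, real_inner_smul_right, hDD, hDO _ _ hc', hOD _ _ hc, hOO _ _ hc hc']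
  ring

/-- The coefficients of the vectors of one question: on a block, the observable with outcomes `±1`
is `c` times the diagonal one plus `s` times the link operator. -/
def blockCombo (k : ℕ) (c s : ℝ) (n : ℕ) : LinkCombo d :=
  if n / 2 < d / 2 then
    ⟨(1 + (-1) ^ n * c) / 2, (1 - (-1) ^ n * c) / 2, (-1) ^ n * s / 2,
      Fin.ofNat d (2 * (n / 2) + k), Fin.ofNat d (2 * (n / 2) + 1 + k), 2 * (n / 2) + k⟩
  -- The left-over answer for odd `d`. The entries with coefficient 0 are placeholders; 0 is chosen
  -- as edge because it is always a genuine one when `2 ≤ d`.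
  else ⟨1, 0, 0, Fin.ofNat d (n + k), 0, 0⟩

theorem isEdge_blockCombo {k c s n} (hd : 2 ≤ d) (hk : k = 0 ∨ k = 1 ∧ 2 < d) :
    IsEdge d (blockCombo (d := d) k c s n).e := by
  unfold blockCombo
  split_ifs with h
  · refine ⟨?_, fun he => ?_, fun ho => ?_⟩
    · rcases hk with rfl | ⟨rfl, hk⟩ <;> dsimp only <;> omega
    · have he : Even (2 * (n / 2) + k) := he
      rw [Nat.even_iff] at he
      rcases hk with rfl | ⟨rfl, hk⟩ <;> dsimp only <;> omega
    · have ho : Odd (2 * (n / 2) + k) := ho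
      rw [Nat.odd_iff] at ho
      omega
  · exact isEdge_of_succ_lt (by dsimp only; omega)

/-- A family of vectors is determined on a block by its sum and difference. -/
theorem eq_blockCombo_eval {V : Type*} [AddCommGroup V] [Module ℝ V] {D : Fin d → V} {O : ℕ → V}
    {k : ℕ} {c s : ℝ} {w : ℕ → V}
    (hsum : ∀ m < d / 2, w (2 * m) + w (2 * m + 1) =
      D (Fin.ofNat d (2 * m + k)) + D (Fin.ofNat d (2 * m + 1 + k)))
    (hdiff : ∀ m < d / 2, w (2 * m) - w (2 * m + 1) =
      c • (D (Fin.ofNat d (2 * m + k)) - D (Fin.ofNat d (2 * m + 1 + k))) + s • O (2 * m + k))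
    (hlast : Odd d → w (d - 1) = D (Fin.ofNat d (d - 1 + k))) {n : ℕ} (hn : n < d) :
    w n = (blockCombo k c s n).eval D O := by
  unfold blockCombo
  rcases exists_block_index hn with ⟨m, hm, rfl | rfl⟩ | ⟨ho, rfl⟩
  · have h1 : 2 * m / 2 = m := by omega
    have h2 : ((-1 : ℝ)) ^ (2 * m) = 1 := by rw [pow_mul]; simp
    have h3 : w (2 * m) = (1 / 2 : ℝ) • ((w (2 * m) + w (2 * m + 1)) +
        (w (2 * m) - w (2 * m + 1))) := by module
    rw [h1, if_pos hm, LinkCombo.eval, h3, hsum m hm, hdiff m hm, h2]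
    module
  · have h1 : (2 * m + 1) / 2 = m := by omega
    have h2 : ((-1 : ℝ)) ^ (2 * m + 1) = -1 := by rw [pow_succ, pow_mul]; simp
    have h3 : w (2 * m + 1) = (1 / 2 : ℝ) • ((w (2 * m) + w (2 * m + 1)) -
        (w (2 * m) - w (2 * m + 1))) := by module
    rw [h1, if_pos hm, LinkCombo.eval, h3, hsum m hm, hdiff m hm, h2]
    module
  · have : ¬ (d - 1) / 2 < d / 2 := by rw [Nat.odd_iff] at ho; omega
    rw [if_neg this, LinkCombo.eval, hlast ho]
    simp

/-- The vectors of both parties are universal combinations of those of two questions. -/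
theorem BlockOptimal.eq_blockCombo {u v : Fin 2 → ℕ → H} (h : BlockOptimal d u v)
    (hblock : ∀ m < d / 2, ∀ s t, u s (2 * m) + u s (2 * m + 1) = v t (2 * m) + v t (2 * m + 1))
    {D : Fin d → H} {O : ℕ → H} {k : ℕ} (hD : ∀ n, u 0 n = D (Fin.ofNat d (n + k)))
    (hO : ∀ m < d / 2, u 1 (2 * m) - u 1 (2 * m + 1) = O (2 * m + k)) {n : ℕ} (hn : n < d) :
    (u 0 n = (blockCombo k 1 0 n).eval D O ∧ u 1 n = (blockCombo k 0 1 n).eval D O) ∧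
    (v 0 n = (blockCombo k (Real.sqrt 2 / 2) (Real.sqrt 2 / 2) n).eval D O ∧
      v 1 n = (blockCombo k (Real.sqrt 2 / 2) (-(Real.sqrt 2 / 2)) n).eval D O) := by
  have hq : Real.sqrt 2 / 2 * (Real.sqrt 2 / 2) = 1 / 2 := by
    rw [div_mul_div_comm, Real.mul_self_sqrt (by norm_num)]
    norm_num
  have hv : ∀ m < d / 2, ∀ t, v t (2 * m) + v t (2 * m + 1) =
      D (Fin.ofNat d (2 * m + k)) + D (Fin.ofNat d (2 * m + 1 + k)) := fun m hm t => by
    rw [← hblock m hm 0 t, hD, hD]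
  -- The optimality relations are inverted: `c = 1` isolates the difference of `v 0`, and `c = -1`
  -- that of `v 1`.
  have hdiff : ∀ m < d / 2, ∀ c : ℝ, (Real.sqrt 2 / 2) •
      (D (Fin.ofNat d (2 * m + k)) - D (Fin.ofNat d (2 * m + 1 + k))) +
      (c * (Real.sqrt 2 / 2)) • O (2 * m + k) =
      (1 / 2 : ℝ) • ((1 + c) • (v 0 (2 * m) - v 0 (2 * m + 1)) +
        (1 - c) • (v 1 (2 * m) - v 1 (2 * m + 1))) := fun m hm c => by
    rw [← hO m hm, ← hD, ← hD, h.diff_zero m hm, h.diff_one m hm, smul_smul, smul_smul, mul_assoc,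
      hq]
    module
  refine ⟨⟨eq_blockCombo_eval (fun m _ => ?_) (fun m _ => ?_) (fun _ => hD _) hn,
    eq_blockCombo_eval (fun m hm => ?_) (fun m hm => ?_) (fun ho => ?_) hn⟩,
    eq_blockCombo_eval (fun m hm => hv m hm 0) (fun m hm => ?_) (fun ho => ?_) hn,
    eq_blockCombo_eval (fun m hm => hv m hm 1) (fun m hm => ?_) (fun ho => ?_) hn⟩
  · rw [hD, hD]
  · rw [hD, hD]
    simp
  · rw [hblock m hm 1 0, hv m hm 0]
  · rw [hO m hm]
    simp
  · rw [h.last ho 1 0, ← h.last ho 0 0, hD]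
  · have := hdiff m hm 1
    rw [one_mul] at this
    rw [this]
    module
  · rw [← h.last ho 0 0, hD]
  · have := hdiff m hm (-1)
    rw [neg_one_mul] at this
    rw [this]
    module
  · rw [← h.last ho 0 1, hD]

/-- The answer that a shift by `k` moves to `i`. -/
def unshift (k : ℕ) (i : Fin d) : ℕ := (Fin.exists_ofNat_add_eq k i).choose

theorem unshift_lt (k : ℕ) (i : Fin d) : unshift k i < d := (Fin.exists_ofNat_add_eq k i).choose_spec.1

theorem ofNat_unshift_add (k : ℕ) (i : Fin d) : Fin.ofNat d (unshift k i + k) = i :=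
  (Fin.exists_ofNat_add_eq k i).choose_spec.2

/-- The coefficients of the vectors of the first party. -/
def leftCombo (x : Fin 3) (i : Fin d) : LinkCombo d :=
  ![blockCombo 0 1 0 i, blockCombo 0 0 1 i, blockCombo 1 0 1 (unshift 1 i)] x

/-- The coefficients of the vectors of the second party. -/
def rightCombo (y : Fin 4) (i : Fin d) : LinkCombo d :=
  ![blockCombo 0 (Real.sqrt 2 / 2) (Real.sqrt 2 / 2) i,
    blockCombo 0 (Real.sqrt 2 / 2) (-(Real.sqrt 2 / 2)) i,
    blockCombo 1 (Real.sqrt 2 / 2) (Real.sqrt 2 / 2) (unshift 1 i),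
    blockCombo 1 (Real.sqrt 2 / 2) (-(Real.sqrt 2 / 2)) (unshift 1 i)] y

theorem OptimalPair.eq_combo (hcm : ∀ M N, Commute (L M) (R N)) (h : OptimalPair L R ψ P Q)
    (i : Fin d) :
    (L (P 0 i) ψ = (leftCombo 0 i).eval (fun i => L (P 0 i) ψ) (fun e => L (linkOp P e) ψ) ∧
      L (P 1 i) ψ = (leftCombo 1 i).eval (fun i => L (P 0 i) ψ) (fun e => L (linkOp P e) ψ)) ∧
    (R (Q 0 i) ψ = (rightCombo 0 i).eval (fun i => L (P 0 i) ψ) (fun e => L (linkOp P e) ψ) ∧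
      R (Q 1 i) ψ = (rightCombo 1 i).eval (fun i => L (P 0 i) ψ) (fun e => L (linkOp P e) ψ)) := by
  have hb := fun m hm s t => h.opt.mirror_block hcm (fun s => h.pvmA _ _) (fun t => h.pvmB _ _)
    (m := m) hm s t
  have := h.opt.eq_blockCombo (D := fun i => L (P 0 i) ψ) (O := fun e => L (linkOp P e) ψ) (k := 0)
    (fun m hm s t => by
      have := hb m hm s t
      simp only [map_add, add_apply] at this
      exact this) (fun n => rfl)
    (fun m _ => by
      rw [linkOp, if_pos (by simp), map_sub, sub_apply]
      rfl) i.isLt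
  simp only [shiftedFamily, Fin.ofNat_val_add_zero] at this
  exact this

theorem OptimalPair.eq_combo' (hcm : ∀ M N, Commute (L M) (R N)) (h : OptimalPair L R ψ P Q)
    (hd : 2 < d) (i : Fin d) :
    L (P 2 i) ψ = (leftCombo 2 i).eval (fun i => L (P 0 i) ψ) (fun e => L (linkOp P e) ψ) ∧
    (R (Q 2 i) ψ = (rightCombo 2 i).eval (fun i => L (P 0 i) ψ) (fun e => L (linkOp P e) ψ) ∧
      R (Q 3 i) ψ = (rightCombo 3 i).eval (fun i => L (P 0 i) ψ) (fun e => L (linkOp P e) ψ)) := by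
  have hb := fun m hm s t => (h.opt' hd).mirror_block hcm (fun s => h.pvmA _ _)
    (fun t => h.pvmB _ _) (m := m) hm s t
  have := (h.opt' hd).eq_blockCombo (D := fun i => L (P 0 i) ψ) (O := fun e => L (linkOp P e) ψ)
    (k := 1) (fun m hm s t => by
      have := hb m hm s t
      simp only [map_add, add_apply] at this
      exact this) (fun n => rfl)
    (fun m _ => by
      rw [linkOp, if_neg (by simp), map_sub, sub_apply, add_right_comm]
      rfl) (unshift_lt 1 i)
  simp only [shiftedFamily, ofNat_unshift_add] at this
  exact ⟨this.1.2, this.2⟩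

theorem isEdge_leftCombo (hd : 2 ≤ d) {x : Fin 3} (hx : x = 0 ∨ x = 1 ∨ 2 < d) (i : Fin d) :
    IsEdge d (leftCombo x i).e := by
  have h3 : x = 0 ∨ x = 1 ∨ x = 2 := by
    fin_cases x <;> simp
  rcases h3 with rfl | rfl | rfl
  · exact isEdge_blockCombo hd (Or.inl rfl)
  · exact isEdge_blockCombo hd (Or.inl rfl)
  · exact isEdge_blockCombo hd (Or.inr ⟨rfl, by simpa using hx⟩)

theorem isEdge_rightCombo (hd : 2 ≤ d) {y : Fin 4} (hy : y = 0 ∨ y = 1 ∨ 2 < d) (i : Fin d) :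
    IsEdge d (rightCombo y i).e := by
  have h3 : y = 0 ∨ y = 1 ∨ y = 2 ∨ y = 3 := by
    fin_cases y <;> simp
  rcases h3 with rfl | rfl | rfl | rfl
  · exact isEdge_blockCombo hd (Or.inl rfl)
  · exact isEdge_blockCombo hd (Or.inl rfl)
  · exact isEdge_blockCombo hd (Or.inr ⟨rfl, by simpa using hy⟩)
  · exact isEdge_blockCombo hd (Or.inr ⟨rfl, by simpa using hy⟩)

/-- The correlation of an optimal strategy is determined, on the questions that matter. -/
theorem OptimalPair.correlation_eq (h : OptimalPair L R ψ P Q) (hcm : ∀ M N, Commute (L M) (R N))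
    (hψ : ‖ψ‖ = 1) {πA : A} (hA : IsSupport L R ψ πA) {πB : B} (hB : IsSupport R L ψ πB)
    (hd : 2 ≤ d) {x : Fin 3} (hx : x = 0 ∨ x = 1 ∨ 2 < d) {y : Fin 4} (hy : y = 0 ∨ y = 1 ∨ 2 < d)
    (a b : Fin d) :
    commutingCorrelation L R ψ P Q x y a b = (leftCombo x a).pairing (rightCombo y b) := by
  rw [← h.inner_eval hcm hψ hA hB (isEdge_leftCombo hd hx a) (isEdge_rightCombo hd hy b),
    commutingCorrelation]
  have h3 : x = 0 ∨ x = 1 ∨ x = 2 := by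
    fin_cases x <;> simp
  have h4 : y = 0 ∨ y = 1 ∨ y = 2 ∨ y = 3 := by
    fin_cases y <;> simp
  congr 1
  · rcases h3 with rfl | rfl | rfl
    · exact (h.eq_combo hcm a).1.1
    · exact (h.eq_combo hcm a).1.2
    · exact (h.eq_combo' hcm (by simpa using hx) a).1
  · rcases h4 with rfl | rfl | rfl | rfl
    · exact (h.eq_combo hcm b).2.1
    · exact (h.eq_combo hcm b).2.2
    · exact (h.eq_combo' hcm (by simpa using hy) b).2.1
    · exact (h.eq_combo' hcm (by simpa using hy) b).2.2

end Strategy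

end

/-! ### Rotated bases that satisfy the optimality relations. -/

noncomputable section

section Ideal

variable {E H : Type*} [NormedAddCommGroup E] [InnerProductSpace ℂ E] [NormedAddCommGroup H]
  [InnerProductSpace ℂ H] {d : ℕ}

/-- The other element of the block `{2m, 2m + 1}` that contains `n`. -/
def blockPartner (n : ℕ) : ℕ := 2 * (n / 2) + (1 - n % 2)

/-- The vector `n` of the family `f`, rotated by the angle `φ` in the plane of its block. -/
def rotated (d : ℕ) (φ : ℝ) (f : ℕ → E) (n : ℕ) : E :=
  if n / 2 < d / 2 then
    (Real.cos φ : ℂ) • f n + (((-1) ^ n * Real.sin φ : ℝ) : ℂ) • f (blockPartner n)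
  else f n

theorem rotated_even {φ : ℝ} {f : ℕ → E} {m : ℕ} (hm : m < d / 2) :
    rotated d φ f (2 * m) =
      (Real.cos φ : ℂ) • f (2 * m) + (Real.sin φ : ℂ) • f (2 * m + 1) := by
  have h1 : 2 * m / 2 = m := by omega
  have h2 : blockPartner (2 * m) = 2 * m + 1 := by unfold blockPartner; omega
  have h3 : ((-1 : ℝ)) ^ (2 * m) = 1 := by rw [pow_mul]; simp
  rw [rotated, h1, if_pos hm, h2, h3, one_mul]

theorem rotated_odd {φ : ℝ} {f : ℕ → E} {m : ℕ} (hm : m < d / 2) :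
    rotated d φ f (2 * m + 1) =
      (Real.cos φ : ℂ) • f (2 * m + 1) - (Real.sin φ : ℂ) • f (2 * m) := by
  have h1 : (2 * m + 1) / 2 = m := by omega
  have h2 : blockPartner (2 * m + 1) = 2 * m := by unfold blockPartner; omega
  have h3 : ((-1 : ℝ)) ^ (2 * m + 1) = -1 := by rw [pow_succ, pow_mul]; simp
  rw [rotated, h1, if_pos hm, h2, h3, neg_one_mul, Complex.ofReal_neg, neg_smul, sub_eq_add_neg]

theorem rotated_last {φ : ℝ} {f : ℕ → E} (hd : Odd d) : rotated d φ f (d - 1) = f (d - 1) := by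
  rw [rotated, if_neg]
  rw [Nat.odd_iff] at hd
  omega

theorem rotated_zero {f : ℕ → E} {n : ℕ} : rotated d 0 f n = f n := by
  simp [rotated]

theorem inner_rotated_of_ne_block {f : ℕ → E}
    (hf : ∀ n < d, ∀ n' < d, n ≠ n' → inner ℂ (f n) (f n') = 0) {φ φ' : ℝ} {n n' : ℕ} (hn : n < d)
    (hn' : n' < d) (h : n / 2 ≠ n' / 2) :
    inner ℂ (rotated d φ f n) (rotated d φ' f n') = 0 := by
  have hp : ∀ a < d, ∀ φ, ∃ x y : ℂ, ∃ b < d, b / 2 = a / 2 ∧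
      rotated d φ f a = x • f a + y • f b := by
    intro a ha φ
    by_cases hlt : a / 2 < d / 2
    · exact ⟨_, _, blockPartner a, by unfold blockPartner; omega, by unfold blockPartner; omega,
        if_pos hlt⟩
    · exact ⟨1, 0, a, ha, rfl, by rw [rotated, if_neg hlt]; simp⟩
  obtain ⟨x, y, b, hb, hab, e1⟩ := hp n hn φ
  obtain ⟨x', y', b', hb', hab', e2⟩ := hp n' hn' φ'
  have hne : ∀ i j, i / 2 = n / 2 → j / 2 = n' / 2 → i ≠ j := fun i j hi hj hij => by
    subst hij; omega
  rw [e1, e2]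
  simp only [inner_add_left, inner_add_right, inner_smul_left, inner_smul_right,
    hf _ hn _ hn' (hne _ _ rfl rfl), hf _ hn _ hb' (hne _ _ rfl hab'),
    hf _ hb _ hn' (hne _ _ hab rfl), hf _ hb _ hb' (hne _ _ hab hab')]
  simp

theorem inner_rotated {f : ℕ → E}
    (hf : ∀ n < d, ∀ n' < d, n ≠ n' → inner ℂ (f n) (f n') = 0)
    (hf1 : ∀ n < d, inner ℂ (f n) (f n) = 1) {φ : ℝ} {n n' : ℕ} (hn : n < d)
    (hn' : n' < d) : inner ℂ (rotated d φ f n) (rotated d φ f n') = if n = n' then 1 else 0 := by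
  by_cases h : n / 2 = n' / 2
  swap
  · rw [inner_rotated_of_ne_block hf hn hn' h, if_neg (fun hh => h (by rw [hh]))]
  have hcs : (Real.cos φ : ℂ) * Real.cos φ + Real.sin φ * Real.sin φ = 1 := by
    rw [← Complex.ofReal_mul, ← Complex.ofReal_mul, ← Complex.ofReal_add, ← sq, ← sq,
      Real.cos_sq_add_sin_sq, Complex.ofReal_one]
  rcases exists_block_index hn with ⟨m, hm, h1⟩ | ⟨ho, h1⟩
  · have a0 := hf1 (2 * m) (by omega)
    have a1 := hf1 (2 * m + 1) (by omega)
    have a01 := hf (2 * m) (by omega) (2 * m + 1) (by omega) (by omega)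
    have a10 := hf (2 * m + 1) (by omega) (2 * m) (by omega) (by omega)
    have h2 : n' = 2 * m ∨ n' = 2 * m + 1 := by omega
    rcases h1 with rfl | rfl <;> rcases h2 with rfl | rfl <;>
      simp only [rotated_even hm, rotated_odd hm, inner_add_left, inner_add_right, inner_sub_left,
        inner_sub_right, inner_smul_left, inner_smul_right, a0, a1, a01, a10, Complex.conj_ofReal]
    · rw [if_pos trivial]; linear_combination hcs
    · rw [if_neg (by omega)]; ring
    · rw [if_neg (by omega)]; ring
    · rw [if_pos trivial]; linear_combination hcs
  · have h2 : n' = d - 1 := by rw [Nat.odd_iff] at ho; omega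
    rw [h1, h2, rotated_last ho, hf1 _ (by omega), if_pos rfl]

attribute [local instance] InnerProductSpace.complexToReal

theorem BlockOptimal.congr {u v u' v' : Fin 2 → ℕ → H} (h : BlockOptimal d u v)
    (hu : ∀ s, ∀ n < d, u s n = u' s n) (hv : ∀ s, ∀ n < d, v s n = v' s n) :
    BlockOptimal d u' v' where
  diff_zero m hm := by
    rw [← hu _ _ (by omega), ← hu _ _ (by omega), ← hv _ _ (by omega), ← hv _ _ (by omega),
      ← hv _ _ (by omega), ← hv _ _ (by omega), h.diff_zero m hm]
  diff_one m hm := by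
    rw [← hu _ _ (by omega), ← hu _ _ (by omega), ← hv _ _ (by omega), ← hv _ _ (by omega),
      ← hv _ _ (by omega), ← hv _ _ (by omega), h.diff_one m hm]
  last ho s t := by
    have : d - 1 < d := Nat.sub_lt ho.pos one_pos
    rw [← hu _ _ this, ← hv _ _ this, h.last ho]
  cross s t a ha b hb hab := by rw [← hu _ _ ha, ← hv _ _ hb, h.cross s t a ha b hb hab]

/-- Rotating both factors by `φ` turns the pair of diagonal and off-diagonal combinations by `2φ`.
-/
theorem tmul_rotated_diff (τ : E →ₗ[ℂ] E →ₗ[ℂ] H) {f : ℕ → E} {φ : ℝ} {m : ℕ} (hm : m < d / 2) :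
    τ (rotated d φ f (2 * m)) (rotated d φ f (2 * m)) -
      τ (rotated d φ f (2 * m + 1)) (rotated d φ f (2 * m + 1)) =
    (Real.cos (2 * φ) : ℂ) • (τ (f (2 * m)) (f (2 * m)) - τ (f (2 * m + 1)) (f (2 * m + 1))) +
      (Real.sin (2 * φ) : ℂ) • (τ (f (2 * m)) (f (2 * m + 1)) + τ (f (2 * m + 1)) (f (2 * m))) := by
  have h1 : (Real.cos (2 * φ) : ℂ) =
      Real.cos φ * Real.cos φ - Real.sin φ * Real.sin φ := by
    rw [Real.cos_two_mul', sq, sq]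
    push_cast
    rfl
  have h2 : (Real.sin (2 * φ) : ℂ) = 2 * Real.sin φ * Real.cos φ := by
    rw [Real.sin_two_mul]
    push_cast
    rfl
  rw [h1, h2, rotated_even hm, rotated_odd hm]
  simp only [map_add, map_sub, map_smul, LinearMap.add_apply, LinearMap.sub_apply,
    LinearMap.smul_apply]
  module

/-- The angles of the first party. -/
def leftAngle (s : Fin 2) : ℝ := ![0, Real.pi / 4] s

/-- The angles of the second party. -/
def rightAngle (t : Fin 2) : ℝ := ![Real.pi / 8, -(Real.pi / 8)] t

/-- After doubling, the angles 0 and π/4 give the diagonal vector `D` and the off-diagonal vector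
`O`, and ±π/8 give `(√2/2)(D ± O)`. The relations then reduce to `2 (√2/2)² = 1`. -/
theorem blockOptimal_rotated (τ : E →ₗ[ℂ] E →ₗ[ℂ] H)
    (hτ : ∀ x y x' y', inner ℂ (τ x y) (τ x' y') = inner ℂ x x' * inner ℂ y y') {f : ℕ → E}
    (hf : ∀ n < d, ∀ n' < d, n ≠ n' → inner ℂ (f n) (f n') = 0) (κ : ℂ) :
    BlockOptimal d
      (fun s n => κ • τ (rotated d (leftAngle s) f n) (rotated d (leftAngle s) f n))
      (fun t n => κ • τ (rotated d (rightAngle t) f n) (rotated d (rightAngle t) f n)) := by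
  have hq : ((Real.sqrt 2 / 2 : ℝ) : ℂ) * ((Real.sqrt 2 / 2 : ℝ) : ℂ) = 1 / 2 := by
    rw [← Complex.ofReal_mul, div_mul_div_comm, Real.mul_self_sqrt (by norm_num)]
    norm_num
  have e1 : 2 * (Real.pi / 4) = Real.pi / 2 := by ring
  have e2 : 2 * (Real.pi / 8) = Real.pi / 4 := by ring
  have e3 : 2 * -(Real.pi / 8) = -(Real.pi / 4) := by ring
  have hL0 : leftAngle 0 = 0 := rfl
  have hL1 : leftAngle 1 = Real.pi / 4 := rfl
  have hR0 : rightAngle 0 = Real.pi / 8 := rfl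
  have hR1 : rightAngle 1 = -(Real.pi / 8) := rfl
  refine ⟨fun m hm => ?_, fun m hm => ?_, fun ho s t => ?_, fun s t a ha b hb hab => ?_⟩
  · simp only [← smul_sub, tmul_rotated_diff τ hm, hL0, hR0, hR1, e2, e3, mul_zero, Real.cos_zero,
      Real.sin_zero, Real.cos_neg, Real.sin_neg, Real.cos_pi_div_four, Real.sin_pi_div_four]
    rw [← Complex.coe_smul]
    simp only [Complex.ofReal_neg, Complex.ofReal_one, Complex.ofReal_zero]
    generalize ((Real.sqrt 2 / 2 : ℝ) : ℂ) = q at hq ⊢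
    generalize τ (f (2 * m)) (f (2 * m)) - τ (f (2 * m + 1)) (f (2 * m + 1)) = D
    generalize τ (f (2 * m)) (f (2 * m + 1)) + τ (f (2 * m + 1)) (f (2 * m)) = O
    have : κ • D = (κ * (2 * (q * q))) • D := by rw [hq]; norm_num
    rw [zero_smul, one_smul, add_zero, this]
    module
  · simp only [← smul_sub, tmul_rotated_diff τ hm, hL1, hR0, hR1, e1, e2, e3, Real.cos_pi_div_two,
      Real.sin_pi_div_two, Real.cos_neg, Real.sin_neg, Real.cos_pi_div_four, Real.sin_pi_div_four]
    rw [← Complex.coe_smul]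
    simp only [Complex.ofReal_neg, Complex.ofReal_one, Complex.ofReal_zero]
    generalize ((Real.sqrt 2 / 2 : ℝ) : ℂ) = q at hq ⊢
    generalize τ (f (2 * m)) (f (2 * m)) - τ (f (2 * m + 1)) (f (2 * m + 1)) = D
    generalize τ (f (2 * m)) (f (2 * m + 1)) + τ (f (2 * m + 1)) (f (2 * m)) = O
    have : κ • O = (κ * (2 * (q * q))) • O := by rw [hq]; norm_num
    rw [zero_smul, one_smul, zero_add, this]
    module
  · simp only [rotated_last ho]
  · rw [real_inner_eq_re_inner ℂ, inner_smul_left, inner_smul_right, hτ,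
      inner_rotated_of_ne_block hf ha hb hab]
    simp

end Ideal

end

/-! ### The ideal strategy on the maximally entangled state. -/

noncomputable section

section AbstractIdeal

set_option linter.unusedSectionVars false

attribute [local instance] InnerProductSpace.complexToReal

variable {A B : Type*} [Ring A] [StarRing A] [Algebra ℂ A] [StarModule ℂ A]
  [Ring B] [StarRing B] [Algebra ℂ B] [StarModule ℂ B]
  {E H : Type*} [NormedAddCommGroup E] [InnerProductSpace ℂ E]
  [NormedAddCommGroup H] [InnerProductSpace ℂ H] [CompleteSpace H]
  {L : A →⋆ₐ[ℂ] (H →L[ℂ] H)} {R : B →⋆ₐ[ℂ] (H →L[ℂ] H)} {ψ : H}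
  {d : ℕ} [NeZero d] {P : Fin 3 → Fin d → A} {Q : Fin 4 → Fin d → B}

/-- The family `e`, rotated in the blocks `{2m + k, 2m + k + 1}`. -/
def rotatedVec (e : Fin d → E) (φ : ℝ) (k : ℕ) (i : Fin d) : E :=
  rotated d φ (fun n => e (Fin.ofNat d (n + k))) (unshift k i)

/-- The measurement vectors of the first party in the ideal strategy. -/
def leftVec (e : Fin d → E) (x : Fin 3) : Fin d → E :=
  ![rotatedVec e 0 0, rotatedVec e (Real.pi / 4) 0, rotatedVec e (Real.pi / 4) 1] x

/-- The measurement vectors of the second party in the ideal strategy. -/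
def rightVec (e : Fin d → E) (y : Fin 4) : Fin d → E :=
  ![rotatedVec e (Real.pi / 8) 0, rotatedVec e (-(Real.pi / 8)) 0, rotatedVec e (Real.pi / 8) 1,
    rotatedVec e (-(Real.pi / 8)) 1] y

theorem rotatedVec_ofNat (e : Fin d → E) (φ : ℝ) (k : ℕ) {n : ℕ} (hn : n < d) :
    rotatedVec e φ k (Fin.ofNat d (n + k)) =
      rotated d φ (fun n => e (Fin.ofNat d (n + k))) n := by
  rw [rotatedVec, (Fin.ofNat_add_inj_of_lt (unshift_lt k _) hn).mp (ofNat_unshift_add k _)]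

theorem rotatedVec_zero (e : Fin d → E) (k : ℕ) : rotatedVec e 0 k = e := by
  funext i
  rw [rotatedVec, rotated_zero, ofNat_unshift_add]

theorem OptimalPair.of_rotated (hP : ∀ x k, IsPVM d (fun i => P x (Fin.ofNat d (i + k))))
    (hQ : ∀ y k, IsPVM d (fun i => Q y (Fin.ofNat d (i + k)))) (τ : E →ₗ[ℂ] E →ₗ[ℂ] H)
    (hτ : ∀ x y x' y', inner ℂ (τ x y) (τ x' y') = inner ℂ x x' * inner ℂ y y') {e : Fin d → E}
    (he : Orthonormal ℂ e) (κ : ℂ)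
    (hL : ∀ x a, L (P x a) ψ = κ • τ (leftVec e x a) (leftVec e x a))
    (hR : ∀ y b, R (Q y b) ψ = κ • τ (rightVec e y b) (rightVec e y b)) :
    OptimalPair L R ψ P Q := by
  have hf : ∀ k, ∀ n < d, ∀ n' < d, n ≠ n' →
      inner ℂ (e (Fin.ofNat d (n + k))) (e (Fin.ofNat d (n' + k))) = 0 := fun k n hn n' hn' hne =>
    he.2 fun h => hne ((Fin.ofNat_add_inj_of_lt hn hn').mp h)
  -- The rotation by 0 is trivial for either division into blocks, so question 0 can serve both
  -- halves.
  have h0 : leftVec e 0 = rotatedVec e 0 1 := by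
    rw [leftVec, rotatedVec_zero, rotatedVec_zero]
    rfl
  refine ⟨hP, hQ, (blockOptimal_rotated τ hτ (hf 0) κ).congr (fun s n hn => ?_) fun t n hn => ?_,
    fun _ => (blockOptimal_rotated τ hτ (hf 1) κ).congr (fun s n hn => ?_) fun t n hn => ?_⟩
  · rw [shiftedFamily, hL, ← rotatedVec_ofNat e _ _ hn]
    fin_cases s <;> rfl
  · rw [shiftedFamily, hR, ← rotatedVec_ofNat e _ _ hn]
    fin_cases t <;> rfl
  · rw [shiftedFamily, hL, ← rotatedVec_ofNat e _ _ hn]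
    fin_cases s
    · simp only [Fin.zero_eta, Matrix.cons_val_zero, h0]
      rfl
    · rfl
  · rw [shiftedFamily, hR, ← rotatedVec_ofNat e _ _ hn]
    fin_cases t <;> rfl

end AbstractIdeal

section IdealStrategy

set_option linter.unusedSectionVars false

variable {E F : Type*} [NormedAddCommGroup E] [InnerProductSpace ℂ E] [CompleteSpace E]
  [NormedAddCommGroup F] [InnerProductSpace ℂ F] [CompleteSpace F]
  {d : ℕ} [NeZero d]

/-- The tensor product of vectors, as a bilinear map. -/
def pureTensorBilin (E F : Type*) [NormedAddCommGroup E] [InnerProductSpace ℂ E]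
    [NormedAddCommGroup F] [InnerProductSpace ℂ F] : E →ₗ[ℂ] F →ₗ[ℂ] HilbertTensor E F :=
  LinearMap.mk₂ ℂ pureTensor pureTensor_add_left pureTensor_smul_left pureTensor_add_right
    pureTensor_smul_right

theorem pureTensorBilin_apply (x : E) (y : F) : pureTensorBilin E F x y = pureTensor x y := rfl

/-- The measurement in an orthonormal family. -/
def vecProj (w : Fin d → E) (i : Fin d) : E →L[ℂ] E := InnerProductSpace.rankOne ℂ (w i) (w i)

theorem orthonormal_rotatedVec {e : Fin d → E} (he : Orthonormal ℂ e) (φ : ℝ) (k : ℕ) :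
    Orthonormal ℂ (rotatedVec e φ k) := by
  rw [orthonormal_iff_ite] at he ⊢
  intro i j
  rw [rotatedVec, rotatedVec, inner_rotated (fun n hn n' hn' hne => ?_) (fun n hn => ?_)
    (unshift_lt k i) (unshift_lt k j)]
  · refine if_congr ⟨fun h => ?_, fun h => by rw [h]⟩ rfl rfl
    rw [← ofNat_unshift_add k i, h, ofNat_unshift_add]
  · rw [he, if_neg]
    exact fun h => hne ((Fin.ofNat_add_inj_of_lt hn hn').mp h)
  · rw [he, if_pos rfl]

theorem isProjectiveMeasurement_vecProj (e : OrthonormalBasis (Fin d) ℂ E) {w : Fin d → E}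
    (hw : Orthonormal ℂ w) : IsProjectiveMeasurement (vecProj w) := by
  have : FiniteDimensional ℂ E := Module.Basis.finiteDimensional_of_finite e.toBasis
  have hcard : Fintype.card (Fin d) = Module.finrank ℂ E :=
    (Module.finrank_eq_card_basis e.toBasis).symm
  have hcoe : ⇑(basisOfOrthonormalOfCardEqFinrank hw hcard) = w :=
    coe_basisOfOrthonormalOfCardEqFinrank hw hcard
  let b := (basisOfOrthonormalOfCardEqFinrank hw hcard).toOrthonormalBasis (by rwa [hcoe])
  have hb : ⇑b = w := (Module.Basis.coe_toOrthonormalBasis _ _).trans hcoe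
  refine ⟨fun i => InnerProductSpace.isStarProjection_rankOne_self (hw.1 i), fun i j hij => ?_, ?_⟩
  · ext x
    simp [vecProj, hw.2 hij]
  · have := b.sum_rankOne_eq_id
    rw [hb] at this
    exact this

/-- The rotations have real coefficients. Coordinates in the basis `e` therefore stay real, and no
conjugate appears when a vector is moved across the entangled state. -/
theorem inner_rotated_symm {f : ℕ → E} {g : E} (h : ∀ n, inner ℂ (f n) g = inner ℂ g (f n))
    (φ : ℝ) (n : ℕ) : inner ℂ (rotated d φ f n) g = inner ℂ g (rotated d φ f n) := by
  rw [rotated]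
  split_ifs
  · simp only [inner_add_left, inner_add_right, inner_smul_left, inner_smul_right,
      Complex.conj_ofReal, h]
  · exact h n

theorem inner_rotatedVec_symm {e : Fin d → E} (he : Orthonormal ℂ e) (φ : ℝ) (k : ℕ) (i j : Fin d) :
    inner ℂ (rotatedVec e φ k i) (e j) = inner ℂ (e j) (rotatedVec e φ k i) := by
  refine inner_rotated_symm (fun n => ?_) _ _
  rw [orthonormal_iff_ite] at he
  rw [he, he]
  exact if_congr eq_comm rfl rfl

/-- The maximally entangled state of two copies of a `d`-dimensional space. -/
def entangledVec (e : Fin d → E) : HilbertTensor E E :=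
  ((Real.sqrt d : ℂ))⁻¹ • ∑ i, pureTensor (e i) (e i)

theorem norm_entangledVec {e : Fin d → E} (he : Orthonormal ℂ e) : ‖entangledVec e‖ = 1 := by
  rw [orthonormal_iff_ite] at he
  have hd : (0 : ℝ) < d := Nat.cast_pos.mpr (Nat.pos_of_ne_zero (NeZero.ne d))
  have h : inner ℂ (entangledVec e) (entangledVec e) = (1 : ℂ) := by
    simp only [entangledVec, inner_smul_left, inner_smul_right, sum_inner, inner_sum,
      inner_pureTensor, he]
    simp only [mul_ite, mul_one, mul_zero, Finset.sum_ite_eq',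
      Finset.mem_univ, if_true, Finset.sum_const, Finset.card_univ, Fintype.card_fin, nsmul_eq_mul,
      map_inv₀, Complex.conj_ofReal]
    have : (Real.sqrt d : ℂ) * Real.sqrt d = d := by
      rw [← Complex.ofReal_mul, Real.mul_self_sqrt hd.le, Complex.ofReal_natCast]
    have h0 : (Real.sqrt d : ℂ) ≠ 0 := by
      rw [Complex.ofReal_ne_zero]
      positivity
    rw [← this]
    field_simp
  have h2 := norm_sq_eq_re_inner (𝕜 := ℂ) (entangledVec e)
  rw [h, RCLike.one_re] at h2
  exact (pow_eq_one_iff_of_nonneg (norm_nonneg _) two_ne_zero).mp h2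

/-- `∑ⱼ ⟪w, eⱼ⟫ w ⊗ eⱼ` equals `w ⊗ w` because the coordinates of `w` are real. The second party
gets the same vector. -/
theorem leftRep_vecProj_entangledVec (e : OrthonormalBasis (Fin d) ℂ E) {w : Fin d → E}
    (hw : ∀ i j, inner ℂ (w i) (e j) = inner ℂ (e j) (w i)) (i : Fin d) :
    leftRep E E (vecProj w i) (entangledVec e) =
      ((Real.sqrt d : ℂ))⁻¹ • pureTensorBilin E E (w i) (w i) := by
  rw [entangledVec, map_smul, map_sum]
  congr 1
  conv_rhs => rw [← congrArg (pureTensorBilin E E (w i)) (e.sum_repr' (w i)), map_sum]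
  refine Finset.sum_congr rfl fun j _ => ?_
  rw [leftRep_apply, opTensor_pureTensor, vecProj, InnerProductSpace.rankOne_apply, map_smul,
    pureTensor_smul_left, hw, pureTensorBilin_apply]
  rfl

theorem rightRep_vecProj_entangledVec (e : OrthonormalBasis (Fin d) ℂ E) {w : Fin d → E}
    (hw : ∀ i j, inner ℂ (w i) (e j) = inner ℂ (e j) (w i)) (i : Fin d) :
    rightRep E E (vecProj w i) (entangledVec e) =
      ((Real.sqrt d : ℂ))⁻¹ • pureTensorBilin E E (w i) (w i) := by
  rw [entangledVec, map_smul, map_sum]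
  congr 1
  conv_rhs => rw [← congrArg (fun z => pureTensorBilin E E z (w i)) (e.sum_repr' (w i)), map_sum,
    LinearMap.sum_apply]
  refine Finset.sum_congr rfl fun j _ => ?_
  rw [rightRep_apply, opTensor_pureTensor, vecProj, InnerProductSpace.rankOne_apply, map_smul,
    LinearMap.smul_apply, pureTensor_smul_right, hw, pureTensorBilin_apply]
  rfl

theorem orthonormal_leftVec {e : Fin d → E} (he : Orthonormal ℂ e) (x : Fin 3) :
    Orthonormal ℂ (leftVec e x) := by
  fin_cases x <;> exact orthonormal_rotatedVec he _ _

theorem orthonormal_rightVec {e : Fin d → E} (he : Orthonormal ℂ e) (y : Fin 4) :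
    Orthonormal ℂ (rightVec e y) := by
  fin_cases y <;> exact orthonormal_rotatedVec he _ _

theorem inner_leftVec_symm {e : Fin d → E} (he : Orthonormal ℂ e) (x : Fin 3) (i j : Fin d) :
    inner ℂ (leftVec e x i) (e j) = inner ℂ (e j) (leftVec e x i) := by
  fin_cases x <;> exact inner_rotatedVec_symm he _ _ i j

theorem inner_rightVec_symm {e : Fin d → E} (he : Orthonormal ℂ e) (y : Fin 4) (i j : Fin d) :
    inner ℂ (rightVec e y i) (e j) = inner ℂ (e j) (rightVec e y i) := by
  fin_cases y <;> exact inner_rotatedVec_symm he _ _ i j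

theorem optimalPair_vecProj (e : OrthonormalBasis (Fin d) ℂ E) :
    OptimalPair (leftRep E E) (rightRep E E) (entangledVec e) (fun x => vecProj (leftVec e x))
      (fun y => vecProj (rightVec e y)) :=
  OptimalPair.of_rotated
    (fun x k => (isProjectiveMeasurement_vecProj e (orthonormal_leftVec e.orthonormal x)).isPVM k)
    (fun y k => (isProjectiveMeasurement_vecProj e (orthonormal_rightVec e.orthonormal y)).isPVM k)
    (pureTensorBilin E E) (fun x y x' y' => inner_pureTensor x x' y y') e.orthonormal _
    (fun x a => leftRep_vecProj_entangledVec e (inner_leftVec_symm e.orthonormal x) a)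
    (fun y b => rightRep_vecProj_entangledVec e (inner_rightVec_symm e.orthonormal y) b)

/-- An orthonormal basis of a `d`-dimensional space in a given universe. -/
def liftedBasis (d : ℕ) : OrthonormalBasis (Fin d) ℂ (EuclideanSpace ℂ (ULift.{u} (Fin d))) :=
  (EuclideanSpace.basisFun _ ℂ).reindex Equiv.ulift

/-- The strategy attaining the quantum bound. -/
def idealStrategy (d : ℕ) [NeZero d] : QuantumStrategy.{u} (Fin 3) (Fin 4) (Fin d) (Fin d) where
  HA := EuclideanSpace ℂ (ULift.{u} (Fin d))
  HB := EuclideanSpace ℂ (ULift.{u} (Fin d))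
  ψ := entangledVec (liftedBasis d)
  norm_ψ := norm_entangledVec (liftedBasis d).orthonormal
  PA x := vecProj (leftVec (liftedBasis d) x)
  PB y := vecProj (rightVec (liftedBasis d) y)
  isMeasA x := isProjectiveMeasurement_vecProj (liftedBasis d)
    (orthonormal_leftVec (liftedBasis d).orthonormal x)
  isMeasB y := isProjectiveMeasurement_vecProj (liftedBasis d)
    (orthonormal_rightVec (liftedBasis d).orthonormal y)

theorem optimalPair_idealStrategy (d : ℕ) [NeZero d] :
    OptimalPair (leftRep (idealStrategy.{u} d).HA (idealStrategy.{u} d).HB)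
      (rightRep (idealStrategy.{u} d).HA (idealStrategy.{u} d).HB)
      (idealStrategy.{u} d).ψ (idealStrategy.{u} d).PA (idealStrategy.{u} d).PB :=
  optimalPair_vecProj (liftedBasis.{u} d)

end IdealStrategy

end

/-! ### Conclusion for quantum strategies. -/

noncomputable section

namespace QuantumStrategy

variable {d : ℕ} [NeZero d] (S : QuantumStrategy.{u} (Fin 3) (Fin 4) (Fin d) (Fin d))

/-- The correlation produced by a strategy. -/
def correlation : Correlation (Fin 3) (Fin 4) (Fin d) (Fin d) :=
  commutingCorrelation (leftRep S.HA S.HB) (rightRep S.HA S.HB) S.ψ S.PA S.PB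

theorem isCommutingStrategy :
    IsCommutingStrategy (leftRep S.HA S.HB) (rightRep S.HA S.HB) S.ψ S.PA S.PB :=
  ⟨leftRep_commute_rightRep, S.norm_ψ, fun x k => (S.isMeasA x).isPVM k,
    fun y k => (S.isMeasB y).isPVM k⟩

theorem produces_iff {p : Correlation (Fin 3) (Fin 4) (Fin d) (Fin d)} :
    S.Produces p ↔ p = S.correlation := by
  have key : ∀ x y a b, inner ℂ S.ψ (opTensor (S.PA x a) (S.PB y b) S.ψ) =
      (S.correlation x y a b : ℂ) := fun x y a b => by
    rw [← leftRep_mul_rightRep]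
    exact S.isCommutingStrategy.inner_eq x y a b
  refine ⟨fun h => ?_, fun h => h ▸ key⟩
  funext x y a b
  exact Complex.ofReal_injective ((h x y a b).symm.trans (key x y a b))

theorem correlation_mem_Cq : S.correlation ∈ Cq.{u} 3 4 d d := ⟨S, S.produces_iff.mpr rfl⟩

/-- The relations satisfied by a strategy that attains the quantum bound. -/
abbrev IsOptimal : Prop :=
  OptimalPair (leftRep S.HA S.HB) (rightRep S.HA S.HB) S.ψ S.PA S.PB

theorem bell_correlation_eq_iff (hd : 2 ≤ d) {ε : ℝ} (hε : 0 < ε) :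
    bell ε S.correlation = quantumBound d ↔ S.IsOptimal :=
  S.isCommutingStrategy.bell_eq_iff hε hd

theorem bell_correlation_le (hd : 2 ≤ d) {ε : ℝ} (hε : 0 < ε) :
    bell ε S.correlation ≤ quantumBound d :=
  S.isCommutingStrategy.bell_le hε hd

variable {S}

theorem IsOptimal.correlation_eq (h : S.IsOptimal) (hd : 2 ≤ d) {x : Fin 3}
    (hx : x = 0 ∨ x = 1 ∨ 2 < d) {y : Fin 4} (hy : y = 0 ∨ y = 1 ∨ 2 < d) (a b : Fin d) :
    S.correlation x y a b = (leftCombo x a).pairing (rightCombo y b) := by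
  obtain ⟨πA, hA⟩ := exists_isSupport_left S.ψ
  obtain ⟨πB, hB⟩ := exists_isSupport_right S.ψ
  exact OptimalPair.correlation_eq h S.isCommutingStrategy.commute S.norm_ψ hA hB hd hx hy a b

theorem IsOptimal.selfTestsState (h : S.IsOptimal) :
    ∃ (KA : Type u) (_ : NormedAddCommGroup KA) (_ : InnerProductSpace ℂ KA)
      (_ : CompleteSpace KA)
      (KB : Type u) (_ : NormedAddCommGroup KB) (_ : InnerProductSpace ℂ KB)
      (_ : CompleteSpace KB)
      (ΦA : S.HA →ₗᵢ[ℂ] Qudit d ⊗[ℂ] KA) (ΦB : S.HB →ₗᵢ[ℂ] Qudit d ⊗[ℂ] KB)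
      (aux : HilbertTensor KA KB),
      ‖aux‖ = 1 ∧ opTensor ΦA.toContinuousLinearMap ΦB.toContinuousLinearMap S.ψ =
        withAux (maxEntangled d) aux := by
  obtain ⟨πA, hA⟩ := exists_isSupport_left S.ψ
  obtain ⟨πB, hB⟩ := exists_isSupport_right S.ψ
  obtain ⟨_, _, hm⟩ := OptimalPair.exists_mirrorSystem S.isCommutingStrategy.commute h hA hB
  obtain ⟨ΦA, ΦB, aux, h1, h2⟩ := hm.exists_isometries S.norm_ψ
  exact ⟨S.HA, _, _, inferInstance, S.HB, _, _, inferInstance, ΦA, ΦB, aux, h1, h2⟩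

theorem isOptimal_idealStrategy (d : ℕ) [NeZero d] : (idealStrategy.{u} d).IsOptimal :=
  optimalPair_idealStrategy d

end QuantumStrategy

end

theorem theorem3 (d : ℕ) [NeZero d] (hd : 2 ≤ d) (ε : ℝ) (hε : 0 < ε) :
    IsGreatest (bell ε '' Cq.{u} 3 4 d d) (quantumBound d) ∧
    (2 < d → ∃! p : Correlation (Fin 3) (Fin 4) (Fin d) (Fin d),
      p ∈ Cq.{u} 3 4 d d ∧ bell ε p = quantumBound d) ∧
    (d = 2 → ∃! r : Correlation (Fin 2) (Fin 2) (Fin d) (Fin d),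
      ∃ p ∈ Cq.{u} 3 4 d d, bell ε p = quantumBound d ∧ restrict01 p = r) ∧
    (∀ p ∈ Cq.{u} 3 4 d d, bell ε p = quantumBound d →
      SelfTestsState.{u} p (maxEntangled d)) := by
  have hideal := QuantumStrategy.isOptimal_idealStrategy.{u} d
  have hmem := (idealStrategy.{u} d).correlation_mem_Cq
  have hbell := ((idealStrategy.{u} d).bell_correlation_eq_iff hd hε).mpr hideal
  refine ⟨⟨⟨_, hmem, hbell⟩, ?_⟩, fun hlt => ⟨_, ⟨hmem, hbell⟩, ?_⟩,
    fun _ => ⟨_, ⟨_, hmem, hbell, rfl⟩, ?_⟩, ?_⟩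
  · rintro _ ⟨p, ⟨S, hS⟩, rfl⟩
    rw [S.produces_iff.mp hS]
    exact S.bell_correlation_le hd hε
  · rintro p ⟨⟨S, hS⟩, hp⟩
    obtain rfl := S.produces_iff.mp hS
    have h := (S.bell_correlation_eq_iff hd hε).mp hp
    -- Both correlations equal the same pairing of coefficients, which does not depend on the
    -- strategy.
    funext x y a b
    rw [h.correlation_eq hd (by simp [hlt]) (by simp [hlt]),
      hideal.correlation_eq hd (by simp [hlt]) (by simp [hlt])]
  · rintro _ ⟨p, ⟨S, hS⟩, hp, rfl⟩
    obtain rfl := S.produces_iff.mp hS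
    have h := (S.bell_correlation_eq_iff hd hε).mp hp
    funext s t a b
    have hs : (![0, 1] : Fin 2 → Fin 3) s = 0 ∨ (![0, 1] : Fin 2 → Fin 3) s = 1 ∨ 2 < d := by
      fin_cases s <;> simp
    have ht : (![0, 1] : Fin 2 → Fin 4) t = 0 ∨ (![0, 1] : Fin 2 → Fin 4) t = 1 ∨ 2 < d := by
      fin_cases t <;> simp
    rw [restrict01, restrict01, h.correlation_eq hd hs ht, hideal.correlation_eq hd hs ht]
  · rintro p - hp S hS
    obtain rfl := S.produces_iff.mp hS
    exact ((S.bell_correlation_eq_iff hd hε).mp hp).selfTestsState
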